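/- **Setting.** Let $\mathcal M=(x_1,\dots,x_n)$ be a finite sequence of elements of a linearly ordered set (repetitions allowed). Its *runs* are its maximal nondecreasing subsequences of consecutive entries; let $\rho$ be their number. Two elements of the same run belong to the same *block* if they have equal values, or if no element of another run has its value in the closed interval spanned by their values. The query $\mathtt{select}(r)$, $1\le r\le n$, asks for the $r$-th smallest element, counted with multiplicity. The cost is the number of comparisons "$x\le y$?" between elements. Logarithms are to base 2, and $0\log 0=0$. **Algorithm Quick Synergy MultiSelection.** Find the runs by a linear scan. Then process recursively a collection of nonempty (pieces of) runs with the queries that fall into it; stop if there are no such queries. Otherwise: 1. Compute the pivot $\mu$, the median of the middle elements of the runs, by worst-case linear-time selection; let $j$ be the run that contains it. 2. Find by doubling searches, started in parallel at both ends, the boundaries in every other run between the elements smaller than, equal to, and greater than $\mu$. 3. Find the maximum $\max_\ell$ of the smaller elements and the minimum $\min_r$ of the greater elements in the runs other than $j$, and locate $\max_\ell$ and $\min_r$ in run $j$ by doubling searches that start at the position of $\mu$ (if $\max_\ell$ or $\min_r$ does not exist, the corresponding part of run $j$ reaches to its end). 4. The ranks of all elements of run $j$ strictly between $\max_\ell$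 and $\min_r$, and of all elements equal to $\mu$, are now known; answer the queries that hit them. Recurse on the elements at most $\max_\ell$ and on the elements at least $\min_r$, each with the queries that fall into that part. **Parameters.** Let $r_1\le\dots\le r_q$ be ranks in $\{1,\dots,n\}$, and let $\xi$ be the number of pivots that the algorithm computes while answering $\mathtt{select}(r_1),\dots,\mathtt{select}(r_q)$. The *pivot blocks* are the blocks that contain an element with the value of a pivot. The *selection blocks* are the pivot blocks together with, for each run and each $i\in\{0,\dots,\xi\}$, the set of the elements of the run that lie in no pivot block and have their values between the $i$-th and the $(i+1)$-st pivot in sorted order (below all pivots for $i=0$, above all pivots for $i=\xi$), whenever this set is nonempty. Let $\beta$ be the number of selection blocks and $s_1,\dots,s_\beta$ their sizes. Let $m_1,\dots,m_\lambda$ be the numbers of pivot blocks that contain the values of the $\lambda$ pivots whose value occurs more than once in $\mathcal M$. For $0\le i\le\xi$ let $\rho_i$ be the number of runs that have elements with values strictly between the $i$-th and the $(i+1)$-st pivot, with the same conventions for $i=0$ and $i=\xi$. Put $r_0=0$, $r_{q+1}=n$, and $\Delta_i=r_{i+1}-r_i$ for $0\le i\le q$. **Theorem (Quick Synergy MultiSelection).**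 The algorithm answers the $q$ select queries correctly and performs $$O\Bigl(n+\sum_{i=1}^{\beta}\log s_i+\beta\log\rho-\sum_{i=1}^{\lambda}m_i\log m_i-\sum_{i=0}^{\xi}\rho_i\log\rho_i\Bigr)\subseteq O\Bigl(n+n\log n-\sum_{i=0}^{q}\Delta_i\log\Delta_i\Bigr)$$ data comparisons: there is an absolute constant $C>0$ such that, for every input and every choice of queries, the number of comparisons is at most $C$ times the first expression in parentheses, and that expression is at most $C$ times the second. -/

import Mathlib

namespace QSMS

/-! ### The comparison model -/

/-- A comparison-based program with result in `α`, working on handles `i : ι` of data elements.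
The data can be inspected only through the questions `ask i j`: "is element `i` at most
element `j`?". -/
inductive Cmp (ι α : Type) : Type
  | ret (x : α) : Cmp ι α
  | ask (i j : ι) (k : Bool → Cmp ι α) : Cmp ι α

namespace Cmp

variable {ι α β : Type}

/-- Sequential composition. -/
def bind : Cmp ι α → (α → Cmp ι β) → Cmp ι β
  | ret x, f => f x
  | ask i j k, f => ask i j (fun b => (k b).bind f)

instance : Monad (Cmp ι) where
  pure := ret
  bind := bind

/-- The result of the program when the questions are answered by `le`. -/
def eval (le : ι → ι → Bool) : Cmp ι α → α
  | ret x => x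
  | ask i j k => (k (le i j)).eval le

/-- The number of data comparisons performed when the questions are answered by `le`. -/
def cost (le : ι → ι → Bool) : Cmp ι α → ℕ
  | ret _ => 0
  | ask i j k => (k (le i j)).cost le + 1

end Cmp

section Algorithm

variable {ι : Type}

/-- Is element `i` at most element `j`? (one comparison) -/
def leq (i j : ι) : Cmp ι Bool := Cmp.ask i j Cmp.ret

/-- Is element `i` smaller than element `j`? (one comparison) -/
def less (i j : ι) : Cmp ι Bool := do
  let b ← leq j i
  return !b

/-- Linear scan that cuts the input into its maximal nondecreasing runs. -/
def detectRuns : List ι → Cmp ι (List (List ι))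
  | [] => return []
  | [x] => return [[x]]
  | x :: y :: t => do
    let b ← leq x y
    let rs ← detectRuns (y :: t)
    match b, rs with
    | true, r :: rs => return (x :: r) :: rs
    | _, rs => return [x] :: rs

/-! #### Linear selection (groups of five, median of the medians), used for the median of the
middles -/

/-- Insertion into a sorted list. -/
def insertC (x : ι) : List ι → Cmp ι (List ι)
  | [] => return [x]
  | y :: ys => do
    let b ← leq x y
    if b then return x :: y :: ys
    else do
      let zs ← insertC x ys
      return y :: zs

/-- Insertion sort. -/
def sortC : List ι → Cmp ι (List ι)
  | [] => return []
  | x :: xs => do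
    let ys ← sortC xs
    insertC x ys

/-- Cut a list into groups of five; the last group may be shorter. -/
def groups : List ι → List (List ι)
  | [] => []
  | a :: b :: c :: d :: e :: t => [a, b, c, d, e] :: groups t
  | l => [l]

/-- The medians of the given groups. -/
def medians : List (List ι) → Cmp ι (List ι)
  | [] => return []
  | g :: gs => do
    let s ← sortC g
    let ms ← medians gs
    return s[s.length / 2]?.toList ++ ms

/-- Three-way partition of a list by the value of `p`: smaller, equal, greater. -/
def partition (p : ι) : List ι → Cmp ι (List ι × List ι × List ι)
  | [] => return ([], [], [])
  | x :: xs => do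
    let (l, e, g) ← partition p xs
    let b ← leq x p
    if b then do
      let c ← leq p x
      if c then return (l, x :: e, g) else return (x :: l, e, g)
    else return (l, e, x :: g)

/-- `select fuel l k` finds the element of `l` of (0-based) rank `k`. -/
def select : ℕ → List ι → ℕ → Cmp ι (Option ι)
  | 0, _, _ => return none
  | fuel + 1, l, k =>
    if l.length ≤ 50 then do
      let s ← sortC l
      return s[k]?
    else do
      let ms ← medians (groups l)
      let p ← select fuel ms (ms.length / 2)
      match p with
      | none => return none
      | some p => do
        let (s, e, g) ← partition p l
        if k < s.length then select fuel s k
        else if k < s.length + e.length then return some p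
        else select fuel g (k - (s.length + e.length))

/-- The median of the middle elements of the runs. -/
def medianOfMiddles (runs : List (List ι)) : Cmp ι (Option ι) :=
  let middles := runs.filterMap fun r => r[r.length / 2]?
  select (middles.length + 1) middles (middles.length / 2)

/-! #### Searches in sorted lists

`test` is assumed to be true on an initial segment of the positions of the sorted list only; the
searches find the length of that segment. -/

/-- Apply a test to the entry of `l` at position `m`. -/
def testAt (test : ι → Cmp ι Bool) (l : List ι) (m : ℕ) : Cmp ι Bool :=
  match l[m]? with
  | some x => test x
  | none => return false

/-- Binary search between `lo` and `hi`. -/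
def bisect (test : ℕ → Cmp ι Bool) (lo hi : ℕ) : Cmp ι ℕ :=
  if h : lo < hi then do
    let b ← test ((lo + hi) / 2)
    if b then bisect test ((lo + hi) / 2 + 1) hi
    else bisect test lo ((lo + hi) / 2)
  else return lo
termination_by hi - lo

/-- Doubling search between `lo` and `hi` starting at `lo`, with current step `2 ^ i`. -/
def doubling (test : ℕ → Cmp ι Bool) (lo hi i : ℕ) : Cmp ι ℕ :=
  if h : lo + 2 ^ i ≤ hi then do
    let b ← test (lo + 2 ^ i - 1)
    if b then doubling test (lo + 2 ^ i) hi (i + 1)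
    else bisect test lo (lo + 2 ^ i - 1)
  else bisect test lo hi
termination_by hi - lo
decreasing_by
  have := Nat.one_le_two_pow (n := i)
  omega

/-- Two doubling searches between `lo` and `hi`, starting at both ends and run in parallel, with
current step `2 ^ i`. -/
def doublingBoth (test : ℕ → Cmp ι Bool) (lo hi i : ℕ) : Cmp ι ℕ :=
  if h : lo + 2 ^ i ≤ hi then do
    let b ← test (lo + 2 ^ i - 1)
    if b then
      if h' : lo + 2 ^ i + 2 ^ i ≤ hi then do
        let c ← test (hi - 2 ^ i)
        if c then bisect test (hi - 2 ^ i + 1) hi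
        else doublingBoth test (lo + 2 ^ i) (hi - 2 ^ i) (i + 1)
      else bisect test (lo + 2 ^ i) hi
    else bisect test lo (lo + 2 ^ i - 1)
  else bisect test lo hi
termination_by hi - lo
decreasing_by
  have := Nat.one_le_two_pow (n := i)
  omega

/-! #### The steps of the algorithm -/

/-- Split a run by the pivot `μ` (of another run) into the elements smaller than, equal to and
greater than `μ`. -/
def splitRun (μ : ι) (r : List ι) : Cmp ι (List ι × List ι × List ι) := do
  let i ← doublingBoth (testAt (fun x => less x μ) r) 0 r.length 0
  let j ← doublingBoth (testAt (fun x => leq x μ) r) 0 r.length 0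
  return (r.take i, (r.take j).drop i, r.drop j)

/-- Split each of the given runs by the pivot `μ`. -/
def splitRuns (μ : ι) : List (List ι) → Cmp ι (List (List ι × List ι × List ι))
  | [] => return []
  | r :: rs => do
    let p ← splitRun μ r
    let ps ← splitRuns μ rs
    return p :: ps

/-- A maximum of a list. -/
def maxC : List ι → Cmp ι (Option ι)
  | [] => return none
  | x :: xs => do
    let m ← maxC xs
    match m with
    | none => return some x
    | some y => do
      let b ← leq x y
      if b then return some y else return some x

/-- A minimum of a list. -/
def minC : List ι → Cmp ι (Option ι)
  | [] => return none
  | x :: xs => do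
    let m ← minC xs
    match m with
    | none => return some x
    | some y => do
      let b ← leq x y
      if b then return some x else return some y

/-- The number of elements at the beginning of `l` (whose entries increase) that are smaller than
`m`, by a doubling search; all of them if there is no bound `m`. -/
def countBelow (m : Option ι) (l : List ι) : Cmp ι ℕ :=
  match m with
  | none => return l.length
  | some m => doubling (testAt (fun x => less x m) l) 0 l.length 0

/-- The number of elements at the beginning of `l` (whose entries decrease) that are greater than
`m`, by a doubling search; all of them if there is no bound `m`. -/
def countAbove (m : Option ι) (l : List ι) : Cmp ι ℕ :=
  match m with
  | none => return l.length
  | some m => doubling (testAt (fun x => less m x) l) 0 l.length 0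

/-- What the recursion returns: `answer k` is the element of (1-based) rank `k` when `k` is one of
the queries, and `pivots` is the list of the pivots that were computed. -/
structure Output (ι : Type) where
  answer : ℕ → Option ι
  pivots : List ι

/-- The recursion of Quick Synergy MultiSelection on the (pieces of the) runs of a sub-instance,
with the list `Q` of the (1-based) query ranks inside the sub-instance. -/
def multiSelectRuns [DecidableEq ι] : ℕ → List (List ι) → List ℕ → Cmp ι (Output ι)
  | 0, _, _ => return ⟨fun _ => none, []⟩
  | fuel + 1, runs, Q =>
    if Q.isEmpty then return ⟨fun _ => none, []⟩
    else do
      let μ ← medianOfMiddles runs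
      match μ with
      | none => return ⟨fun _ => none, []⟩
      | some μ => do
        -- the run that contains the pivot, and the other runs
        let rj := (runs.filter fun r => μ ∈ r).flatten
        let parts ← splitRuns μ (runs.filter fun r => μ ∉ r)
        -- greatest smaller and smallest greater element in the other runs
        let maxl ← maxC (parts.filterMap fun p => p.1.getLast?)
        let minr ← minC (parts.filterMap fun p => p.2.2.head?)
        -- searches for them in the run of the pivot, starting at the pivot
        let before := rj.take (rj.idxOf μ)
        let after := rj.drop (rj.idxOf μ + 1)
        let i ← countAbove maxl before.reverse
        let j ← countBelow minr after
        -- the two sub-instances, and the elements between them in sorted order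
        let left := (before.take (before.length - i) :: parts.map fun p => p.1).filter
          fun r => !r.isEmpty
        let right := (after.drop j :: parts.map fun p => p.2.2).filter fun r => !r.isEmpty
        let mid := before.drop (before.length - i) ++
          μ :: (parts.map fun p => p.2.1).flatten ++ after.take j
        let nl := left.flatten.length
        let nm := nl + mid.length
        let outl ← multiSelectRuns fuel left (Q.filter fun k => k ≤ nl)
        let outr ← multiSelectRuns fuel right ((Q.filter fun k => nm < k).map fun k => k - nm)
        return ⟨fun k =>
            if k ≤ nl then outl.answer k
            else if k ≤ nm then mid[k - nl - 1]?
            else outr.answer (k - nm),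
          outl.pivots ++ μ :: outr.pivots⟩

/-- Quick Synergy MultiSelection on the input sequence `xs` with the list `Q` of (1-based) query
ranks. It returns the list of the answers to the queries, and the list of the pivots computed. -/
def quickSynergyMultiSelection [DecidableEq ι] (xs : List ι) (Q : List ℕ) :
    Cmp ι (List (Option ι) × List ι) := do
  let runs ← detectRuns xs
  let out ← multiSelectRuns xs.length runs Q
  return (Q.map out.answer, out.pivots)

end Algorithm

/-! ### Parameters of an instance -/

section Parameters

variable {α : Type*} [LinearOrder α] {n : ℕ}

/-- The data comparisons on the input sequence `a 0, …, a (n - 1)`. -/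
def cmpOf (a : Fin n → α) (i j : Fin n) : Bool := decide (a i ≤ a j)

/-- The element at position `p` is an element of (1-based) rank `k`, i.e. a correct answer to
the query `select k`. -/
def HasRank (a : Fin n → α) (k : ℕ) (p : Fin n) : Prop :=
  (Finset.univ.filter fun t => a t < a p).card < k ∧
    k ≤ (Finset.univ.filter fun t => a t ≤ a p).card

/-- The (0-based) index of the maximal nondecreasing run that contains position `p`: the number of
descents up to `p`. -/
def runOf (a : Fin n → α) (p : Fin n) : ℕ :=
  (Finset.univ.filter fun k : Fin n => k ≤ p ∧ ∃ j : Fin n, (j : ℕ) + 1 = k ∧ a k < a j).card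

/-- The number `ρ` of runs. -/
def numRuns (a : Fin n → α) : ℕ := (Finset.univ.image (runOf a)).card

/-- Positions `p` and `t` are in the same block: they are in the same run and either carry the same
value, or no element of another run has its value in the closed interval that they span. -/
def SameBlock (a : Fin n → α) (p t : Fin n) : Prop :=
  runOf a p = runOf a t ∧
    (a p = a t ∨ ∀ s, runOf a s ≠ runOf a p → ¬(min (a p) (a t) ≤ a s ∧ a s ≤ max (a p) (a t)))

instance (a : Fin n → α) (p t : Fin n) : Decidable (SameBlock a p t) := by
  unfold SameBlock
  infer_instance

/-- The block that contains position `p`. -/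
def blockOf (a : Fin n → α) (p : Fin n) : Finset (Fin n) :=
  Finset.univ.filter fun t => SameBlock a p t

/-- The blocks of the input. -/
def blocks (a : Fin n → α) : Finset (Finset (Fin n)) := Finset.univ.image (blockOf a)

/-- The blocks that contain an element of value `v`. -/
def blocksOfValue (a : Fin n → α) (v : α) : Finset (Finset (Fin n)) :=
  (blocks a).filter fun B => ∃ p ∈ B, a p = v

/-- The pivot blocks for the set `P` of pivot values. -/
def pivotBlocks (a : Fin n → α) (P : Finset α) : Finset (Finset (Fin n)) :=
  P.biUnion (blocksOfValue a)

/-- The number of pivots smaller than the value `x`. A value that is not a pivot lies between the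
`i`-th and the `(i + 1)`-st pivot in sorted order exactly when this number is `i` (for `i = 0`: it
is below all pivots, for `i = P.card`: it is above all of them). -/
def gapOf (P : Finset α) (x : α) : ℕ := (P.filter fun v => v < x).card

/-- The selection block that contains position `p`: the block of `p` if that is a pivot block,
otherwise all elements of the run of `p` outside the pivot blocks that are between the same
pivots as `p`. -/
def selectionBlockOf (a : Fin n → α) (P : Finset α) (p : Fin n) : Finset (Fin n) :=
  if blockOf a p ∈ pivotBlocks a P then blockOf a p
  else Finset.univ.filter fun t =>
    runOf a t = runOf a p ∧ blockOf a t ∉ pivotBlocks a P ∧ gapOf P (a t) = gapOf P (a p)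

/-- The (nonempty) selection blocks for the set `P` of pivot values. -/
def selectionBlocks (a : Fin n → α) (P : Finset α) : Finset (Finset (Fin n)) :=
  Finset.univ.image (selectionBlockOf a P)

/-- The number `ρ_i` of runs that have elements with values (strictly) between the `i`-th and the
`(i + 1)`-st pivot. -/
def gapRuns (a : Fin n → α) (P : Finset α) (i : ℕ) : ℕ :=
  ((Finset.univ.filter fun p => a p ∉ P ∧ gapOf P (a p) = i).image (runOf a)).card

/-- The values in `P` that occur more than once in the input. -/
def repeated (a : Fin n → α) (P : Finset α) : Finset α :=
  P.filter fun v => 1 < (Finset.univ.filter fun p => a p = v).card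

/-- The set of the values of the pivots that Quick Synergy MultiSelection computes. -/
def pivotSet (a : Fin n → α) (Q : List ℕ) : Finset α :=
  (((quickSynergyMultiSelection (List.finRange n) Q).eval (cmpOf a)).2.map a).toFinset

/-- `n + ∑ log s_i + β log ρ - ∑ m_i log m_i - ∑ ρ_i log ρ_i` for the set `P` of pivot values. -/
noncomputable def synergyBound (a : Fin n → α) (P : Finset α) : ℝ :=
  (n : ℝ) + ∑ B ∈ selectionBlocks a P, Real.logb 2 B.card
    + (selectionBlocks a P).card * Real.logb 2 (numRuns a)
    - ∑ v ∈ repeated a P, (blocksOfValue a v).card * Real.logb 2 (blocksOfValue a v).card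
    - ∑ i ∈ Finset.range (P.card + 1), gapRuns a P i * Real.logb 2 (gapRuns a P i)

/-- The ranks `r_1, …, r_q` extended by `r_0 = 0` and `r_{q+1} = n`. -/
def extendedRank (n : ℕ) {q : ℕ} (r : Fin q → ℕ) (i : ℕ) : ℕ :=
  if i = 0 then 0 else if h : i - 1 < q then r ⟨i - 1, h⟩ else n

/-- `n + n log n - ∑ Δ_i log Δ_i` with `Δ_i = r_{i+1} - r_i`. -/
noncomputable def queryBound (n : ℕ) {q : ℕ} (r : Fin q → ℕ) : ℝ :=
  (n : ℝ) + n * Real.logb 2 n - ∑ i ∈ Finset.range (q + 1),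
    ((extendedRank n r (i + 1) : ℝ) - extendedRank n r i) *
      Real.logb 2 ((extendedRank n r (i + 1) : ℝ) - extendedRank n r i)

end Parameters

end QSMS

/-! A run of the algorithm is recorded as a binary `PivotTree`. A node is a sub-instance `S` with
its pivot, the children are `lowSide` and `highSide`, and a leaf is a sub-instance without queries.
A node with m runs costs O(m) for the median, the maximum and the minimum, plus logarithms for the
searches. So `multiSelectRuns_spec` reduces the cost bound to bounds for `runSum` and `searchSum`.
`runSum`: the tree cuts the runs into pieces, namely the runs in the leaves and, for each pivot, the
runs that contain its value. About half of the runs reach to either side of the pivot. Hence either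
a node creates many surplus pieces, or both children have at most 3m/4 runs, and then every piece
below loses a constant in the logarithm of the number of runs around it (`node_gain`). Summed up,
this is an entropy, pieces · log ρ - ∑ x log x, plus O(n) (`runSum_le`). `searchSum`: a run of
length x carries the potential 4 + 2 log x. Cutting it into x and y releases enough for a search
from the nearer end (`potential_add`); only the weights 1 + log of the final pieces remain
(`searchSum_le`). Selection blocks: no block crosses a boundary of the recursion, and a pivot block
stays inside the `middle` of its node. Therefore the leaf pieces and the pivot value pieces inject
into the selection blocks (`sum_leafRuns_add_le`), and a gap meets at most two runs more than its
leaf, those of the two adjacent pivots (`gapRuns_le`). The errors are O(n). They can be absorbed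
because lg x ≤ 2x/3 makes the subtracted terms lose at most 2n/3 in total (`excess_ge`), so that n
is at most three times the bound (`le_synergyBound`). Second inequality: the excess is at most three
times the entropy of the pieces relative to n, plus O(n) (`excess_le`). Fix the class of the V
elements strictly between two neighbouring queried values. After the first pivot inside the class,
the class is at the upper end of the left child and at the lower end of the right one. From then on
each pivot in the class turns one child into a leaf, and half of the runs lose half of their class
elements. The potential ∑_k √(number of runs with at least 2^k class elements) pays √m for this, so
the square roots of the piece numbers add up to O(√V) (`classSum_le`). Since x log(V/x) ≤ 2√(Vx),
the class has entropy at most V log(n/V) + O(V). Over all classes and queried values this is the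
entropy of the partition into labels. An interval of ranks between neighbouring queries meets at
most three labels (`card_labels_le`), which gives n log n - ∑ Δ_i log Δ_i + O(n). -/

namespace QSMS

set_option linter.unusedSectionVars false

/-! ### Evaluation and cost of comparison programs -/

namespace Cmp

variable {ι α β : Type} (le : ι → ι → Bool)

@[simp] theorem eval_ret (x : α) : (ret x : Cmp ι α).eval le = x := (rfl)

@[simp] theorem cost_ret (x : α) : (ret x : Cmp ι α).cost le = 0 := (rfl)

@[simp] theorem eval_pure (x : α) : (pure x : Cmp ι α).eval le = x := (rfl)

@[simp] theorem cost_pure (x : α) : (pure x : Cmp ι α).cost le = 0 := (rfl)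

@[simp] theorem eval_ask (i j : ι) (k : Bool → Cmp ι α) :
    (ask i j k).eval le = (k (le i j)).eval le := (rfl)

@[simp] theorem cost_ask (i j : ι) (k : Bool → Cmp ι α) :
    (ask i j k).cost le = (k (le i j)).cost le + 1 := (rfl)

@[simp] theorem eval_bind (c : Cmp ι α) (f : α → Cmp ι β) :
    (c >>= f).eval le = (f (c.eval le)).eval le := by
  change (c.bind f).eval le = _
  induction c with
  | ret x => rfl
  | ask i j k ih => exact ih _

@[simp] theorem cost_bind (c : Cmp ι α) (f : α → Cmp ι β) :
    (c >>= f).cost le = c.cost le + (f (c.eval le)).cost le := by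
  change (c.bind f).cost le = _
  induction c with
  | ret x => simp [bind]
  | ask i j k ih =>
    have := ih (le i j)
    simp only [bind, cost_ask, eval_ask, this]
    omega

@[simp] theorem eval_ite (p : Prop) [Decidable p] (c d : Cmp ι α) :
    (if p then c else d).eval le = if p then c.eval le else d.eval le := apply_ite _ _ _ _

@[simp] theorem cost_ite (p : Prop) [Decidable p] (c d : Cmp ι α) :
    (if p then c else d).cost le = if p then c.cost le else d.cost le := apply_ite _ _ _ _

end Cmp

/-- The answers to the comparisons of elements whose values are given by `a`. -/
def leOf {ι : Type} {α : Type*} [LinearOrder α] (a : ι → α) (i j : ι) : Bool :=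
  decide (a i ≤ a j)

section Basics

variable {ι : Type} {α : Type*} [LinearOrder α] (a : ι → α)

@[simp] theorem leq_eval (i j : ι) : (leq i j).eval (leOf a) = decide (a i ≤ a j) := (rfl)

@[simp] theorem leq_cost (le : ι → ι → Bool) (i j : ι) : (leq i j).cost le = 1 := (rfl)

@[simp] theorem less_eval (i j : ι) : (less i j).eval (leOf a) = decide (a i < a j) := by
  simp [less, ← not_le]

@[simp] theorem less_cost (le : ι → ι → Bool) (i j : ι) : (less i j).cost le = 1 := (rfl)

/-! ### Insertion sort -/

theorem insertC_perm (x : ι) (l : List ι) : ((insertC x l).eval (leOf a)).Perm (x :: l) := by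
  induction l with
  | nil => simp [insertC]
  | cons y ys ih =>
    simp only [insertC, Cmp.eval_bind, leq_eval, Cmp.eval_ite, Cmp.eval_pure]
    split
    · simp
    · simpa using (ih.cons y).trans (List.Perm.swap x y ys)

theorem insertC_sorted (x : ι) (l : List ι) (h : l.Pairwise (fun i j => a i ≤ a j)) :
    ((insertC x l).eval (leOf a)).Pairwise (fun i j => a i ≤ a j) := by
  induction l with
  | nil => simp [insertC]
  | cons y ys ih =>
    simp only [insertC, Cmp.eval_bind, leq_eval, Cmp.eval_ite, Cmp.eval_pure]
    rw [List.pairwise_cons] at h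
    split
    · next hxy =>
      have hxy : a x ≤ a y := by simpa using hxy
      simp only [List.pairwise_cons, List.mem_cons]
      exact ⟨fun z hz => hz.elim (fun e => e ▸ hxy) fun hz => hxy.trans (h.1 z hz), h⟩
    · next hxy =>
      have hxy : a y < a x := by simpa using hxy
      simp only [List.pairwise_cons]
      refine ⟨fun z hz => ?_, ih h.2⟩
      rcases List.mem_cons.1 ((insertC_perm a x ys).mem_iff.1 hz) with rfl | hz
      · exact hxy.le
      · exact h.1 z hz

theorem insertC_cost (x : ι) (l : List ι) : (insertC x l).cost (leOf a) ≤ l.length := by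
  induction l with
  | nil => simp [insertC]
  | cons y ys ih =>
    simp only [insertC, Cmp.cost_bind, leq_eval, leq_cost, List.length_cons, Cmp.cost_ite,
      Cmp.cost_pure]
    split
    · simp
    · omega

theorem sortC_perm (l : List ι) : ((sortC l).eval (leOf a)).Perm l := by
  induction l with
  | nil => simp [sortC]
  | cons x xs ih => simpa [sortC] using (insertC_perm a x _).trans (ih.cons x)

theorem sortC_sorted (l : List ι) :
    ((sortC l).eval (leOf a)).Pairwise (fun i j => a i ≤ a j) := by
  induction l with
  | nil => simp [sortC]
  | cons x xs ih => simpa [sortC] using insertC_sorted a x _ ih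

/-- Five elements cost at most ten comparisons, which makes two per element in `medians_groups`;
lists of at most fifty elements cost less than 25 per element in `select_spec`. -/
theorem sortC_cost (l : List ι) : 2 * (sortC l).cost (leOf a) ≤ l.length * (l.length - 1) := by
  induction l with
  | nil => simp [sortC]
  | cons x xs ih =>
    have h := insertC_cost a x ((sortC xs).eval (leOf a))
    rw [(sortC_perm a xs).length_eq] at h
    simp only [sortC, Cmp.cost_bind, List.length_cons, Nat.add_sub_cancel]
    rcases hn : xs.length with _ | n
    · rw [hn] at h ih; simp at *; omega
    · rw [hn] at h ih
      simp only [Nat.add_sub_cancel] at ih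
      nlinarith

/-! ### Order statistics of lists -/

/-- `p` is a value of (0-based) rank `k` in `l`. -/
def IsKth (l : List ι) (k : ℕ) (p : ι) : Prop :=
  l.countP (fun x => a x < a p) ≤ k ∧ k < l.countP (fun x => a x ≤ a p)

theorem IsKth.perm {l l' : List ι} {k : ℕ} {p : ι} (h : l.Perm l') (hk : IsKth a l k p) :
    IsKth a l' k p := by
  unfold IsKth at *
  rwa [← h.countP_eq, ← h.countP_eq]

theorem isKth_getElem_of_sorted {l : List ι} (h : l.Pairwise (fun i j => a i ≤ a j)) {k : ℕ}
    (hk : k < l.length) : IsKth a l k l[k] := by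
  have hd : l = l.take k ++ l[k] :: l.drop (k + 1) := by simp
  set p := l[k] with hp
  have h' := h
  rw [hd, List.pairwise_append, List.pairwise_cons] at h'
  obtain ⟨h1, ⟨h2, h3⟩, h4⟩ := h'
  have hl : (l.take k).length = k := by simp; omega
  constructor
  · rw [hd, List.countP_append, List.countP_cons]
    have e1 : (l.drop (k + 1)).countP (fun x => a x < a p) = 0 := by
      rw [List.countP_eq_zero]
      intro x hx
      simpa using h2 x hx
    have e2 := List.countP_le_length (p := fun x => decide (a x < a p)) (l := l.take k)
    simp only [e1, lt_irrefl, decide_false]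
    simp
    omega
  · rw [hd, List.countP_append, List.countP_cons]
    have e1 : (l.take k).countP (fun x => a x ≤ a p) = k := by
      rw [List.countP_eq_length.2, hl]
      intro x hx
      simpa using h4 x hx p (by simp)
    simp [e1]

theorem sortC_isKth (l : List ι) {k : ℕ} (hk : k < l.length) :
    ∃ p, ((sortC l).eval (leOf a))[k]? = some p ∧ p ∈ l ∧ IsKth a l k p := by
  have hk' : k < ((sortC l).eval (leOf a)).length := by rwa [(sortC_perm a l).length_eq]
  refine ⟨((sortC l).eval (leOf a))[k], by simp [hk'], ?_, ?_⟩
  · exact (sortC_perm a l).mem_iff.1 (List.getElem_mem _)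
  · exact (isKth_getElem_of_sorted a (sortC_sorted a l) hk').perm a (sortC_perm a l)

end Basics

section Selection

variable {ι : Type} {α : Type*} [LinearOrder α] (a : ι → α)

/-! ### Linear selection -/

theorem countP_le_value (l : List ι) (p : ι) :
    l.countP (fun x => a p ≤ a x) + l.countP (fun x => a x < a p) = l.length := by
  rw [List.length_eq_countP_add_countP (fun x => decide (a p ≤ a x))]
  simp

theorem countP_value_le (l : List ι) (p : ι) :
    l.countP (fun x => a x ≤ a p) + l.countP (fun x => a p < a x) = l.length := by
  rw [List.length_eq_countP_add_countP (fun x => decide (a x ≤ a p))]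
  simp

/-- For a full group of five both counts are three: the source of the factor 3 in `medians_groups`.
-/
theorem group_median (g : List ι) (hg : g ≠ []) :
    ∃ m, ((sortC g).eval (leOf a))[((sortC g).eval (leOf a)).length / 2]? = some m ∧ m ∈ g ∧
      g.length / 2 + 1 ≤ g.countP (fun x => a x ≤ a m) ∧
      g.length - g.length / 2 ≤ g.countP (fun x => a m ≤ a x) := by
  have h0 := List.length_pos_iff.2 hg
  obtain ⟨m, h1, h2, h3, h4⟩ := sortC_isKth a g (k := g.length / 2) (by omega)
  refine ⟨m, by rwa [(sortC_perm a g).length_eq], h2, h4, ?_⟩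
  have := countP_le_value a g m
  omega

theorem countP_mono_value {l : List ι} {m p : ι} (h : a m ≤ a p) :
    l.countP (fun x => a x ≤ a m) ≤ l.countP (fun x => a x ≤ a p) :=
  List.countP_mono_left fun x _ hx => by simp at *; exact hx.trans h

theorem countP_anti_value {l : List ι} {m p : ι} (h : a p ≤ a m) :
    l.countP (fun x => a m ≤ a x) ≤ l.countP (fun x => a p ≤ a x) :=
  List.countP_mono_left fun x _ hx => by simp at *; exact h.trans hx

/-- The medians of the groups of `l`: there are about `l.length / 5` of them, and about three
elements of `l` for each of them are bounded by it from either side. -/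
theorem medians_groups (l : List ι) :
    let ms := (medians (groups l)).eval (leOf a)
    (∀ m ∈ ms, m ∈ l) ∧ 5 * ms.length ≤ l.length + 4 ∧ l.length ≤ 5 * ms.length ∧
      (medians (groups l)).cost (leOf a) ≤ 2 * l.length + 10 ∧
      ∀ p, 3 * ms.countP (fun x => a x ≤ a p) ≤ l.countP (fun x => a x ≤ a p) + 2 ∧
        3 * ms.countP (fun x => a p ≤ a x) ≤ l.countP (fun x => a p ≤ a x) + 2 := by
  induction l using groups.induct with
  | case1 => simp [groups, medians]
  | case2 x y z u v t ih =>
    obtain ⟨m, h1, h2, h3, h4⟩ := group_median a [x, y, z, u, v] (by simp)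
    have h5 := sortC_cost a [x, y, z, u, v]
    simp only [groups, medians, Cmp.eval_bind, Cmp.cost_bind, Cmp.eval_pure, Cmp.cost_pure, h1,
      Option.toList_some, List.cons_append, List.nil_append, List.length_cons, List.mem_cons]
    simp only [List.length_cons, List.length_nil] at h5 h3 h4
    obtain ⟨i1, i2, i3, i4, i5⟩ := ih
    refine ⟨?_, by omega, by omega, by omega, fun p => ⟨?_, ?_⟩⟩
    · rintro w (rfl | hw)
      · simp at h2; tauto
      · have := i1 w hw; tauto
    · have e : (x :: y :: z :: u :: v :: t).countP (fun w => a w ≤ a p) =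
        [x, y, z, u, v].countP (fun w => a w ≤ a p) + t.countP (fun w => a w ≤ a p) := by
        rw [← List.countP_append]; rfl
      rw [e, List.countP_cons]
      have := (i5 p).1
      split
      · next h =>
        have := countP_mono_value a (l := [x, y, z, u, v]) (of_decide_eq_true h)
        omega
      · omega
    · have e : (x :: y :: z :: u :: v :: t).countP (fun w => a p ≤ a w) =
        [x, y, z, u, v].countP (fun w => a p ≤ a w) + t.countP (fun w => a p ≤ a w) := by
        rw [← List.countP_append]; rfl
      rw [e, List.countP_cons]
      have := (i5 p).2
      split
      · next h =>
        have := countP_anti_value a (l := [x, y, z, u, v]) (of_decide_eq_true h)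
        omega
      · omega
  | case3 l h0 h5 =>
    have hl : l.length < 5 := by
      rcases l with _ | ⟨x, _ | ⟨y, _ | ⟨z, _ | ⟨u, _ | ⟨v, t⟩⟩⟩⟩⟩ <;> simp at *
      exact absurd rfl (h5 _ _ _ _ _ _ rfl rfl rfl rfl rfl)
    have hne : l ≠ [] := fun h => h0 h
    have hpos := List.length_pos_iff.2 hne
    obtain ⟨m, h1, h2, h3, h4⟩ := group_median a l hne
    have h6 := sortC_cost a l
    have h7 : l.length * (l.length - 1) ≤ 4 * 3 := Nat.mul_le_mul (by omega) (by omega)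
    have e : groups l = [l] := by
      rcases l with _ | ⟨x, _ | ⟨y, _ | ⟨z, _ | ⟨u, _ | ⟨v, t⟩⟩⟩⟩⟩ <;> simp [groups] at hne hl ⊢
      omega
    simp only [e, medians, Cmp.eval_bind, Cmp.cost_bind, Cmp.eval_pure, Cmp.cost_pure, h1,
      Option.toList_some, List.cons_append, List.nil_append, List.length_cons, List.mem_cons]
    -- The last group may guarantee only one element on either side of its median; the slack of two
    -- in the statement replaces the missing ones.
    refine ⟨by simpa using h2, by simp; omega, by simp; omega, by omega, fun p => ⟨?_, ?_⟩⟩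
    · rw [List.countP_cons]
      split
      · next h =>
        have := countP_mono_value a (l := l) (of_decide_eq_true h)
        rw [List.countP_nil]; omega
      · simp
    · rw [List.countP_cons]
      split
      · next h =>
        have := countP_anti_value a (l := l) (of_decide_eq_true h)
        rw [List.countP_nil]; omega
      · simp

theorem partition_eval (p : ι) (l : List ι) : (partition p l).eval (leOf a) =
    (l.filter (fun x => a x < a p), l.filter (fun x => a x = a p),
      l.filter (fun x => a p < a x)) := by
  induction l with
  | nil => simp [partition]
  | cons x xs ih =>
    simp only [partition, Cmp.eval_bind, ih, leq_eval, Cmp.eval_ite, Cmp.eval_pure]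
    rcases lt_trichotomy (a x) (a p) with h | h | h
    · simp [h, h.le, h.not_ge, h.ne, h.not_gt]
    · simp [h]
    · simp [h, h.not_ge, h.ne', h.not_gt]

theorem partition_cost (p : ι) (l : List ι) :
    (partition p l).cost (leOf a) ≤ 2 * l.length := by
  induction l with
  | nil => simp [partition]
  | cons x xs ih =>
    simp only [partition, Cmp.cost_bind, leq_eval, leq_cost, Cmp.cost_ite, Cmp.cost_pure,
      List.length_cons]
    split
    · split <;> omega
    · omega

theorem countP_filter_of_imp {f g : ι → Bool} {l : List ι}
    (h : ∀ x ∈ l, g x = true → f x = true) :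
    (l.filter f).countP g = l.countP g := by
  rw [List.countP_filter]
  refine List.countP_congr fun x hx => ?_
  have := h x hx
  simp only [Bool.and_eq_true]
  tauto

/-- The two recursive calls get about n/5 and at most 7n/10 + 2 elements. With 4n + 10 comparisons
for the medians and the partition, the total is about 139n + 430, which is at most 150n as soon as n
> 50; this is why the base case goes up to 50. -/
theorem select_spec (fuel : ℕ) : ∀ (l : List ι) (k : ℕ), k < l.length → l.length < fuel →
    ∃ p, (select fuel l k).eval (leOf a) = some p ∧ p ∈ l ∧ IsKth a l k p ∧
      (select fuel l k).cost (leOf a) ≤ 150 * l.length := by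
  induction fuel with
  | zero => intro l k _ h; omega
  | succ fuel ih =>
    intro l k hk hf
    rw [select]
    by_cases h50 : l.length ≤ 50
    · obtain ⟨p, h1, h2, h3⟩ := sortC_isKth a l hk
      have h4 := sortC_cost a l
      have h5 : l.length * (l.length - 1) ≤ l.length * 49 := Nat.mul_le_mul le_rfl (by omega)
      simp only [h50, if_true, Cmp.eval_bind, Cmp.cost_bind, Cmp.eval_pure, Cmp.cost_pure, h1]
      exact ⟨p, rfl, h2, h3, by omega⟩
    · simp only [h50, if_false, Cmp.eval_bind, Cmp.cost_bind]
      obtain ⟨m1, m2, m3, m4, m5⟩ := medians_groups a l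
      set ms := (medians (groups l)).eval (leOf a) with hms
      obtain ⟨p, p1, p2, p3, p4⟩ := ih ms (ms.length / 2) (by omega) (by omega)
      have q1 := partition_cost a p l
      simp only [p1, Cmp.eval_bind, Cmp.cost_bind, partition_eval, Cmp.eval_ite, Cmp.cost_ite,
        Cmp.eval_pure, Cmp.cost_pure]
      have c1 := countP_le_value a l p
      have c2 := countP_value_le a l p
      have c3 := countP_le_value a ms p
      obtain ⟨c4, c5⟩ := p3
      obtain ⟨c6, c7⟩ := m5 p
      have s1 : (l.filter (fun x => a x < a p)).length = l.countP (fun x => a x < a p) :=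
        List.countP_eq_length_filter.symm
      have s3 : (l.filter (fun x => a p < a x)).length = l.countP (fun x => a p < a x) :=
        List.countP_eq_length_filter.symm
      have s2 : (l.filter (fun x => a x < a p)).length + (l.filter (fun x => a x = a p)).length =
          l.countP (fun x => a x ≤ a p) := by
        rw [← List.countP_eq_length_filter, ← List.countP_eq_length_filter]
        clear * -
        induction l with
        | nil => rfl
        | cons x xs ih =>
          simp only [List.countP_cons, decide_eq_true_eq]
          rcases lt_trichotomy (a x) (a p) with h | h | h
          · simp [h, h.le, h.ne]; omega
          · simp [h]; omega
          · simp [h.not_ge, h.ne', h.not_gt]; omega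
      rw [s2]
      split
      · next hk1 =>
        obtain ⟨x, x1, x2, ⟨x3, x4⟩, x5⟩ := ih _ k hk1 (by omega)
        rw [List.mem_filter, decide_eq_true_eq] at x2
        refine ⟨x, x1, x2.1, ⟨?_, ?_⟩, by omega⟩
        · rwa [countP_filter_of_imp] at x3
          intro y _ hy
          simp at *
          exact hy.trans x2.2
        · rwa [countP_filter_of_imp] at x4
          intro y _ hy
          simp at *
          exact hy.trans_lt x2.2
      · next hk1 =>
        split
        · next hk2 => exact ⟨p, rfl, m1 p p2, ⟨by omega, by omega⟩, by omega⟩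
        · next hk2 =>
          obtain ⟨x, x1, x2, ⟨x3, x4⟩, x5⟩ := ih (l.filter (fun x => a p < a x))
            (k - l.countP (fun x => a x ≤ a p)) (by omega) (by omega)
          rw [List.mem_filter, decide_eq_true_eq] at x2
          -- A predicate that holds on all elements up to the value of `p` counts all the discarded
          -- elements; this is the shift of the rank.
          have key : ∀ g : ι → Bool, (∀ y, a y ≤ a p → g y = true) →
              l.countP g = l.countP (fun x => a x ≤ a p) +
                (l.filter (fun x => a p < a x)).countP g := by
            intro g hg
            clear * - hg
            induction l with
            | nil => rfl
            | cons y ys ih =>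
              rcases le_or_gt (a y) (a p) with h | h
              · simp [h, h.not_gt, hg y h, ih]; omega
              · simp [List.countP_cons, h, h.not_ge, ih]; omega
          refine ⟨x, x1, x2.1, ⟨?_, ?_⟩, by omega⟩
          · rw [key _ (fun y hy => by simpa using hy.trans_lt x2.2)]
            omega
          · rw [key _ (fun y hy => by simpa using hy.trans x2.2.le)]
            omega

/-- Every nonempty run has a middle element, so the list of the middles is as long as the list of
the runs. -/
theorem medianOfMiddles_spec (runs : List (List ι)) (h : ∀ r ∈ runs, r ≠ []) (hne : runs ≠ []) :
    ∃ μ, (medianOfMiddles runs).eval (leOf a) = some μ ∧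
      μ ∈ runs.filterMap (fun r => r[r.length / 2]?) ∧
      IsKth a (runs.filterMap fun r => r[r.length / 2]?) (runs.length / 2) μ ∧
      (medianOfMiddles runs).cost (leOf a) ≤ 150 * runs.length := by
  have hl : (runs.filterMap fun r => r[r.length / 2]?).length = runs.length := by
    clear hne
    induction runs with
    | nil => rfl
    | cons r rs ih =>
      have hr := List.length_pos_iff.2 (h r (by simp))
      have : r.length / 2 < r.length := by omega
      rw [List.filterMap_cons, List.getElem?_eq_getElem this]
      simp [ih fun r hr => h r (by simp [hr])]
  have hpos := List.length_pos_iff.2 hne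
  obtain ⟨p, h1, h2, h3, h4⟩ := select_spec a
    ((runs.filterMap fun r => r[r.length / 2]?).length + 1)
    (runs.filterMap fun r => r[r.length / 2]?) (runs.length / 2) (by omega) (by omega)
  refine ⟨p, ?_, h2, h3, ?_⟩
  · simp only [medianOfMiddles]
    rwa [hl] at h1 ⊢
  · simp only [medianOfMiddles]
    rwa [hl] at h4 ⊢

end Selection

/-! ### Binary and doubling searches -/

section Search

variable {ι : Type} {α : Type*} (le : ι → ι → Bool)

/-- A test of cost at most one which holds precisely below the position `t`. -/
structure IsCut (test : ℕ → Cmp ι Bool) (t hi : ℕ) : Prop where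
  eval : ∀ m < hi, (test m).eval le = decide (m < t)
  cost : ∀ m, (test m).cost le ≤ 1

variable {le}

/-- Each test halves the interval; an interval of length below 2 ^ w is exhausted after w tests. -/
theorem bisect_spec {test : ℕ → Cmp ι Bool} {t top : ℕ} (h : IsCut le test t top) (w : ℕ) :
    ∀ lo hi, lo ≤ t → t ≤ hi → hi ≤ top → hi - lo < 2 ^ w →
      (bisect test lo hi).eval le = t ∧ (bisect test lo hi).cost le ≤ w := by
  induction w with
  | zero =>
    intro lo hi h1 h2 _ h3
    rw [bisect]
    have : ¬ lo < hi := by omega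
    simp [this]
    omega
  | succ w ih =>
    intro lo hi h1 h2 h4 h3
    rw [bisect]
    by_cases hlt : lo < hi
    · have hc := h.cost ((lo + hi) / 2)
      rw [pow_succ] at h3
      simp only [hlt, dif_pos, Cmp.eval_bind, Cmp.cost_bind, h.eval ((lo + hi) / 2) (by omega),
        Cmp.eval_ite, Cmp.cost_ite]
      by_cases hm : (lo + hi) / 2 < t
      · obtain ⟨e, c⟩ := ih ((lo + hi) / 2 + 1) hi (by omega) h2 h4 (by omega)
        simp [hm, e]; omega
      · obtain ⟨e, c⟩ := ih lo ((lo + hi) / 2) (by omega) (by omega) (by omega) (by omega)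
        simp [hm, e]; omega
    · simp [hlt]; omega

/-- Here `e` counts the successful doublings. They skip 2 ^ i * (2 ^ e - 1) positions, all below
`t`. The cost is `e` successful tests, a failing one, and a bisection in fewer than 2 ^ (i + e)
positions. -/
theorem doubling_spec {test : ℕ → Cmp ι Bool} {t hi : ℕ} (h : IsCut le test t hi) (ht : t ≤ hi)
    (d : ℕ) : ∀ lo i, hi - lo ≤ d → lo ≤ t → (doubling test lo hi i).eval le = t ∧
      ∃ e, 2 ^ i * 2 ^ e ≤ t - lo + 2 ^ i ∧ (doubling test lo hi i).cost le ≤ 2 * e + i + 1 := by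
  induction d with
  | zero =>
    intro lo i h1 h2
    have := Nat.one_le_two_pow (n := i)
    rw [doubling]
    have hn : ¬ lo + 2 ^ i ≤ hi := by omega
    simp only [hn, dif_neg, not_false_eq_true]
    obtain ⟨b1, b2⟩ := bisect_spec h i lo hi h2 ht le_rfl (by omega)
    exact ⟨b1, 0, by omega, by omega⟩
  | succ d ih =>
    intro lo i h1 h2
    have := Nat.one_le_two_pow (n := i)
    rw [doubling]
    by_cases hn : lo + 2 ^ i ≤ hi
    · have hc := h.cost (lo + 2 ^ i - 1)
      simp only [hn, dif_pos, Cmp.eval_bind, Cmp.cost_bind, h.eval (lo + 2 ^ i - 1) (by omega),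
        Cmp.eval_ite, Cmp.cost_ite]
      by_cases hm : lo + 2 ^ i - 1 < t
      · obtain ⟨b1, e, b2, b3⟩ := ih (lo + 2 ^ i) (i + 1) (by omega) (by omega)
        simp only [hm, decide_true, if_true, b1, true_and]
        refine ⟨e + 1, ?_, by omega⟩
        rw [pow_succ] at b2 ⊢
        have : 2 ^ i * (2 ^ e * 2) = 2 ^ i * 2 * 2 ^ e := by ring
        omega
      · obtain ⟨b1, b2⟩ := bisect_spec h i lo (lo + 2 ^ i - 1) h2 (by omega) (by omega) (by omega)
        simp only [hm, decide_false, Bool.false_eq_true, if_false, b1, true_and]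
        exact ⟨0, by omega, by omega⟩
    · simp only [hn, dif_neg, not_false_eq_true]
      obtain ⟨b1, b2⟩ := bisect_spec h i lo hi h2 ht le_rfl (by omega)
      exact ⟨b1, 0, by omega, by omega⟩

/-- As for `doubling_spec`, but each of the `e` full rounds makes two tests and moves both ends, so
2 ^ e is bounded by the distance of `t` from the nearer end. -/
theorem doublingBoth_spec {test : ℕ → Cmp ι Bool} {t top : ℕ} (h : IsCut le test t top)
    (d : ℕ) : ∀ lo hi i, hi - lo ≤ d → lo ≤ t → t ≤ hi → hi ≤ top →
      (doublingBoth test lo hi i).eval le = t ∧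
      ∃ e, 2 ^ i * 2 ^ e ≤ t - lo + 2 ^ i ∧ 2 ^ i * 2 ^ e ≤ hi - t + 2 ^ i ∧
        (doublingBoth test lo hi i).cost le ≤ 3 * e + i + 2 := by
  induction d with
  | zero =>
    intro lo hi i h1 h2 ht h3
    have := Nat.one_le_two_pow (n := i)
    rw [doublingBoth]
    have hn : ¬ lo + 2 ^ i ≤ hi := by omega
    simp only [hn, dif_neg, not_false_eq_true]
    obtain ⟨b1, b2⟩ := bisect_spec h i lo hi h2 ht h3 (by omega)
    exact ⟨b1, 0, by omega, by omega, by omega⟩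
  | succ d ih =>
    intro lo hi i h1 h2 ht h3
    have := Nat.one_le_two_pow (n := i)
    rw [doublingBoth]
    by_cases hn : lo + 2 ^ i ≤ hi
    · have hc := h.cost (lo + 2 ^ i - 1)
      simp only [hn, dif_pos, Cmp.eval_bind, Cmp.cost_bind, h.eval (lo + 2 ^ i - 1) (by omega),
        Cmp.eval_ite, Cmp.cost_ite]
      by_cases hm : lo + 2 ^ i - 1 < t
      · simp only [hm, decide_true, if_true]
        by_cases hn' : lo + 2 ^ i + 2 ^ i ≤ hi
        · have hc' := h.cost (hi - 2 ^ i)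
          simp only [hn', dif_pos, Cmp.eval_bind, Cmp.cost_bind, h.eval (hi - 2 ^ i) (by omega),
            Cmp.eval_ite, Cmp.cost_ite]
          by_cases hm' : hi - 2 ^ i < t
          · obtain ⟨b1, b2⟩ := bisect_spec h i (hi - 2 ^ i + 1) hi (by omega) ht h3 (by omega)
            simp only [hm', decide_true, if_true, b1, true_and]
            exact ⟨0, by omega, by omega, by omega⟩
          · obtain ⟨b1, e, b2, b4, b3⟩ := ih (lo + 2 ^ i) (hi - 2 ^ i) (i + 1) (by omega)
              (by omega) (by omega) (by omega)
            simp only [hm', decide_false, Bool.false_eq_true, if_false, b1, true_and]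
            rw [pow_succ] at b2 b4
            have : 2 ^ i * (2 ^ e * 2) = 2 ^ i * 2 * 2 ^ e := by ring
            refine ⟨e + 1, ?_, ?_, by omega⟩ <;> rw [pow_succ] <;> omega
        · simp only [hn', dif_neg, not_false_eq_true]
          obtain ⟨b1, b2⟩ := bisect_spec h i (lo + 2 ^ i) hi (by omega) ht h3 (by omega)
          exact ⟨b1, 0, by omega, by omega, by omega⟩
      · obtain ⟨b1, b2⟩ := bisect_spec h i lo (lo + 2 ^ i - 1) h2 (by omega) (by omega) (by omega)
        simp only [hm, decide_false, Bool.false_eq_true, if_false, b1, true_and]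
        exact ⟨0, by omega, by omega, by omega⟩
    · simp only [hn, dif_neg, not_false_eq_true]
      obtain ⟨b1, b2⟩ := bisect_spec h i lo hi h2 ht h3 (by omega)
      exact ⟨b1, 0, by omega, by omega, by omega⟩

/-- A test of the entries of a list that holds on the entries of an initial segment only. -/
theorem isCut_testAt {test : ι → Cmp ι Bool} {l : List ι} (f : ι → Bool)
    (he : ∀ x, (test x).eval le = f x) (hc : ∀ x, (test x).cost le ≤ 1)
    (hl : l.Pairwise fun x y => f y = true → f x = true) :
    IsCut le (testAt test l) (l.countP f) l.length ∧ l.take (l.countP f) = l.filter f ∧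
      l.drop (l.countP f) = l.filter (fun x => !f x) := by
  -- Once `f` fails it fails on the rest of the list, so the two filters just cut the list.
  have key : l = l.filter f ++ l.filter (fun x => !f x) := by
    clear he hc
    induction l with
    | nil => rfl
    | cons x xs ih =>
      rw [List.pairwise_cons] at hl
      by_cases hx : f x = true
      · simp only [List.filter_cons, hx, Bool.not_true, if_true, Bool.false_eq_true, if_false,
          List.cons_append]
        rw [← ih hl.2]
      · have h0 : xs.filter f = [] := by
          rw [List.filter_eq_nil_iff]
          exact fun y hy hfy => hx (hl.1 y hy hfy)
        have h1 := ih hl.2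
        rw [h0, List.nil_append] at h1
        simp only [Bool.not_eq_true] at hx
        simp only [List.filter_cons, hx, Bool.not_false, if_true, Bool.false_eq_true, if_false,
          h0, List.nil_append]
        rw [← h1]
  have hlen : (l.filter f).length = l.countP f := List.countP_eq_length_filter.symm
  refine ⟨⟨fun m hm => ?_, fun m => ?_⟩, ?_, ?_⟩
  · have e : l[m]? = some l[m] := by simp [hm]
    simp only [testAt, e, he]
    by_cases hmt : m < l.countP f
    · have : l[m] = (l.filter f)[m]'(by omega) := by
        have h2 : l[m]? = (l.filter f ++ l.filter (fun x => !f x))[m]? := by rw [← key]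
        rw [List.getElem?_append_left (by omega), e, List.getElem?_eq_getElem (by omega)] at h2
        exact Option.some.inj h2
      have h3 : l[m] ∈ l.filter f := this ▸ List.getElem_mem _
      simp [hmt, (List.mem_filter.1 h3).2]
    · have h2 : l[m]? = (l.filter f ++ l.filter (fun x => !f x))[m]? := by rw [← key]
      rw [List.getElem?_append_right (by omega), e] at h2
      have h3 := List.mem_of_getElem? h2.symm
      have := (List.mem_filter.1 h3).2
      simp [hmt]
      simpa using this
  · unfold testAt
    split
    · exact hc _
    · simp
  · have h1 : ∀ l', l = l.filter f ++ l' → l.take (l.countP f) = l.filter f := by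
      intro l' h
      rw [← hlen]
      nth_rewrite 2 [h]
      exact List.take_left' rfl
    exact h1 _ key
  · have h1 : ∀ l', l = l.filter f ++ l' → l.drop (l.countP f) = l' := by
      intro l' h
      rw [← hlen]
      nth_rewrite 2 [h]
      exact List.drop_left' rfl
    exact h1 _ key

end Search

/-! ### Binary logarithms of natural numbers -/

/-- The binary logarithm of a natural number. -/
noncomputable def lg (x : ℕ) : ℝ := Real.logb 2 x

@[simp] theorem lg_zero : lg 0 = 0 := by simp [lg]

@[simp] theorem lg_one : lg 1 = 0 := by simp [lg]

@[simp] theorem lg_two : lg 2 = 1 := by simp [lg]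

theorem lg_nonneg (x : ℕ) : 0 ≤ lg x := by
  rcases Nat.eq_zero_or_pos x with rfl | h
  · simp
  · exact Real.logb_nonneg (by norm_num) (by exact_mod_cast h)

theorem lg_mono {x y : ℕ} (h : x ≤ y) : lg x ≤ lg y := by
  rcases Nat.eq_zero_or_pos x with rfl | hx
  · simpa using lg_nonneg y
  · exact Real.logb_le_logb_of_le (by norm_num) (by exact_mod_cast hx) (by exact_mod_cast h)

theorem lg_mul {x y : ℕ} (hx : 0 < x) (hy : 0 < y) : lg (x * y) = lg x + lg y := by
  unfold lg
  push_cast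
  exact Real.logb_mul (by positivity) (by positivity)

theorem lg_pow (x k : ℕ) : lg (x ^ k) = k * lg x := by
  unfold lg
  push_cast
  exact Real.logb_pow _ _ _

/-- Bounds of logarithms by rational multiples are reduced to inequalities between integer powers.
-/
theorem lg_le_of_pow_le {x k : ℕ} {c : ℝ} (hk : 0 < k) (j : ℕ) (h : x ^ k ≤ 2 ^ j)
    (hc : (j : ℝ) ≤ k * c) : lg x ≤ c := by
  have h1 := lg_mono h
  rw [lg_pow, lg_pow, lg_two, mul_one] at h1
  have : (0 : ℝ) < k := by exact_mod_cast hk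
  nlinarith

/-- The binary logarithm is at most two thirds of the argument. -/
theorem lg_le_two_thirds (x : ℕ) : lg x ≤ 2 / 3 * x := by
  rcases Nat.eq_zero_or_pos x with rfl | hx
  · simp
  -- The integer inequality is x ^ 3 ≤ 4 ^ x. From 2 on, the cube grows by at most (3/2) ^ 3 < 4 in
  -- each step. What matters later is that 2/3 is less than 1.
  refine lg_le_of_pow_le (k := 3) (by norm_num) (2 * x) ?_ (by push_cast; linarith)
  induction x, hx using Nat.le_induction with
  | base => norm_num
  | succ n hn ih =>
    rcases Nat.lt_or_ge n 2 with h | h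
    · have : n = 1 := by omega
      subst this; norm_num
    · have : (n + 1) ^ 3 ≤ 4 * n ^ 3 := by nlinarith [mul_le_mul' h h, Nat.mul_le_mul h (Nat.mul_le_mul h h)]
      calc (n + 1) ^ 3 ≤ 4 * n ^ 3 := this
        _ ≤ 4 * 2 ^ (2 * n) := by omega
        _ = 2 ^ (2 * (n + 1)) := by ring

/-- The natural logarithm lies below its tangent at 2, which is x/2 + log 2 - 1, and this is at most
x log 2 because 1/2 < log 2 < 1. -/
theorem logb_two_le {x : ℝ} (hx : 0 < x) : Real.logb 2 x ≤ x := by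
  rw [Real.logb, div_le_iff₀ (Real.log_pos (by norm_num))]
  have h1 := Real.add_one_le_exp (Real.log x - Real.log x)
  have h2 : Real.log x ≤ x / 2 + (Real.log 2 - 1) := by
    have := Real.log_le_sub_one_of_pos (show 0 < x / 2 by positivity)
    rw [Real.log_div hx.ne' (by norm_num)] at this
    linarith
  have h3 := Real.log_two_gt_d9
  have h4 := Real.log_two_lt_d9
  nlinarith

/-! ### Entropy terms, weights and potentials -/

/-- `x * lg x`. -/
noncomputable def xlg (x : ℕ) : ℝ := x * lg x

@[simp] theorem xlg_zero : xlg 0 = 0 := by simp [xlg]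

@[simp] theorem xlg_one : xlg 1 = 0 := by simp [xlg]

/-- The weight `1 + lg x` of a nonempty piece of size `x`. -/
noncomputable def weight (x : ℕ) : ℝ := if x = 0 then 0 else 1 + lg x

@[simp] theorem weight_zero : weight 0 = 0 := by simp [weight]

theorem weight_nonneg (x : ℕ) : 0 ≤ weight x := by
  have := lg_nonneg x
  unfold weight
  split <;> linarith

theorem weight_mono {x y : ℕ} (h : x ≤ y) : weight x ≤ weight y := by
  rcases Nat.eq_zero_or_pos x with rfl | hx
  · simpa using weight_nonneg y
  · have := lg_mono h
    rw [weight, weight, if_neg (by omega), if_neg (by omega)]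
    linarith

theorem lg_add_le {x y : ℕ} (hx : 0 < x) (h : y ≤ x) : lg (x + y) ≤ 1 + lg x := by
  calc lg (x + y) ≤ lg (2 * x) := lg_mono (by omega)
    _ = 1 + lg x := by rw [lg_mul (by norm_num) hx, lg_two]

theorem weight_add_le (x y : ℕ) : weight (x + y) ≤ weight x + weight y := by
  wlog h : y ≤ x
  · rw [add_comm x, add_comm (weight x)]
    exact this y x (by omega)
  rcases Nat.eq_zero_or_pos y with rfl | hy
  · simp
  have := lg_add_le (by omega) h
  have := lg_nonneg y
  rw [weight, weight, weight, if_neg (by omega), if_neg (by omega), if_neg (by omega)]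
  linarith

theorem lg_one_add_le_weight (x : ℕ) : lg (1 + x) ≤ weight x := by
  rcases Nat.eq_zero_or_pos x with rfl | hx
  · simp
  · have := lg_add_le hx (y := 1) hx
    rw [weight, if_neg (by omega), add_comm]
    linarith

/-- The potential `4 + 2 lg x` of a nonempty run of length `x`. -/
noncomputable def potential (x : ℕ) : ℝ := if x = 0 then 0 else 4 + 2 * lg x

@[simp] theorem potential_zero : potential 0 = 0 := by simp [potential]

theorem potential_nonneg (x : ℕ) : 0 ≤ potential x := by
  have := lg_nonneg x
  unfold potential
  split <;> linarith

theorem potential_le (x : ℕ) : potential x ≤ 4 * weight x := by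
  have := lg_nonneg x
  unfold potential weight
  split <;> linarith

/-- If y ≤ x, two roundings are lost, lg (x + y) ≤ 1 + lg x and lg (1 + y) ≤ 1 + lg y. The constant
4 of the new piece pays for both, each being doubled. The term released is the cost of a search from
the nearer end. -/
theorem potential_add (x y : ℕ) :
    potential (x + y) + 2 * lg (1 + min x y) ≤ potential x + potential y := by
  wlog h : y ≤ x
  · rw [add_comm x, add_comm (potential x), min_comm]
    exact this y x (by omega)
  rcases Nat.eq_zero_or_pos y with rfl | hy
  · simp
  have h1 := lg_add_le (by omega) h
  have h2 := lg_add_le hy (y := 1) hy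
  rw [min_eq_right h, add_comm 1 y]
  rw [potential, potential, potential, if_neg (by omega), if_neg (by omega), if_neg (by omega)]
  linarith

theorem potential_add_le (x y : ℕ) : potential (x + y) ≤ potential x + potential y := by
  have := potential_add x y
  have := lg_nonneg (1 + min x y)
  linarith

/-- The potential pays for the two searches that split a run into three parts. -/
theorem potential_split (x y z : ℕ) :
    potential (x + y + z) + (lg (1 + min x (y + z)) + lg (1 + min (x + y) z)) ≤
      potential x + potential z + 4 * weight y := by
  have h1 := potential_add x (y + z)
  have h2 := potential_add (x + y) z
  have h3 := potential_add_le x y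
  have h4 := potential_add_le y z
  have h5 := potential_le y
  rw [← add_assoc] at h1
  linarith

/-! ### Recursion trees -/

section Tree

variable {ι : Type} [Fintype ι] [DecidableEq ι] {α : Type*} [LinearOrder α]
  (a : ι → α) (R : ι → ℕ)

/-- The number of runs that have elements in `S`. -/
def runCount (S : Finset ι) : ℕ := (S.image R).card

/-- The part of the run `k` in `S`. -/
def runPart (S : Finset ι) (k : ℕ) : Finset ι := S.filter fun p => R p = k

/-- The number of runs that have elements in `S` with the value of `μ`. -/
def equalRuns (S : Finset ι) (μ : ι) : ℕ := runCount R (S.filter fun p => a p = a μ)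

/-- The left sub-instance of `S` for the pivot `μ`: all elements at most the maximum of the smaller
elements of the runs other than that of the pivot. -/
def lowSide (S : Finset ι) (μ : ι) : Finset ι :=
  S.filter fun p => ∃ s ∈ S, R s ≠ R μ ∧ a s < a μ ∧ a p ≤ a s

/-- The right sub-instance of `S` for the pivot `μ`. -/
def highSide (S : Finset ι) (μ : ι) : Finset ι :=
  S.filter fun p => ∃ s ∈ S, R s ≠ R μ ∧ a μ < a s ∧ a s ≤ a p

/-- The elements of `S` whose ranks are known after splitting by the pivot `μ`. -/
def middle (S : Finset ι) (μ : ι) : Finset ι :=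
  S.filter fun p => p ∉ lowSide a R S μ ∧ p ∉ highSide a R S μ

/-- The shape of the recursion: the pivots and the recursive calls. -/
inductive PivotTree (ι : Type) : Type
  | leaf : PivotTree ι
  | node (μ : ι) (l r : PivotTree ι) : PivotTree ι

namespace PivotTree

/-- The sum over the leaves and the nodes of a recursion tree for the instance `S`. -/
def sum (fl : Finset ι → ℝ) (fn : Finset ι → ι → ℝ) : PivotTree ι → Finset ι → ℝ
  | leaf, S => fl S
  | node μ l r, S => fn S μ + l.sum fl fn (lowSide a R S μ) + r.sum fl fn (highSide a R S μ)

/-- The pivots in sorted order. -/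
def pivots : PivotTree ι → List ι
  | leaf => []
  | node μ l r => l.pivots ++ μ :: r.pivots

/-- A tree fits to the instance `S` and the set `Y` of the values that are asked for: the recursion
stops when no value is asked for, and in half of the runs half of the elements are at most (at
least) the pivot. -/
def Valid (Y : Finset α) : PivotTree ι → Finset ι → Prop
  | leaf, S => ∀ p ∈ S, a p ∉ Y
  | node μ l r, S => (∃ p ∈ S, a p ∈ Y) ∧ μ ∈ S ∧
      runCount R S ≤ 2 * ((S.image R).filter fun k =>
        (runPart R S k).card ≤ 2 * ((runPart R S k).filter fun p => a p ≤ a μ).card).card ∧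
      runCount R S ≤ 2 * ((S.image R).filter fun k =>
        (runPart R S k).card ≤ 2 * ((runPart R S k).filter fun p => a μ ≤ a p).card).card ∧
      l.Valid Y (lowSide a R S μ) ∧ r.Valid Y (highSide a R S μ)

end PivotTree

variable {a R} {S : Finset ι} {μ : ι} {p : ι}

theorem mem_lowSide : p ∈ lowSide a R S μ ↔
    p ∈ S ∧ ∃ s ∈ S, R s ≠ R μ ∧ a s < a μ ∧ a p ≤ a s := by simp [lowSide]

theorem mem_highSide : p ∈ highSide a R S μ ↔
    p ∈ S ∧ ∃ s ∈ S, R s ≠ R μ ∧ a μ < a s ∧ a s ≤ a p := by simp [highSide]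

theorem lowSide_lt (h : p ∈ lowSide a R S μ) : a p < a μ := by
  obtain ⟨_, s, _, _, h1, h2⟩ := mem_lowSide.1 h
  exact h2.trans_lt h1

theorem lt_highSide (h : p ∈ highSide a R S μ) : a μ < a p := by
  obtain ⟨_, s, _, _, h1, h2⟩ := mem_highSide.1 h
  exact h1.trans_le h2

theorem lowSide_subset : lowSide a R S μ ⊆ S := Finset.filter_subset _ _

theorem highSide_subset : highSide a R S μ ⊆ S := Finset.filter_subset _ _

theorem mem_lowSide_of_ne (h : p ∈ S) (hR : R p ≠ R μ) (hp : a p < a μ) : p ∈ lowSide a R S μ :=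
  mem_lowSide.2 ⟨h, p, h, hR, hp, le_rfl⟩

theorem mem_highSide_of_ne (h : p ∈ S) (hR : R p ≠ R μ) (hp : a μ < a p) :
    p ∈ highSide a R S μ :=
  mem_highSide.2 ⟨h, p, h, hR, hp, le_rfl⟩

theorem mem_middle : p ∈ middle a R S μ ↔
    p ∈ S ∧ p ∉ lowSide a R S μ ∧ p ∉ highSide a R S μ := by simp [middle]

theorem disjoint_lowSide_highSide : Disjoint (lowSide a R S μ) (highSide a R S μ) :=
  Finset.disjoint_left.2 fun _ h h' => (lowSide_lt h).not_gt (lt_highSide h')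

theorem runCount_mono {S T : Finset ι} (h : S ⊆ T) : runCount R S ≤ runCount R T :=
  Finset.card_le_card (Finset.image_subset_image h)

theorem runCount_le_card (S : Finset ι) : runCount R S ≤ S.card := Finset.card_image_le

theorem equalRuns_le : equalRuns a R S μ ≤ runCount R S :=
  runCount_mono (Finset.filter_subset _ _)

theorem card_sides_add_le :
    (lowSide a R S μ).card + (highSide a R S μ).card + (S.filter fun p => a p = a μ).card ≤
      S.card := by
  rw [← Finset.card_union_of_disjoint disjoint_lowSide_highSide, ← Finset.card_union_of_disjoint]
  · refine Finset.card_le_card ?_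
    refine Finset.union_subset (Finset.union_subset lowSide_subset highSide_subset)
      (Finset.filter_subset _ _)
  · refine Finset.disjoint_left.2 fun p hp hq => ?_
    have hq := (Finset.mem_filter.1 hq).2
    rcases Finset.mem_union.1 hp with h | h
    · exact (lowSide_lt h).ne hq
    · exact (lt_highSide h).ne' hq

/-- Each run of the half in question has an element at most the pivot. Either this is a smaller
element of another run and lies in `lowSide`, or the run contains the value of the pivot; the run of
the pivot is of the second kind. -/
theorem runCount_le_low (hμ : μ ∈ S) (h : runCount R S ≤ 2 * ((S.image R).filter fun k =>
    (runPart R S k).card ≤ 2 * ((runPart R S k).filter fun p => a p ≤ a μ).card).card) :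
    runCount R S ≤ 2 * (runCount R (lowSide a R S μ) + equalRuns a R S μ) := by
  refine h.trans (Nat.mul_le_mul_left 2 ?_)
  refine le_trans (Finset.card_le_card ?_) (Finset.card_union_le _ _)
  intro k hk
  obtain ⟨hk1, hk2⟩ := Finset.mem_filter.1 hk
  obtain ⟨q, hq, rfl⟩ := Finset.mem_image.1 hk1
  have h0 : 0 < (runPart R S (R q)).card := Finset.card_pos.2 ⟨q, by simp [runPart, hq]⟩
  obtain ⟨p, hp⟩ := Finset.card_pos.1 (show 0 < _ by omega :
    0 < ((runPart R S (R q)).filter fun p => a p ≤ a μ).card)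
  simp only [runPart, Finset.mem_filter] at hp
  obtain ⟨⟨hp1, hp2⟩, hp3⟩ := hp
  rw [Finset.mem_union, ← hp2]
  rcases hp3.lt_or_eq with h | h
  · by_cases hR : R p = R μ
    · exact Or.inr (hR ▸ Finset.mem_image_of_mem _ (by simp [hμ]))
    · exact Or.inl (Finset.mem_image_of_mem _ (mem_lowSide_of_ne hp1 hR h))
  · exact Or.inr (Finset.mem_image_of_mem _ (by simp [hp1, h]))

theorem runCount_le_high (hμ : μ ∈ S) (h : runCount R S ≤ 2 * ((S.image R).filter fun k =>
    (runPart R S k).card ≤ 2 * ((runPart R S k).filter fun p => a μ ≤ a p).card).card) :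
    runCount R S ≤ 2 * (runCount R (highSide a R S μ) + equalRuns a R S μ) := by
  refine h.trans (Nat.mul_le_mul_left 2 ?_)
  refine le_trans (Finset.card_le_card ?_) (Finset.card_union_le _ _)
  intro k hk
  obtain ⟨hk1, hk2⟩ := Finset.mem_filter.1 hk
  obtain ⟨q, hq, rfl⟩ := Finset.mem_image.1 hk1
  have h0 : 0 < (runPart R S (R q)).card := Finset.card_pos.2 ⟨q, by simp [runPart, hq]⟩
  obtain ⟨p, hp⟩ := Finset.card_pos.1 (show 0 < _ by omega :
    0 < ((runPart R S (R q)).filter fun p => a μ ≤ a p).card)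
  simp only [runPart, Finset.mem_filter] at hp
  obtain ⟨⟨hp1, hp2⟩, hp3⟩ := hp
  rw [Finset.mem_union, ← hp2]
  rcases hp3.lt_or_eq with h | h
  · by_cases hR : R p = R μ
    · exact Or.inr (hR ▸ Finset.mem_image_of_mem _ (by simp [hμ]))
    · exact Or.inl (Finset.mem_image_of_mem _ (mem_highSide_of_ne hp1 hR h))
  · exact Or.inr (Finset.mem_image_of_mem _ (by simp [hp1, h]))

/-- An element of another run goes to a side or equals the pivot, and the run of the pivot is
counted by `equalRuns`. The middle therefore hides no run. -/
theorem runCount_le_parts (hμ : μ ∈ S) : runCount R S ≤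
    runCount R (lowSide a R S μ) + runCount R (highSide a R S μ) + equalRuns a R S μ := by
  refine le_trans (Finset.card_le_card ?_) ((Finset.card_union_le _ _).trans
    (Nat.add_le_add_right (Finset.card_union_le _ _) _))
  intro k hk
  obtain ⟨p, hp, rfl⟩ := Finset.mem_image.1 hk
  rw [Finset.mem_union, Finset.mem_union]
  by_cases hR : R p = R μ
  · exact Or.inr (hR ▸ Finset.mem_image_of_mem _ (by simp [hμ]))
  rcases lt_trichotomy (a p) (a μ) with h | h | h
  · exact Or.inl (Or.inl (Finset.mem_image_of_mem _ (mem_lowSide_of_ne hp hR h)))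
  · exact Or.inr (Finset.mem_image_of_mem _ (by simp [hp, h]))
  · exact Or.inl (Or.inr (Finset.mem_image_of_mem _ (mem_highSide_of_ne hp hR h)))

/-! ### The linear part of the cost -/

/-- When the two sub-instances have together few runs more than the instance, both have
significantly fewer runs than it. -/
theorem node_gain {m ml mr me : ℕ} {bl br : ℝ} (hl : ml ≤ m) (hr : mr ≤ m)
    (h1 : m ≤ ml + mr + me) (h2 : m ≤ 2 * (ml + me)) (h3 : m ≤ 2 * (mr + me))
    (hbl : (ml : ℝ) ≤ bl) (hbr : (mr : ℝ) ≤ br) :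
    (m : ℝ) ≤ 4 * (bl * (lg m - lg ml) + br * (lg m - lg mr)) +
      4 * (ml + mr + 2 * me - m) := by
  have gl : 0 ≤ lg m - lg ml := sub_nonneg.2 (lg_mono hl)
  have gr : 0 ≤ lg m - lg mr := sub_nonneg.2 (lg_mono hr)
  have el : (ml : ℝ) * (lg m - lg ml) ≤ bl * (lg m - lg ml) := mul_le_mul_of_nonneg_right hbl gl
  have er : (mr : ℝ) * (lg m - lg mr) ≤ br * (lg m - lg mr) := mul_le_mul_of_nonneg_right hbr gr
  have pl : 0 ≤ (ml : ℝ) * (lg m - lg ml) := mul_nonneg (Nat.cast_nonneg _) gl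
  have pr : 0 ≤ (mr : ℝ) * (lg m - lg mr) := mul_nonneg (Nat.cast_nonneg _) gr
  -- Either the surplus of pieces is at least m/4 and pays for m alone, or it is smaller. In the
  -- latter case `h2` and `h3` force both `ml` and `mr` to be at most 3m/4.
  by_cases hc : m ≤ 4 * (ml + mr + 2 * me - m)
  · have : (m : ℝ) ≤ 4 * (ml + mr + 2 * me - m) := by
      have h4 : 5 * m ≤ 4 * (ml + mr + 2 * me) := by omega
      have h5 : (5 * m : ℝ) ≤ 4 * (ml + mr + 2 * me) := by exact_mod_cast h4
      linarith
    linarith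
  -- Since (4/3) ^ 3 > 2, a loss of a quarter of the runs lowers the logarithm by at least 1/3.
  · have key : ∀ x : ℕ, 4 * x ≤ 3 * m → (x : ℝ) * (1 / 3) ≤ x * (lg m - lg x) := by
      intro x hx
      rcases Nat.eq_zero_or_pos x with rfl | hx0
      · simp
      refine mul_le_mul_of_nonneg_left ?_ (Nat.cast_nonneg _)
      have h4 : (4 * x) ^ 3 ≤ (3 * m) ^ 3 := Nat.pow_le_pow_left hx 3
      have h5 : 2 * x ^ 3 ≤ m ^ 3 := by
        have e1 : (4 * x) ^ 3 = 64 * x ^ 3 := by ring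
        have e2 : (3 * m) ^ 3 = 27 * m ^ 3 := by ring
        omega
      have h6 := lg_mono h5
      rw [lg_mul (by norm_num) (by positivity), lg_pow, lg_pow, lg_two] at h6
      push_cast at h6
      linarith
    have k1 := key ml (by omega)
    have k2 := key mr (by omega)
    have h6 : (m : ℝ) ≤ ml + mr + me := by exact_mod_cast h1
    have h7 : (0 : ℝ) ≤ me := Nat.cast_nonneg _
    linarith

namespace PivotTree

variable (a R) in
/-- The number of pieces into which the runs are cut, without the middle elements different from
the pivots. -/
def pieces (T : PivotTree ι) (S : Finset ι) : ℝ :=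
  T.sum a R (fun S => runCount R S) (fun S μ => equalRuns a R S μ) S

variable (a R) in
/-- The sum of `x lg x` over the numbers `x` of pieces in the leaves and of the pivot values. -/
noncomputable def pieceEntropy (T : PivotTree ι) (S : Finset ι) : ℝ :=
  T.sum a R (fun S => xlg (runCount R S)) (fun S μ => xlg (equalRuns a R S μ)) S

variable (a R) in
/-- The sum of the numbers of runs over the nodes. -/
def runSum (T : PivotTree ι) (S : Finset ι) : ℝ :=
  T.sum a R (fun _ => 0) (fun S _ => runCount R S) S

variable {Y : Finset α}

theorem runCount_le_pieces (T : PivotTree ι) :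
    ∀ S, T.Valid a R Y S → (runCount R S : ℝ) ≤ T.pieces a R S := by
  induction T with
  | leaf => intro S _; exact le_rfl
  | node μ l r ihl ihr =>
    intro S ⟨_, hμ, _, _, hl, hr⟩
    have h1 := ihl _ hl
    have h2 := ihr _ hr
    have h3 : (runCount R S : ℝ) ≤ runCount R (lowSide a R S μ) + runCount R (highSide a R S μ) +
      equalRuns a R S μ := by exact_mod_cast runCount_le_parts hμ
    unfold pieces at h1 h2 ⊢
    simp only [sum]
    linarith

theorem pieces_le_card (T : PivotTree ι) :
    ∀ S, T.Valid a R Y S → T.pieces a R S ≤ S.card := by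
  induction T with
  | leaf => intro S _; exact Nat.cast_le.2 (runCount_le_card _)
  | node μ l r ihl ihr =>
    intro S ⟨_, hμ, _, _, hl, hr⟩
    have h1 := ihl _ hl
    have h2 := ihr _ hr
    have h3 := card_sides_add_le (a := a) (R := R) (S := S) (μ := μ)
    have h4 : equalRuns a R S μ ≤ _ := runCount_le_card _
    have h5 : ((lowSide a R S μ).card : ℝ) + (highSide a R S μ).card + equalRuns a R S μ ≤
      S.card := by exact_mod_cast le_trans (by omega) h3
    unfold pieces at h1 h2 ⊢
    simp only [sum]
    linarith

/-- The first bracket is the entropy of the pieces: passing to a child with `x` of the `m` runs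
lowers it by lg m - lg x for every piece of that child. The second bracket collects the surplus of
pieces. In it `S.card` falls by at least `equalRuns` at each node, which gives the second copy of
`me` in `node_gain`. -/
theorem runSum_le (T : PivotTree ι) : ∀ S, T.Valid a R Y S → T.runSum a R S ≤
    4 * (T.pieces a R S * lg (runCount R S) - T.pieceEntropy a R S) +
      4 * (T.pieces a R S - runCount R S + S.card) := by
  induction T with
  | leaf =>
    intro S _
    simp only [runSum, pieces, pieceEntropy, sum, xlg]
    have : (0 : ℝ) ≤ S.card := Nat.cast_nonneg _
    linarith
  | node μ l r ihl ihr =>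
    intro S ⟨_, hμ, hlow, hhigh, hl, hr⟩
    have h1 := ihl _ hl
    have h2 := ihr _ hr
    have b1 := runCount_le_pieces l _ hl
    have b2 := runCount_le_pieces r _ hr
    have g := node_gain (runCount_mono (R := R) (lowSide_subset (a := a) (R := R) (μ := μ)))
      (runCount_mono (R := R) (highSide_subset (a := a) (R := R) (μ := μ)))
      (runCount_le_parts hμ) (runCount_le_low hμ hlow) (runCount_le_high hμ hhigh) b1 b2
    have h3 := card_sides_add_le (a := a) (R := R) (S := S) (μ := μ)
    have h4 : equalRuns a R S μ ≤ _ := runCount_le_card _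
    have h5 : ((lowSide a R S μ).card : ℝ) + (highSide a R S μ).card + equalRuns a R S μ ≤
      S.card := by exact_mod_cast le_trans (by omega) h3
    have h6 : xlg (equalRuns a R S μ) ≤ equalRuns a R S μ * lg (runCount R S) :=
      mul_le_mul_of_nonneg_left (lg_mono equalRuns_le) (Nat.cast_nonneg _)
    unfold runSum pieces pieceEntropy at *
    simp only [sum]
    nlinarith

/-! ### The cost of the searches -/

variable (a R) in
/-- The part of the run of the pivot in the middle. -/
def middleRun (S : Finset ι) (μ : ι) : Finset ι := runPart R (middle a R S μ) (R μ)

variable (a R) in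
/-- The number of elements of the run `k` in `S` with a value `x` that satisfies `P x`. -/
def runFilter (S : Finset ι) (k : ℕ) (P : α → Prop) [DecidablePred P] : ℕ :=
  ((runPart R S k).filter fun p => P (a p)).card

variable (a R) in
/-- The cost of the searches at a node, up to a constant and the number of runs. -/
noncomputable def searchNode (S : Finset ι) (μ : ι) : ℝ :=
  ∑ k ∈ (Finset.univ.image R).erase (R μ),
    (lg (1 + min (runFilter a R S k (· < a μ)) (runFilter a R S k (a μ ≤ ·))) +
      lg (1 + min (runFilter a R S k (· ≤ a μ)) (runFilter a R S k (a μ < ·)))) +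
  2 * lg (1 + (middleRun a R S μ).card)

variable (a R) in
/-- The sum of the search costs over the nodes. -/
noncomputable def searchSum (T : PivotTree ι) (S : Finset ι) : ℝ :=
  T.sum a R (fun _ => 0) (searchNode a R) S

variable (a R) in
/-- The total weight of the pieces into which the runs are cut. -/
noncomputable def weightSum (T : PivotTree ι) (S : Finset ι) : ℝ :=
  T.sum a R (fun S => ∑ k ∈ Finset.univ.image R, weight (runPart R S k).card)
    (fun S μ => ∑ k ∈ Finset.univ.image R, weight (runFilter a R S k (· = a μ)) +
      weight ((middleRun a R S μ).filter fun p => a p < a μ).card +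
      weight ((middleRun a R S μ).filter fun p => a μ < a p).card) S

theorem card_filter_trichotomy (S : Finset ι) (x : α) :
    S.card = (S.filter fun p => a p < x).card + (S.filter fun p => a p = x).card +
      (S.filter fun p => x < a p).card := by
  rw [← Finset.card_filter_add_card_filter_not (s := S) (fun p => a p < x),
    ← Finset.card_filter_add_card_filter_not (s := S.filter fun p => ¬ a p < x) (fun p => a p = x),
    Finset.filter_filter, Finset.filter_filter, add_assoc]
  congr 2
  · congr 1
    ext p
    simp only [Finset.mem_filter]
    exact ⟨fun h => ⟨h.1, h.2.2⟩, fun h => ⟨h.1, by simp [h.2], h.2⟩⟩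
  · congr 1
    ext p
    simp only [Finset.mem_filter]
    exact ⟨fun h => ⟨h.1, lt_of_le_of_ne (not_lt.1 h.2.1) (Ne.symm h.2.2)⟩,
      fun h => ⟨h.1, h.2.not_gt, h.2.ne'⟩⟩

theorem card_filter_le_eq (S : Finset ι) (x : α) : (S.filter fun p => a p ≤ x).card =
    (S.filter fun p => a p < x).card + (S.filter fun p => a p = x).card := by
  rw [← Finset.card_union_of_disjoint]
  · congr 1
    ext p
    simp only [Finset.mem_filter, Finset.mem_union, le_iff_lt_or_eq]
    tauto
  · exact Finset.disjoint_left.2 fun p h h' => (Finset.mem_filter.1 h).2.ne (Finset.mem_filter.1 h').2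

theorem card_filter_ge_eq (S : Finset ι) (x : α) : (S.filter fun p => x ≤ a p).card =
    (S.filter fun p => a p = x).card + (S.filter fun p => x < a p).card := by
  rw [← Finset.card_union_of_disjoint]
  · congr 1
    ext p
    simp only [Finset.mem_filter, Finset.mem_union, le_iff_lt_or_eq, eq_comm (a := x)]
    tauto
  · exact Finset.disjoint_left.2 fun p h h' => (Finset.mem_filter.1 h').2.ne' (Finset.mem_filter.1 h).2

theorem runPart_lowSide {k : ℕ} (hk : k ≠ R μ) :
    (runPart R (lowSide a R S μ) k).card = runFilter a R S k (· < a μ) := by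
  unfold runFilter runPart
  congr 1
  ext p
  simp only [Finset.mem_filter]
  constructor
  · rintro ⟨h1, h2⟩
    exact ⟨⟨lowSide_subset h1, h2⟩, lowSide_lt h1⟩
  · rintro ⟨⟨h1, h2⟩, h3⟩
    exact ⟨mem_lowSide_of_ne h1 (h2 ▸ hk) h3, h2⟩

theorem runPart_highSide {k : ℕ} (hk : k ≠ R μ) :
    (runPart R (highSide a R S μ) k).card = runFilter a R S k (a μ < ·) := by
  unfold runFilter runPart
  congr 1
  ext p
  simp only [Finset.mem_filter]
  constructor
  · rintro ⟨h1, h2⟩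
    exact ⟨⟨highSide_subset h1, h2⟩, lt_highSide h1⟩
  · rintro ⟨⟨h1, h2⟩, h3⟩
    exact ⟨mem_highSide_of_ne h1 (h2 ▸ hk) h3, h2⟩

theorem card_runPart_split (S : Finset ι) (μ : ι) (k : ℕ) :
    (runPart R S k).card = (runPart R (lowSide a R S μ) k).card +
      (runPart R (middle a R S μ) k).card + (runPart R (highSide a R S μ) k).card := by
  rw [← Finset.card_union_of_disjoint, ← Finset.card_union_of_disjoint]
  · congr 1
    ext p
    simp only [runPart, Finset.mem_filter, Finset.mem_union, mem_middle]
    have h1 : p ∈ lowSide a R S μ → p ∈ S := fun h => lowSide_subset h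
    have h2 : p ∈ highSide a R S μ → p ∈ S := fun h => highSide_subset h
    tauto
  · refine Finset.disjoint_left.2 fun p h h' => ?_
    simp only [runPart, Finset.mem_filter, Finset.mem_union, mem_middle] at h h'
    rcases h with h | h
    · exact (lowSide_lt h.1).not_gt (lt_highSide h'.1)
    · exact h.1.2.2 h'.1
  · refine Finset.disjoint_left.2 fun p h h' => ?_
    simp only [runPart, Finset.mem_filter, mem_middle] at h h'
    exact h'.1.2.1 h.1

theorem runFilter_eq_middleRun : runFilter a R S (R μ) (· = a μ) =
    ((middleRun a R S μ).filter fun p => a p = a μ).card := by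
  unfold runFilter middleRun runPart
  congr 1
  ext p
  simp only [Finset.mem_filter, mem_middle]
  constructor
  · rintro ⟨⟨h1, h2⟩, h3⟩
    exact ⟨⟨⟨h1, fun h => (lowSide_lt h).ne h3, fun h => (lt_highSide h).ne' h3⟩, h2⟩, h3⟩
  · rintro ⟨⟨h1, h2⟩, h3⟩
    exact ⟨⟨h1.1, h2⟩, h3⟩

/-- In the other runs `potential_split` pays for the two searches. In the run of the pivot the
middle part is given up: its potential is at most four times its weight, and the two searches in it
cost at most twice its weight, whence the factor 6. -/
theorem searchNode_le (S : Finset ι) (μ : ι) :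
    ∑ k ∈ Finset.univ.image R, potential (runPart R S k).card + searchNode a R S μ ≤
      ∑ k ∈ Finset.univ.image R, potential (runPart R (lowSide a R S μ) k).card +
      ∑ k ∈ Finset.univ.image R, potential (runPart R (highSide a R S μ) k).card +
      6 * (∑ k ∈ Finset.univ.image R, weight (runFilter a R S k (· = a μ)) +
        weight ((middleRun a R S μ).filter fun p => a p < a μ).card +
        weight ((middleRun a R S μ).filter fun p => a μ < a p).card) := by
  have hj : R μ ∈ Finset.univ.image R := Finset.mem_image_of_mem _ (Finset.mem_univ _)
  rw [← Finset.add_sum_erase _ _ hj, ← Finset.add_sum_erase _ _ hj, ← Finset.add_sum_erase _ _ hj,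
    ← Finset.add_sum_erase _ _ hj]
  unfold searchNode
  have hsum : ∑ k ∈ (Finset.univ.image R).erase (R μ), (potential (runPart R S k).card +
      (lg (1 + min (runFilter a R S k (· < a μ)) (runFilter a R S k (a μ ≤ ·))) +
      lg (1 + min (runFilter a R S k (· ≤ a μ)) (runFilter a R S k (a μ < ·))))) ≤
      ∑ k ∈ (Finset.univ.image R).erase (R μ), (potential (runPart R (lowSide a R S μ) k).card +
        potential (runPart R (highSide a R S μ) k).card +
        6 * weight (runFilter a R S k (· = a μ))) := by
    refine Finset.sum_le_sum fun k hk => ?_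
    have hk := (Finset.mem_erase.1 hk).1
    rw [runPart_lowSide hk, runPart_highSide hk]
    have h1 := card_filter_trichotomy (a := a) (runPart R S k) (a μ)
    have h2 := card_filter_le_eq (a := a) (runPart R S k) (a μ)
    have h3 := card_filter_ge_eq (a := a) (runPart R S k) (a μ)
    have h4 := potential_split (runFilter a R S k (· < a μ)) (runFilter a R S k (· = a μ))
      (runFilter a R S k (a μ < ·))
    have h5 := weight_nonneg (runFilter a R S k (· = a μ))
    unfold runFilter at *
    rw [h1, h2, h3]
    linarith
  simp only [Finset.sum_add_distrib, ← Finset.mul_sum] at hsum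
  have hm := card_runPart_split (a := a) (R := R) S μ (R μ)
  have h1 := card_filter_trichotomy (a := a) (middleRun a R S μ) (a μ)
  rw [← runFilter_eq_middleRun] at h1
  set b := ((middleRun a R S μ).filter fun p => a p < a μ).card
  set e := runFilter a R S (R μ) (· = a μ)
  set b' := ((middleRun a R S μ).filter fun p => a μ < a p).card
  change (runPart R S (R μ)).card = _ + (middleRun a R S μ).card + _ at hm
  rw [h1] at hm ⊢
  rw [hm]
  have p1 := potential_add_le ((runPart R (lowSide a R S μ) (R μ)).card + (b + e + b'))
    (runPart R (highSide a R S μ) (R μ)).card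
  have p2 := potential_add_le (runPart R (lowSide a R S μ) (R μ)).card (b + e + b')
  have p3 := potential_le (b + e + b')
  have p4 := lg_one_add_le_weight (b + e + b')
  have p5 := weight_add_le (b + e) b'
  have p6 := weight_add_le b e
  simp only [Finset.sum_add_distrib]
  linarith

/-- `searchNode_le` telescopes along the tree; in the leaves the potential is bounded by the weight.
-/
theorem searchSum_le (T : PivotTree ι) : ∀ S : Finset ι,
    T.searchSum a R S + ∑ k ∈ Finset.univ.image R, potential (runPart R S k).card ≤
      6 * T.weightSum a R S := by
  induction T with
  | leaf =>
    intro S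
    simp only [searchSum, weightSum, sum, zero_add, Finset.mul_sum]
    refine Finset.sum_le_sum fun k _ => ?_
    have := potential_le (runPart R S k).card
    have := weight_nonneg (runPart R S k).card
    linarith
  | node μ l r ihl ihr =>
    intro S
    have h1 := ihl (lowSide a R S μ)
    have h2 := ihr (highSide a R S μ)
    have h3 := searchNode_le (a := a) (R := R) S μ
    unfold searchSum weightSum at *
    simp only [sum]
    linarith

end PivotTree

end Tree

/-! ### The structure of recursion trees -/

section Structure

variable {ι : Type} [Fintype ι] [DecidableEq ι] {α : Type*} [LinearOrder α]
  (a : ι → α) (R : ι → ℕ)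

/-- The relation of being in the same block, for an arbitrary assignment `R` of runs. -/
def Linked (p t : ι) : Prop :=
  R p = R t ∧
    (a p = a t ∨ ∀ s, R s ≠ R p → ¬(min (a p) (a t) ≤ a s ∧ a s ≤ max (a p) (a t)))

/-- A set of elements that contains all elements with values between two of its values. -/
def Full (S : Finset ι) : Prop := ∀ x ∈ S, ∀ y ∈ S, ∀ t, a x ≤ a t → a t ≤ a y → t ∈ S

namespace PivotTree

/-- The nodes of a recursion tree for `S`: the sub-instances with their pivots. -/
def nodes : PivotTree ι → Finset ι → List (Finset ι × ι)
  | leaf, _ => []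
  | node μ l r, S => l.nodes (lowSide a R S μ) ++ (S, μ) :: r.nodes (highSide a R S μ)

/-- The elements in the leaves of a recursion tree for `S`. -/
def leafSet : PivotTree ι → Finset ι → Finset ι
  | leaf, S => S
  | node μ l r, S => l.leafSet (lowSide a R S μ) ∪ r.leafSet (highSide a R S μ)

end PivotTree

variable {a R} {S : Finset ι} {μ x y : ι} {Y : Finset α}

theorem Linked.symm (h : Linked a R x y) : Linked a R y x := by
  obtain ⟨h1, h2⟩ := h
  refine ⟨h1.symm, h2.imp Eq.symm fun h s hs => ?_⟩
  rw [min_comm, max_comm]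
  exact h s (h1 ▸ hs)

theorem not_linked_of_between {s : ι} (hs : R s ≠ R x) (h1 : a y ≤ a s) (h2 : a s ≤ a x)
    (h3 : a y < a x) : ¬ Linked a R x y := by
  rintro ⟨_, h | h⟩
  · exact h3.ne' h
  · exact h s hs ⟨(min_le_right _ _).trans h1, h2.trans (le_max_left _ _)⟩

/-- The low side is closed downwards in `S`, as it is cut off by a single value. -/
theorem lt_of_mem_lowSide (hy : y ∈ lowSide a R S μ) (hx : x ∈ S) (hx' : x ∉ lowSide a R S μ) :
    a y < a x := by
  obtain ⟨_, s, h1, h2, h3, h4⟩ := mem_lowSide.1 hy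
  by_contra h
  exact hx' (mem_lowSide.2 ⟨hx, s, h1, h2, h3, (not_lt.1 h).trans h4⟩)

theorem lt_of_mem_highSide (hy : y ∈ highSide a R S μ) (hx : x ∈ S)
    (hx' : x ∉ highSide a R S μ) : a x < a y := by
  obtain ⟨_, s, h1, h2, h3, h4⟩ := mem_highSide.1 hy
  by_contra h
  exact hx' (mem_highSide.2 ⟨hx, s, h1, h2, h3, h4.trans (not_lt.1 h)⟩)

/-- A foreign element separates `y` from `x`. In the run of the pivot it is the element `s` of
another run that puts `y` into the low side; in any other run it is the pivot itself. -/
theorem not_linked_lowSide (hy : y ∈ lowSide a R S μ) (hx : x ∈ S)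
    (hx' : x ∉ lowSide a R S μ) : ¬ Linked a R x y := by
  intro hL
  have hlt := lt_of_mem_lowSide hy hx hx'
  have hR := hL.1
  by_cases hj : R x = R μ
  · obtain ⟨_, s, h1, h2, h3, h4⟩ := mem_lowSide.1 hy
    refine not_linked_of_between (hj ▸ h2) h4 ?_ hlt hL
    by_contra h
    exact hx' (mem_lowSide.2 ⟨hx, s, h1, h2, h3, (not_le.1 h).le⟩)
  · refine not_linked_of_between (Ne.symm hj) (lowSide_lt hy).le ?_ hlt hL
    by_contra h
    exact hx' (mem_lowSide_of_ne hx hj (not_le.1 h))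

theorem not_linked_highSide (hy : y ∈ highSide a R S μ) (hx : x ∈ S)
    (hx' : x ∉ highSide a R S μ) : ¬ Linked a R x y := by
  intro hL
  have hlt := lt_of_mem_highSide hy hx hx'
  have hR := hL.1
  by_cases hj : R x = R μ
  · obtain ⟨_, s, h1, h2, h3, h4⟩ := mem_highSide.1 hy
    refine not_linked_of_between (hR ▸ hj ▸ h2) ?_ h4 hlt hL.symm
    by_contra h
    exact hx' (mem_highSide.2 ⟨hx, s, h1, h2, h3, (not_le.1 h).le⟩)
  · refine not_linked_of_between (hR ▸ Ne.symm hj) ?_ (lt_highSide hy).le hlt hL.symm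
    by_contra h
    exact hx' (mem_highSide_of_ne hx hj (not_le.1 h))

theorem Full.lowSide (h : Full a S) : Full a (lowSide a R S μ) := by
  intro x hx y hy t h1 h2
  obtain ⟨hy1, s, hs⟩ := mem_lowSide.1 hy
  exact mem_lowSide.2 ⟨h x (lowSide_subset hx) y hy1 t h1 h2, s, hs.1, hs.2.1, hs.2.2.1,
    h2.trans hs.2.2.2⟩

theorem Full.highSide (h : Full a S) : Full a (highSide a R S μ) := by
  intro x hx y hy t h1 h2
  obtain ⟨hx1, s, hs⟩ := mem_highSide.1 hx
  exact mem_highSide.2 ⟨h x hx1 y (highSide_subset hy) t h1 h2, s, hs.1, hs.2.1, hs.2.2.1,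
    hs.2.2.2.trans h1⟩

theorem full_univ : Full a Finset.univ := fun _ _ _ _ _ _ _ => Finset.mem_univ _

/-- Sub-instances are intervals of values, so all copies of the pivot value are still present and
the local count is a global one. -/
theorem equalRuns_eq (h : Full a S) (hμ : μ ∈ S) :
    equalRuns a R S μ = runCount R (Finset.univ.filter fun p => a p = a μ) := by
  unfold equalRuns
  congr 1
  ext p
  simp only [Finset.mem_filter, Finset.mem_univ, true_and, and_iff_right_iff_imp]
  intro hp
  exact h μ hμ μ hμ p hp.ge hp.le

theorem runFilter_eq (h : Full a S) (hμ : μ ∈ S) (k : ℕ) :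
    PivotTree.runFilter a R S k (· = a μ) =
      (Finset.univ.filter fun p => a p = a μ ∧ R p = k).card := by
  unfold PivotTree.runFilter runPart
  congr 1
  ext p
  simp only [Finset.mem_filter, Finset.mem_univ, true_and]
  constructor
  · rintro ⟨⟨_, h1⟩, h2⟩
    exact ⟨h2, h1⟩
  · rintro ⟨h1, h2⟩
    exact ⟨⟨h μ hμ μ hμ p h1.ge h1.le, h2⟩, h1⟩

theorem run_eq_of_mem_middle (hx : x ∈ middle a R S μ) (h : a x ≠ a μ) : R x = R μ := by
  obtain ⟨h1, h2, h3⟩ := mem_middle.1 hx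
  by_contra hR
  rcases h.lt_or_gt with h | h
  · exact h2 (mem_lowSide_of_ne h1 hR h)
  · exact h3 (mem_highSide_of_ne h1 hR h)

theorem pivot_mem_middle (h : μ ∈ S) : μ ∈ middle a R S μ :=
  mem_middle.2 ⟨h, fun h => (lowSide_lt h).ne rfl, fun h => (lt_highSide h).ne rfl⟩

/-- Two middle elements of the run of the pivot on the same side of it are both in the block of
the pivot or both not. -/
theorem linked_pivot_of_linked (hS : Full a S) (hμ : μ ∈ S)
    (hy : y ∈ middle a R S μ) (hxμ : a x ≠ a μ) (hyμ : a y ≠ a μ) (h : Linked a R x μ) :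
    Linked a R y μ := by
  obtain ⟨hy1, hy2, hy3⟩ := mem_middle.1 hy
  have hR := run_eq_of_mem_middle hy hyμ
  refine ⟨hR, Or.inr fun s hs hb => ?_⟩
  rw [hR] at hs
  -- A foreign element strictly between `y` and the pivot would put `y` into one of the sides. A
  -- foreign element equal to the pivot would already separate `x`, whose value differs from that of
  -- the pivot, from it.
  rcases lt_trichotomy (a s) (a μ) with h1 | h1 | h1
  · have h2 : a y ≤ a s := by
      rcases min_le_iff.1 hb.1 with h2 | h2
      · exact h2
      · exact absurd h1 h2.not_gt
    exact hy2 (mem_lowSide.2 ⟨hy1, s, hS y hy1 μ hμ s h2 h1.le, hs, h1, h2⟩)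
  · rcases h.2 with h2 | h2
    · exact hxμ h2
    · exact h2 s (h.1 ▸ hs) ⟨(min_le_right _ _).trans h1.ge, h1.le.trans (le_max_right _ _)⟩
  · have h2 : a s ≤ a y := by
      rcases le_max_iff.1 hb.2 with h2 | h2
      · exact h2
      · exact absurd h1 h2.not_gt
    exact hy3 (mem_highSide.2 ⟨hy1, s, hS μ hμ y hy1 s h1.le h2, hs, h1, h2⟩)

namespace PivotTree

theorem nodes_map_snd (T : PivotTree ι) : ∀ S, (T.nodes a R S).map Prod.snd = T.pivots := by
  induction T with
  | leaf => intro S; rfl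
  | node μ l r ihl ihr => intro S; simp [nodes, pivots, ihl, ihr]

theorem mem_pivots_of_mem_nodes {T : PivotTree ι} {S S' : Finset ι} {μ : ι}
    (h : (S', μ) ∈ T.nodes a R S) : μ ∈ T.pivots := by
  rw [← nodes_map_snd (a := a) (R := R) T S]
  exact List.mem_map.2 ⟨_, h, rfl⟩

theorem exists_mem_nodes {T : PivotTree ι} (S : Finset ι) {μ : ι} (h : μ ∈ T.pivots) :
    ∃ S', (S', μ) ∈ T.nodes a R S := by
  rw [← nodes_map_snd (a := a) (R := R) T S] at h
  obtain ⟨⟨S', μ'⟩, h1, h2⟩ := List.mem_map.1 h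
  exact ⟨S', by simpa [← h2] using h1⟩

theorem mem_nodes_node {μ ν : ι} {l r : PivotTree ι} {S S' : Finset ι} :
    (S', ν) ∈ (node μ l r).nodes a R S ↔ (S', ν) ∈ l.nodes a R (lowSide a R S μ) ∨
      (S' = S ∧ ν = μ) ∨ (S', ν) ∈ r.nodes a R (highSide a R S μ) := by
  simp [nodes]

theorem mem_pivots_node {μ ν : ι} {l r : PivotTree ι} :
    ν ∈ (node μ l r).pivots ↔ ν ∈ l.pivots ∨ ν = μ ∨ ν ∈ r.pivots := by
  simp [pivots]

theorem nodes_subset (T : PivotTree ι) : ∀ S, T.Valid a R Y S → ∀ S' μ,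
    (S', μ) ∈ T.nodes a R S → μ ∈ S' ∧ S' ⊆ S := by
  induction T with
  | leaf => intro S _ S' μ h; simp [nodes] at h
  | node μ l r ihl ihr =>
    intro S ⟨_, hμ, _, _, hl, hr⟩ S' ν h
    rcases mem_nodes_node.1 h with h | ⟨rfl, rfl⟩ | h
    · exact ⟨(ihl _ hl _ _ h).1, (ihl _ hl _ _ h).2.trans lowSide_subset⟩
    · exact ⟨hμ, subset_rfl⟩
    · exact ⟨(ihr _ hr _ _ h).1, (ihr _ hr _ _ h).2.trans highSide_subset⟩

theorem nodes_full (T : PivotTree ι) : ∀ S, Full a S → ∀ S' μ,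
    (S', μ) ∈ T.nodes a R S → Full a S' := by
  induction T with
  | leaf => intro S _ S' μ h; simp [nodes] at h
  | node μ l r ihl ihr =>
    intro S hS S' ν h
    rcases mem_nodes_node.1 h with h | ⟨rfl, rfl⟩ | h
    · exact ihl _ hS.lowSide _ _ h
    · exact hS
    · exact ihr _ hS.highSide _ _ h

theorem pivots_mem (T : PivotTree ι) {S : Finset ι} (hT : T.Valid a R Y S) {μ : ι}
    (h : μ ∈ T.pivots) : μ ∈ S := by
  obtain ⟨S', h'⟩ := exists_mem_nodes (a := a) (R := R) S h
  have := nodes_subset T S hT _ _ h'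
  exact this.2 this.1

/-- The tree is a search tree: the left subtree takes its pivots below `μ`, the right one above it.
Hence no pivot value occurs twice. -/
theorem pivots_sorted (T : PivotTree ι) : ∀ S, T.Valid a R Y S →
    T.pivots.Pairwise fun μ ν => a μ < a ν := by
  induction T with
  | leaf => intro S _; exact List.Pairwise.nil
  | node μ l r ihl ihr =>
    intro S ⟨_, hμ, _, _, hl, hr⟩
    rw [pivots, List.pairwise_append, List.pairwise_cons]
    refine ⟨ihl _ hl, ⟨fun ν h => lt_highSide (pivots_mem r hr h), ihr _ hr⟩, fun ν h ξ h' => ?_⟩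
    have h1 := lowSide_lt (pivots_mem l hl h)
    rcases List.mem_cons.1 h' with rfl | h'
    · exact h1
    · exact h1.trans (lt_highSide (pivots_mem r hr h'))

theorem pivots_injOn {T : PivotTree ι} {S : Finset ι} (hT : T.Valid a R Y S) {μ ν : ι}
    (hμ : μ ∈ T.pivots) (hν : ν ∈ T.pivots) (h : a μ = a ν) : μ = ν := by
  have h1 : (T.pivots.map a).Nodup :=
    List.pairwise_map.2 ((pivots_sorted T S hT).imp fun h => h.ne)
  exact List.inj_on_of_nodup_map h1 hμ hν h

/-- No other pivot lies between a middle element and the pivot. -/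
theorem pivot_middle_noncrossing (T : PivotTree ι) : ∀ S, T.Valid a R Y S → ∀ S' μ,
    (S', μ) ∈ T.nodes a R S → ∀ x ∈ middle a R S' μ, ∀ ν ∈ T.pivots, ν ≠ μ →
      (a x < a ν ∧ a μ < a ν) ∨ (a ν < a x ∧ a ν < a μ) := by
  induction T with
  | leaf => intro S _ S' μ h; simp [nodes] at h
  | node ξ l r ihl ihr =>
    intro S ⟨_, hξ, _, _, hl, hr⟩ S' μ h x hx ν hν hne
    have hx1 := (mem_middle.1 hx).1
    rcases mem_nodes_node.1 h with h | ⟨rfl, rfl⟩ | h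
    · obtain ⟨h1, h2⟩ := nodes_subset l _ hl _ _ h
      have h3 := lowSide_lt (h2 h1)
      have h4 := lowSide_lt (h2 hx1)
      rcases mem_pivots_node.1 hν with hν | rfl | hν
      · exact ihl _ hl _ _ h x hx ν hν hne
      · exact Or.inl ⟨h4, h3⟩
      · have h5 := lt_highSide (pivots_mem r hr hν)
        exact Or.inl ⟨h4.trans h5, h3.trans h5⟩
    · rcases mem_pivots_node.1 hν with hν | rfl | hν
      · have h1 := pivots_mem l hl hν
        exact Or.inr ⟨lt_of_mem_lowSide h1 hx1 (mem_middle.1 hx).2.1, lowSide_lt h1⟩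
      · exact absurd rfl hne
      · have h1 := pivots_mem r hr hν
        exact Or.inl ⟨lt_of_mem_highSide h1 hx1 (mem_middle.1 hx).2.2, lt_highSide h1⟩
    · obtain ⟨h1, h2⟩ := nodes_subset r _ hr _ _ h
      have h3 := lt_highSide (h2 h1)
      have h4 := lt_highSide (h2 hx1)
      rcases mem_pivots_node.1 hν with hν | rfl | hν
      · have h5 := lowSide_lt (pivots_mem l hl hν)
        exact Or.inr ⟨h5.trans h4, h5.trans h3⟩
      · exact Or.inr ⟨h4, h3⟩
      · exact ihr _ hr _ _ h x hx ν hν hne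

/-- The block of a pivot is contained in the middle at its node. -/
theorem mem_middle_of_linked (T : PivotTree ι) : ∀ S, T.Valid a R Y S → ∀ S' μ,
    (S', μ) ∈ T.nodes a R S → ∀ x ∈ S, ∀ p ∈ S', a p = a μ → Linked a R x p →
      x ∈ middle a R S' μ := by
  induction T with
  | leaf => intro S _ S' μ h; simp [nodes] at h
  | node ξ l r ihl ihr =>
    intro S ⟨_, hξ, _, _, hl, hr⟩ S' μ h x hx p hp hpμ hL
    rcases mem_nodes_node.1 h with h | ⟨rfl, rfl⟩ | h
    · obtain ⟨h1, h2⟩ := nodes_subset l _ hl _ _ h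
      by_cases hx' : x ∈ lowSide a R S ξ
      · exact ihl _ hl _ _ h x hx' p hp hpμ hL
      · exact absurd hL (not_linked_lowSide (h2 hp) hx hx')
    · refine mem_middle.2 ⟨hx, fun h => ?_, fun h => ?_⟩
      · exact not_linked_lowSide h hp (fun h => (lowSide_lt h).ne hpμ) hL.symm
      · exact not_linked_highSide h hp (fun h => (lt_highSide h).ne' hpμ) hL.symm
    · obtain ⟨h1, h2⟩ := nodes_subset r _ hr _ _ h
      by_cases hx' : x ∈ highSide a R S ξ
      · exact ihr _ hr _ _ h x hx' p hp hpμ hL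
      · exact absurd hL (not_linked_highSide (h2 hp) hx hx')

theorem leafSet_subset (T : PivotTree ι) : ∀ S, T.leafSet a R S ⊆ S := by
  induction T with
  | leaf => intro S; exact subset_rfl
  | node μ l r ihl ihr =>
    intro S
    exact Finset.union_subset ((ihl _).trans lowSide_subset) ((ihr _).trans highSide_subset)

theorem not_mem_middle_of_mem_leafSet (T : PivotTree ι) : ∀ S, T.Valid a R Y S → ∀ S' μ,
    (S', μ) ∈ T.nodes a R S → ∀ x ∈ T.leafSet a R S, x ∉ middle a R S' μ := by
  induction T with
  | leaf => intro S _ S' μ h; simp [nodes] at h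
  | node ξ l r ihl ihr =>
    intro S ⟨_, hξ, _, _, hl, hr⟩ S' μ h x hx hm
    have hxS := (mem_middle.1 hm).1
    rcases mem_nodes_node.1 h with h | ⟨rfl, rfl⟩ | h
    · rcases Finset.mem_union.1 hx with hx | hx
      · exact ihl _ hl _ _ h x hx hm
      · exact (lowSide_lt ((nodes_subset l _ hl _ _ h).2 hxS)).not_gt
          (lt_highSide (leafSet_subset r _ hx))
    · rcases Finset.mem_union.1 hx with hx | hx
      · exact (mem_middle.1 hm).2.1 (leafSet_subset l _ hx)
      · exact (mem_middle.1 hm).2.2 (leafSet_subset r _ hx)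
    · rcases Finset.mem_union.1 hx with hx | hx
      · exact (lowSide_lt (leafSet_subset l _ hx)).not_gt
          (lt_highSide ((nodes_subset r _ hr _ _ h).2 hxS))
      · exact ihr _ hr _ _ h x hx hm

/-- The middles of different nodes are disjoint. -/
theorem pivot_eq_of_mem_middle (T : PivotTree ι) : ∀ S, T.Valid a R Y S → ∀ S₁ μ₁ S₂ μ₂,
    (S₁, μ₁) ∈ T.nodes a R S → (S₂, μ₂) ∈ T.nodes a R S → ∀ x ∈ middle a R S₁ μ₁,
      x ∈ middle a R S₂ μ₂ → μ₁ = μ₂ := by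
  induction T with
  | leaf => intro S _ S₁ μ₁ _ _ h; simp [nodes] at h
  | node ξ l r ihl ihr =>
    intro S ⟨_, hξ, _, _, hl, hr⟩ S₁ μ₁ S₂ μ₂ h h' x hx hx'
    have e : ∀ S' μ, (S', μ) ∈ (node ξ l r).nodes a R S → x ∈ middle a R S' μ →
        (x ∈ lowSide a R S ξ ∧ (S', μ) ∈ l.nodes a R (lowSide a R S ξ)) ∨
        (x ∈ middle a R S ξ ∧ μ = ξ) ∨
        (x ∈ highSide a R S ξ ∧ (S', μ) ∈ r.nodes a R (highSide a R S ξ)) := by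
      intro S' μ h hx
      have hxS := (mem_middle.1 hx).1
      rcases mem_nodes_node.1 h with h | ⟨rfl, rfl⟩ | h
      · exact Or.inl ⟨(nodes_subset l _ hl _ _ h).2 hxS, h⟩
      · exact Or.inr (Or.inl ⟨hx, rfl⟩)
      · exact Or.inr (Or.inr ⟨(nodes_subset r _ hr _ _ h).2 hxS, h⟩)
    have hd : x ∈ lowSide a R S ξ → x ∉ highSide a R S ξ := fun h =>
      Finset.disjoint_left.1 disjoint_lowSide_highSide h
    have hm := mem_middle (a := a) (R := R) (S := S) (μ := ξ) (p := x)
    rcases e _ _ h hx with ⟨h1, h2⟩ | ⟨h1, rfl⟩ | ⟨h1, h2⟩ <;>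
    rcases e _ _ h' hx' with ⟨h3, h4⟩ | ⟨h3, h4⟩ | ⟨h3, h4⟩
    · exact ihl _ hl _ _ _ _ h2 h4 x hx hx'
    · exact absurd h1 (hm.1 h3).2.1
    · exact absurd h3 (hd h1)
    · exact absurd h3 (hm.1 h1).2.1
    · exact h4.symm
    · exact absurd h3 (hm.1 h1).2.2
    · exact absurd h1 (hd h3)
    · exact absurd h1 (hm.1 h3).2.2
    · exact ihr _ hr _ _ _ _ h2 h4 x hx hx'

theorem exists_middle_of_not_mem_leafSet (T : PivotTree ι) : ∀ S, ∀ x ∈ S,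
    x ∉ T.leafSet a R S → ∃ S' μ, (S', μ) ∈ T.nodes a R S ∧ x ∈ middle a R S' μ := by
  induction T with
  | leaf => intro S x hx h; exact absurd hx h
  | node ξ l r ihl ihr =>
    intro S x hx h
    rw [leafSet, Finset.mem_union, not_or] at h
    by_cases h1 : x ∈ lowSide a R S ξ
    · obtain ⟨S', μ, h2, h3⟩ := ihl _ x h1 h.1
      exact ⟨S', μ, mem_nodes_node.2 (Or.inl h2), h3⟩
    by_cases h2 : x ∈ highSide a R S ξ
    · obtain ⟨S', μ, h2, h3⟩ := ihr _ x h2 h.2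
      exact ⟨S', μ, mem_nodes_node.2 (Or.inr (Or.inr h2)), h3⟩
    · exact ⟨S, ξ, mem_nodes_node.2 (Or.inr (Or.inl ⟨rfl, rfl⟩)), mem_middle.2 ⟨hx, h1, h2⟩⟩

/-- The two parts are evaluated differently: the leaves by the gaps between pivots, the nodes by the
pivot values. -/
theorem sum_eq_leaves_add_nodes (fl : Finset ι → ℝ) (fn : Finset ι → ι → ℝ) (T : PivotTree ι) :
    ∀ S, T.sum a R fl fn S = T.sum a R fl (fun _ _ => 0) S +
      ((T.nodes a R S).map fun N => fn N.1 N.2).sum := by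
  induction T with
  | leaf => intro S; simp [sum, nodes]
  | node μ l r ihl ihr =>
    intro S
    simp only [sum, nodes, List.map_append, List.map_cons, List.sum_append, List.sum_cons]
    rw [ihl, ihr]
    ring

theorem gapOf_mono (P : Finset α) {u v : α} (h : u ≤ v) : gapOf P u ≤ gapOf P v :=
  Finset.card_le_card fun w hw => by
    simp only [Finset.mem_filter] at *
    exact ⟨hw.1, hw.2.trans_le h⟩

theorem gapOf_lt (P : Finset α) {u w v : α} (hw : w ∈ P) (h : u ≤ w) (h' : w < v) :
    gapOf P u < gapOf P v := by
  refine Finset.card_lt_card ((Finset.ssubset_iff_of_subset fun z hz => ?_).2 ⟨w, ?_, ?_⟩)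
  · simp only [Finset.mem_filter] at *
    exact ⟨hz.1, hz.2.trans (h.trans_lt h')⟩
  · simp [hw, h']
  · simp [h]

theorem gapOf_le_card (P : Finset α) (u : α) : gapOf P u ≤ P.card :=
  Finset.card_le_card (Finset.filter_subset _ _)

theorem gapOf_injOn (P : Finset α) {u v : α} (hu : u ∈ P) (hv : v ∈ P)
    (h : gapOf P u = gapOf P v) : u = v := by
  rcases lt_trichotomy u v with h1 | h1 | h1
  · exact absurd h (gapOf_lt P hu le_rfl h1).ne
  · exact h1
  · exact absurd h (gapOf_lt P hv le_rfl h1).ne'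

/-- The leaves of a recursion tree correspond to the gaps between the pivots. -/
theorem sum_leaves_eq (fl : Finset ι → ℝ) (h0 : fl ∅ = 0) (P : Finset α) (T : PivotTree ι) :
    ∀ S, T.Valid a R Y S → (∀ μ ∈ T.pivots, a μ ∈ P) →
      (∀ v ∈ P, (∃ μ ∈ T.pivots, a μ = v) ∨ (∀ x ∈ S, a x < v) ∨ ∀ x ∈ S, v < a x) →
      T.sum a R fl (fun _ _ => 0) S = ∑ i ∈ Finset.range (P.card + 1),
        fl ((T.leafSet a R S).filter fun p => gapOf P (a p) = i) := by
  induction T with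
  | leaf =>
    intro S _ _ hP
    simp only [sum, leafSet]
    rcases S.eq_empty_or_nonempty with rfl | ⟨x, hx⟩
    · simp [h0]
    -- A leaf has no pivots, so every value of `P` lies below all of `S` or above all of it; all
    -- elements of the leaf have the same gap.
    have hc : ∀ y ∈ S, gapOf P (a y) = gapOf P (a x) := by
      intro y hy
      unfold gapOf
      congr 1
      refine Finset.filter_congr fun v hv => ?_
      rcases hP v hv with ⟨μ, h, _⟩ | h | h
      · simp [pivots] at h
      · exact iff_of_false (h y hy).not_gt (h x hx).not_gt
      · exact iff_of_true (h y hy) (h x hx)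
    rw [Finset.sum_eq_single_of_mem (gapOf P (a x))
      (Finset.mem_range.2 (Nat.lt_succ_of_le (gapOf_le_card _ _)))]
    · rw [Finset.filter_true_of_mem hc]
    · intro i _ hi
      rw [Finset.filter_false_of_mem, h0]
      intro y hy h
      exact hi (h ▸ hc y hy)
  | node μ l r ihl ihr =>
    intro S ⟨_, hμ, _, _, hl, hr⟩ hP1 hP2
    have hμP := hP1 μ (mem_pivots_node.2 (Or.inr (Or.inl rfl)))
    simp only [sum, leafSet, zero_add]
    rw [ihl _ hl (fun ν h => hP1 ν (mem_pivots_node.2 (Or.inl h))),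
      ihr _ hr (fun ν h => hP1 ν (mem_pivots_node.2 (Or.inr (Or.inr h)))),
      ← Finset.sum_add_distrib]
    · refine Finset.sum_congr rfl fun i _ => ?_
      rw [Finset.filter_union]
      -- The pivot separates the gaps of the two subtrees, so at most one of them has leaf elements
      -- in the gap `i`; with `fl ∅ = 0` the values may be added.
      rcases (((l.leafSet a R (lowSide a R S μ))).filter
        fun p => gapOf P (a p) = i).eq_empty_or_nonempty with h | ⟨x, hx⟩
      · rw [h, h0, zero_add, Finset.empty_union]
      · have : ((r.leafSet a R (highSide a R S μ))).filter (fun p => gapOf P (a p) = i) = ∅ := by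
          rw [Finset.filter_eq_empty_iff]
          intro y hy hyi
          rw [Finset.mem_filter] at hx
          have h1 := lowSide_lt (leafSet_subset l _ hx.1)
          have h2 := lt_highSide (leafSet_subset r _ hy)
          have h3 := gapOf_lt P hμP h1.le h2
          omega
        rw [this, h0, add_zero, Finset.union_empty]
    · intro v hv
      rcases hP2 v hv with ⟨ν, h, rfl⟩ | h | h
      · rcases mem_pivots_node.1 h with h | rfl | h
        · exact Or.inr (Or.inr fun x hx => (lowSide_lt (pivots_mem l hl h)).trans (lt_highSide hx))
        · exact Or.inr (Or.inr fun x hx => lt_highSide hx)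
        · exact Or.inl ⟨ν, h, rfl⟩
      · exact Or.inr (Or.inl fun x hx => h x (highSide_subset hx))
      · exact Or.inr (Or.inr fun x hx => h x (highSide_subset hx))
    · intro v hv
      rcases hP2 v hv with ⟨ν, h, rfl⟩ | h | h
      · rcases mem_pivots_node.1 h with h | rfl | h
        · exact Or.inl ⟨ν, h, rfl⟩
        · exact Or.inr (Or.inl fun x hx => lowSide_lt hx)
        · exact Or.inr (Or.inl fun x hx => (lowSide_lt hx).trans (lt_highSide (pivots_mem r hr h)))
      · exact Or.inr (Or.inl fun x hx => h x (lowSide_subset hx))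
      · exact Or.inr (Or.inr fun x hx => h x (lowSide_subset hx))

end PivotTree

end Structure

/-! ### Blocks and selection blocks -/

section Blocks

/-- Used to compare numbers of classes: each value of `g` is sent to the value of `f` at a chosen
representative. -/
theorem card_image_le_card_image {ι κ κ' : Type*} [DecidableEq κ] [DecidableEq κ'] {s : Finset ι}
    {f : ι → κ} {g : ι → κ'} (h : ∀ p ∈ s, ∀ q ∈ s, f p = f q → g p = g q) :
    (s.image g).card ≤ (s.image f).card := by
  classical
  have hc : ∀ c ∈ s.image g, ∃ p ∈ s, g p = c := fun c hc => Finset.mem_image.1 hc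
  rcases s.eq_empty_or_nonempty with rfl | ⟨p₀, _⟩
  · simp
  have : Nonempty ι := ⟨p₀⟩
  choose! rep h1 h2 using hc
  refine Finset.card_le_card_of_injOn (fun c => f (rep c))
    (fun c hc => Finset.mem_image_of_mem _ (h1 c hc)) fun c hc d hd hcd => ?_
  rw [← h2 c hc, ← h2 d hd]
  exact h _ (h1 c hc) _ (h1 d hd) hcd

theorem card_image_eq_card_image {ι κ κ' : Type*} [DecidableEq κ] [DecidableEq κ'] {s : Finset ι}
    {f : ι → κ} {g : ι → κ'} (h : ∀ p ∈ s, ∀ q ∈ s, f p = f q ↔ g p = g q) :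
    (s.image g).card = (s.image f).card :=
  le_antisymm (card_image_le_card_image fun p hp q hq => (h p hp q hq).1)
    (card_image_le_card_image fun p hp q hq => (h p hp q hq).2)

variable {α : Type*} [LinearOrder α] {n : ℕ} (a : Fin n → α) (P : Finset α)

/-- The block of `p` is a pivot block. -/
def InPivotBlock (p : Fin n) : Prop := ∃ t, SameBlock a p t ∧ a t ∈ P

variable {a P} {p t u : Fin n}

theorem SameBlock.refl (p : Fin n) : SameBlock a p p := ⟨rfl, Or.inl rfl⟩

theorem SameBlock.symm (h : SameBlock a p t) : SameBlock a t p := Linked.symm (R := runOf a) h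

/-- The interval spanned by `p` and `u` is covered by the intervals spanned by `p`, `t` and by `t`,
`u`. If one of these pairs has equal values, the other condition carries over unchanged. -/
theorem SameBlock.trans (h : SameBlock a p t) (h' : SameBlock a t u) : SameBlock a p u := by
  obtain ⟨h1, h2⟩ := h
  obtain ⟨h3, h4⟩ := h'
  refine ⟨h1.trans h3, ?_⟩
  rcases h2 with h2 | h2
  · rw [h1, h2]; exact h4
  rcases h4 with h4 | h4
  · rw [← h4]; exact Or.inr h2
  refine Or.inr fun s hs hb => ?_
  have k1 := h2 s hs
  have k2 := h4 s (h1 ▸ hs)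
  simp only [min_le_iff, le_max_iff] at hb k1 k2
  rcases le_total (a s) (a t) with h | h <;> tauto

theorem mem_blockOf : t ∈ blockOf a p ↔ SameBlock a p t := by simp [blockOf]

theorem blockOf_eq_iff : blockOf a p = blockOf a t ↔ SameBlock a p t := by
  constructor
  · intro h
    rw [← mem_blockOf, h, mem_blockOf]
    exact SameBlock.refl t
  · intro h
    ext u
    rw [mem_blockOf, mem_blockOf]
    exact ⟨fun h' => h.symm.trans h', fun h' => h.trans h'⟩

theorem blocksOfValue_eq (v : α) :
    blocksOfValue a v = (Finset.univ.filter fun p => a p = v).image (blockOf a) := by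
  ext B
  simp only [blocksOfValue, blocks, Finset.mem_filter, Finset.mem_image, Finset.mem_univ, true_and]
  constructor
  · rintro ⟨⟨t, rfl⟩, p, hp, hv⟩
    exact ⟨p, hv, (blockOf_eq_iff.2 (mem_blockOf.1 hp)).symm⟩
  · rintro ⟨p, hv, rfl⟩
    exact ⟨⟨p, rfl⟩, p, mem_blockOf.2 (SameBlock.refl p), hv⟩

variable (a) in
/-- The number of runs that contain the value `v`. -/
def valueRuns (v : α) : ℕ := runCount (runOf a) (Finset.univ.filter fun p => a p = v)

/-- Equal elements of a run are in one block, so the blocks of a value correspond to the runs that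
contain it. -/
theorem card_blocksOfValue (v : α) : (blocksOfValue a v).card = valueRuns a v := by
  rw [blocksOfValue_eq]
  refine card_image_eq_card_image fun p hp q hq => ?_
  simp only [Finset.mem_filter, Finset.mem_univ, true_and] at hp hq
  rw [blockOf_eq_iff]
  exact ⟨fun h => ⟨h, Or.inl (hp.trans hq.symm)⟩, fun h => h.1⟩

theorem blockOf_mem_pivotBlocks : blockOf a p ∈ pivotBlocks a P ↔ InPivotBlock a P p := by
  simp only [pivotBlocks, Finset.mem_biUnion, blocksOfValue_eq, Finset.mem_image,
    Finset.mem_filter, Finset.mem_univ, true_and, InPivotBlock]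
  constructor
  · rintro ⟨v, hv, t, rfl, h⟩
    exact ⟨t, (blockOf_eq_iff.1 h).symm, hv⟩
  · rintro ⟨t, h, ht⟩
    exact ⟨a t, ht, t, rfl, blockOf_eq_iff.2 h.symm⟩

theorem InPivotBlock.of_sameBlock (h : SameBlock a p t) (hp : InPivotBlock a P p) :
    InPivotBlock a P t := by
  obtain ⟨u, h1, h2⟩ := hp
  exact ⟨u, h.symm.trans h1, h2⟩

theorem mem_selectionBlockOf : t ∈ selectionBlockOf a P p ↔
    (InPivotBlock a P p ∧ SameBlock a p t) ∨ (¬ InPivotBlock a P p ∧ ¬ InPivotBlock a P t ∧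
      runOf a t = runOf a p ∧ gapOf P (a t) = gapOf P (a p)) := by
  unfold selectionBlockOf
  by_cases h : InPivotBlock a P p
  · rw [if_pos (blockOf_mem_pivotBlocks.2 h), mem_blockOf]
    simp [h]
  · rw [if_neg (fun h' => h (blockOf_mem_pivotBlocks.1 h')), Finset.mem_filter,
      blockOf_mem_pivotBlocks]
    simp [h]
    tauto

theorem mem_selectionBlockOf_self (p : Fin n) : p ∈ selectionBlockOf a P p := by
  rw [mem_selectionBlockOf]
  by_cases h : InPivotBlock a P p
  · exact Or.inl ⟨h, SameBlock.refl p⟩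
  · exact Or.inr ⟨h, h, rfl, rfl⟩

/-- The selection blocks are the classes of an equivalence relation; later arguments use only this
and `mem_selectionBlockOf`. -/
theorem selectionBlockOf_eq_iff :
    selectionBlockOf a P p = selectionBlockOf a P t ↔ t ∈ selectionBlockOf a P p := by
  constructor
  · intro h
    rw [h]
    exact mem_selectionBlockOf_self t
  · intro h
    ext u
    rw [mem_selectionBlockOf, mem_selectionBlockOf]
    rcases mem_selectionBlockOf.1 h with ⟨h1, h2⟩ | ⟨h1, h2, h3, h4⟩
    · have h3 := h1.of_sameBlock h2
      simp only [h1, h3, true_and, not_true, false_and, or_false]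
      exact ⟨fun h => h2.symm.trans h, fun h => h2.trans h⟩
    · simp only [h1, h2, h3, h4, false_and, false_or]

theorem card_selectionBlocks_eq : ∑ B ∈ selectionBlocks a P, B.card = n := by
  have h := Finset.card_eq_sum_card_image (selectionBlockOf a P) (Finset.univ : Finset (Fin n))
  rw [Finset.card_univ, Fintype.card_fin] at h
  refine Eq.trans (Finset.sum_congr rfl fun B hB => ?_) h.symm
  obtain ⟨p, _, rfl⟩ := Finset.mem_image.1 hB
  congr 1
  ext t
  simp only [Finset.mem_filter, Finset.mem_univ, true_and]
  rw [eq_comm, selectionBlockOf_eq_iff]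

theorem card_pos_of_mem_selectionBlocks {B : Finset (Fin n)} (hB : B ∈ selectionBlocks a P) :
    0 < B.card := by
  obtain ⟨p, _, rfl⟩ := Finset.mem_image.1 hB
  exact Finset.card_pos.2 ⟨p, mem_selectionBlockOf_self p⟩

theorem card_selectionBlocks_le : (selectionBlocks a P).card ≤ n := by
  refine le_trans ?_ (card_selectionBlocks_eq (a := a) (P := P)).le
  rw [Finset.card_eq_sum_ones]
  exact Finset.sum_le_sum fun B hB => card_pos_of_mem_selectionBlocks hB

theorem sum_weight_selectionBlocks : ∑ B ∈ selectionBlocks a P, weight B.card =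
    (selectionBlocks a P).card + ∑ B ∈ selectionBlocks a P, lg B.card := by
  rw [Finset.card_eq_sum_ones, Nat.cast_sum, ← Finset.sum_add_distrib]
  refine Finset.sum_congr rfl fun B hB => ?_
  rw [weight, if_neg (card_pos_of_mem_selectionBlocks hB).ne']
  simp

theorem sum_lg_selectionBlocks_le : ∑ B ∈ selectionBlocks a P, lg B.card ≤ n := by
  have h := card_selectionBlocks_eq (a := a) (P := P)
  calc ∑ B ∈ selectionBlocks a P, lg B.card ≤ ∑ B ∈ selectionBlocks a P, (B.card : ℝ) :=
        Finset.sum_le_sum fun B _ => by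
          have := lg_le_two_thirds B.card
          have : (0 : ℝ) ≤ B.card := Nat.cast_nonneg _
          linarith
    _ = n := by exact_mod_cast h

/-- Pieces that are contained in different selection blocks weigh no more than these. -/
theorem sum_weight_le {κ : Type*} (s : Finset κ) (Z : κ → Finset (Fin n))
    (h1 : ∀ c ∈ s, ∀ x ∈ Z c, ∀ y ∈ Z c, selectionBlockOf a P x = selectionBlockOf a P y)
    (h2 : ∀ c ∈ s, ∀ d ∈ s, ∀ x ∈ Z c, ∀ y ∈ Z d,
      selectionBlockOf a P x = selectionBlockOf a P y → c = d) :
    ∑ c ∈ s, weight (Z c).card ≤ ∑ B ∈ selectionBlocks a P, weight B.card := by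
  classical
  have hc : ∀ c ∈ s.filter (fun c => (Z c).Nonempty), ∃ x, x ∈ Z c :=
    fun c hc => (Finset.mem_filter.1 hc).2
  rw [← Finset.sum_filter_of_ne (p := fun c => (Z c).Nonempty)]
  · rcases isEmpty_or_nonempty (Fin n) with hn | hn
    · rw [Finset.sum_eq_zero]
      · exact Finset.sum_nonneg fun B _ => weight_nonneg _
      · intro c hc'
        obtain ⟨x, _⟩ := hc c hc'
        exact (hn.false x).elim
    choose! rep hrep using hc
    calc _ ≤ ∑ c ∈ s.filter (fun c => (Z c).Nonempty),
          weight (selectionBlockOf a P (rep c)).card := by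
          refine Finset.sum_le_sum fun c hc => weight_mono (Finset.card_le_card fun y hy => ?_)
          rw [← selectionBlockOf_eq_iff]
          exact h1 c (Finset.mem_filter.1 hc).1 _ (hrep c hc) y hy
      _ = ∑ B ∈ (s.filter fun c => (Z c).Nonempty).image fun c => selectionBlockOf a P (rep c),
          weight B.card := by
          rw [Finset.sum_image]
          intro c hc d hd h
          exact h2 c (Finset.mem_filter.1 hc).1 d (Finset.mem_filter.1 hd).1 _ (hrep c hc) _
            (hrep d hd) h
      _ ≤ _ := by
          refine Finset.sum_le_sum_of_subset_of_nonneg ?_ fun B _ _ => weight_nonneg _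
          intro B hB
          obtain ⟨c, _, rfl⟩ := Finset.mem_image.1 hB
          exact Finset.mem_image_of_mem _ (Finset.mem_univ _)
  · intro c _ hne
    by_contra h
    rw [Finset.not_nonempty_iff_eq_empty] at h
    simp [h] at hne

theorem numRuns_eq : numRuns a = runCount (runOf a) Finset.univ := rfl

theorem valueRuns_le_numRuns (v : α) : valueRuns a v ≤ numRuns a :=
  runCount_mono (Finset.filter_subset _ _)

/-- A value that occurs only once lies in one run and contributes 1 · log 1 = 0, so the restriction
to repeated values can be dropped. -/
theorem sum_repeated_eq : ∑ v ∈ repeated a P,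
    ((blocksOfValue a v).card : ℝ) * Real.logb 2 (blocksOfValue a v).card =
      ∑ v ∈ P, xlg (valueRuns a v) := by
  have : ∀ v, ((blocksOfValue a v).card : ℝ) * Real.logb 2 (blocksOfValue a v).card =
    xlg (valueRuns a v) := fun v => by rw [card_blocksOfValue]; rfl
  simp only [this, repeated]
  refine Finset.sum_filter_of_ne fun v _ h => ?_
  by_contra h'
  have h1 : valueRuns a v ≤ 1 := (runCount_le_card _).trans (not_lt.1 h')
  apply h
  interval_cases valueRuns a v <;> simp

variable (a P) in
/-- `β log ρ - ∑ m_i log m_i - ∑ ρ_i log ρ_i`. -/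
noncomputable def excess : ℝ := (selectionBlocks a P).card * lg (numRuns a) -
  ∑ v ∈ P, xlg (valueRuns a v) - ∑ i ∈ Finset.range (P.card + 1), xlg (gapRuns a P i)

theorem synergyBound_eq : synergyBound a P =
    n + ∑ B ∈ selectionBlocks a P, lg B.card + excess a P := by
  unfold synergyBound excess
  rw [sum_repeated_eq]
  simp only [lg, xlg]
  ring

theorem gapRuns_eq (i : ℕ) : gapRuns a P i =
    runCount (runOf a) (Finset.univ.filter fun p => a p ∉ P ∧ gapOf P (a p) = i) := rfl

theorem card_eq_sum_gaps_add_sum_values (P : Finset α) :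
    ∑ i ∈ Finset.range (P.card + 1),
      (Finset.univ.filter fun p => a p ∉ P ∧ gapOf P (a p) = i).card +
    ∑ v ∈ P, (Finset.univ.filter fun p => a p = v).card = n := by
  have h1 := Finset.card_eq_sum_card_fiberwise (f := fun p => gapOf P (a p))
    (s := Finset.univ.filter fun p => a p ∉ P) (t := Finset.range (P.card + 1))
    fun p _ => by simpa using Nat.lt_succ_of_le (PivotTree.gapOf_le_card P (a p))
  have h2 := Finset.card_eq_sum_card_fiberwise (f := a)
    (s := Finset.univ.filter fun p => a p ∈ P) (t := P) fun p hp => by simpa using hp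
  have h3 := Finset.card_filter_add_card_filter_not (s := (Finset.univ : Finset (Fin n)))
    (fun p => a p ∈ P)
  rw [Finset.card_univ, Fintype.card_fin] at h3
  simp only [Finset.filter_filter] at h1 h2
  rw [← h1]
  have h4 : ∑ v ∈ P, (Finset.univ.filter fun p => a p = v).card =
      ∑ v ∈ P, (Finset.univ.filter fun p => a p ∈ P ∧ a p = v).card := by
    refine Finset.sum_congr rfl fun v hv => ?_
    congr 1
    ext p
    simp only [Finset.mem_filter, Finset.mem_univ, true_and]
    exact ⟨fun h => ⟨h ▸ hv, h⟩, fun h => h.2⟩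
  rw [h4, ← h2]
  omega

theorem sum_gapRuns_add_sum_valueRuns_le (P : Finset α) :
    ∑ i ∈ Finset.range (P.card + 1), gapRuns a P i + ∑ v ∈ P, valueRuns a v ≤ n := by
  conv_rhs => rw [← card_eq_sum_gaps_add_sum_values (a := a) P]
  exact Nat.add_le_add (Finset.sum_le_sum fun i _ => runCount_le_card _)
    (Finset.sum_le_sum fun i _ => runCount_le_card _)

theorem card_image_pair {ι : Type*} (s : Finset ι) (g : ι → ℕ) (r : ι → ℕ) (N : ℕ)
    (hN : ∀ p ∈ s, g p < N) :
    (s.image fun p => (g p, r p)).card =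
      ∑ i ∈ Finset.range N, ((s.filter fun p => g p = i).image r).card := by
  rw [Finset.card_eq_sum_card_fiberwise (f := Prod.fst) (t := Finset.range N)]
  · refine Finset.sum_congr rfl fun i _ => ?_
    have : ((s.image fun p => (g p, r p)).filter fun c => c.1 = i) =
        ((s.filter fun p => g p = i).image r).image fun k => (i, k) := by
      ext ⟨j, k⟩
      simp only [Finset.mem_filter, Finset.mem_image, Prod.mk.injEq]
      constructor
      · rintro ⟨⟨p, h1, h2, h3⟩, rfl⟩
        exact ⟨k, ⟨p, ⟨h1, h2⟩, h3⟩, rfl, rfl⟩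
      · rintro ⟨k, ⟨p, ⟨h1, h2⟩, h3⟩, rfl, rfl⟩
        exact ⟨⟨p, h1, h2, h3⟩, rfl⟩
    rw [this, Finset.card_image_of_injective]
    intro k k' h
    exact (Prod.mk.inj h).2
  · intro c hc
    obtain ⟨p, hp, rfl⟩ := Finset.mem_image.1 (Finset.mem_coe.1 hc)
    simpa using hN p hp

theorem card_image_value_pair {ι : Type*} [DecidableEq ι] (s : Finset ι) (b : ι → α) (r : ι → ℕ)
    (hs : ∀ p ∈ s, b p ∈ P) :
    (s.image fun p => (b p, r p)).card =
      ∑ v ∈ P, ((s.filter fun p => b p = v).image r).card := by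
  rw [Finset.card_eq_sum_card_fiberwise (f := Prod.fst) (t := P)]
  · refine Finset.sum_congr rfl fun v _ => ?_
    have : ((s.image fun p => (b p, r p)).filter fun c => c.1 = v) =
        ((s.filter fun p => b p = v).image r).image fun k => (v, k) := by
      ext ⟨j, k⟩
      simp only [Finset.mem_filter, Finset.mem_image, Prod.mk.injEq]
      constructor
      · rintro ⟨⟨p, h1, h2, h3⟩, rfl⟩
        exact ⟨k, ⟨p, ⟨h1, h2⟩, h3⟩, rfl, rfl⟩
      · rintro ⟨k, ⟨p, ⟨h1, h2⟩, h3⟩, rfl, rfl⟩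
        exact ⟨⟨p, h1, h2, h3⟩, rfl⟩
    rw [this, Finset.card_image_of_injective]
    intro k k' h
    exact (Prod.mk.inj h).2
  · intro c hc
    obtain ⟨p, hp, rfl⟩ := Finset.mem_image.1 (Finset.mem_coe.1 hc)
    exact hs p hp

theorem filter_image_valueRuns {v : α} (hv : v ∈ P) :
    (((Finset.univ.filter fun p => a p ∈ P).filter fun p => a p = v).image (runOf a)).card =
      valueRuns a v := by
  unfold valueRuns runCount
  congr 2
  ext p
  simp only [Finset.mem_filter, Finset.mem_univ, true_and]
  exact ⟨fun h => h.2, fun h => ⟨h ▸ hv, h⟩⟩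

/-- There are at most as many selection blocks as pairs of runs and gaps or pivots. -/
theorem card_selectionBlocks_le_sum : (selectionBlocks a P).card ≤
    ∑ i ∈ Finset.range (P.card + 1), gapRuns a P i + ∑ v ∈ P, valueRuns a v := by
  classical
  have hsub : selectionBlocks a P ⊆
      ((Finset.univ.filter fun p => a p ∉ P ∧ ¬ InPivotBlock a P p).image
        (selectionBlockOf a P)) ∪
      ((Finset.univ.filter fun p => a p ∈ P).image (selectionBlockOf a P)) := by
    intro B hB
    obtain ⟨p, _, rfl⟩ := Finset.mem_image.1 hB
    rw [Finset.mem_union]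
    by_cases h : InPivotBlock a P p
    -- A pivot block is represented by one of its elements with a pivot value, so it is charged to a
    -- pair of value and run; the remaining selection blocks are charged to a pair of gap and run.
    · obtain ⟨t, h1, h2⟩ := h
      refine Or.inr (Finset.mem_image.2 ⟨t, by simpa using h2, ?_⟩)
      rw [eq_comm, selectionBlockOf_eq_iff, mem_selectionBlockOf]
      exact Or.inl ⟨⟨t, h1, h2⟩, h1⟩
    · have : a p ∉ P := fun h' => h ⟨p, SameBlock.refl p, h'⟩
      exact Or.inl (Finset.mem_image_of_mem _ (by simp [this, h]))
  refine (Finset.card_le_card hsub).trans ((Finset.card_union_le _ _).trans (Nat.add_le_add ?_ ?_))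
  · refine le_trans (card_image_le_card_image (f := fun p => (gapOf P (a p), runOf a p))
      fun p hp q hq h => ?_) ?_
    · simp only [Finset.mem_filter, Finset.mem_univ, true_and] at hp hq
      obtain ⟨h1, h2⟩ := Prod.mk.inj h
      rw [selectionBlockOf_eq_iff, mem_selectionBlockOf]
      exact Or.inr ⟨hp.2, hq.2, h2.symm, h1.symm⟩
    · rw [card_image_pair _ _ _ (P.card + 1)
        fun p _ => Nat.lt_succ_of_le (PivotTree.gapOf_le_card P (a p))]
      refine Finset.sum_le_sum fun i _ => Finset.card_le_card (Finset.image_subset_image ?_)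
      intro p
      simp only [Finset.mem_filter, Finset.mem_univ, true_and]
      tauto
  · refine le_trans (card_image_le_card_image (f := fun p => (a p, runOf a p))
      fun p hp q hq h => ?_) ?_
    · simp only [Finset.mem_filter, Finset.mem_univ, true_and] at hp hq
      obtain ⟨h1, h2⟩ := Prod.mk.inj h
      rw [selectionBlockOf_eq_iff, mem_selectionBlockOf]
      exact Or.inl ⟨⟨p, SameBlock.refl p, hp⟩, h2, Or.inl h1⟩
    · rw [card_image_value_pair (P := P) _ _ _ fun p hp => by simpa using hp]
      exact (Finset.sum_congr rfl fun v hv => filter_image_valueRuns hv).le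

end Blocks

/-! ### Recursion trees and selection blocks -/

section TreeBlocks

variable {α : Type*} [LinearOrder α] {n : ℕ} {a : Fin n → α} {Y : Finset α}
  {T : PivotTree (Fin n)}

/-- The values of the pivots of a recursion tree. -/
def PivotTree.values (a : Fin n → α) (T : PivotTree (Fin n)) : Finset α := (T.pivots.map a).toFinset

theorem PivotTree.mem_values {v : α} : v ∈ T.values a ↔ ∃ μ ∈ T.pivots, a μ = v := by
  simp [PivotTree.values]

/-- Pivot values are distinct, and at nodes the sub-instances are full; a quantity determined there
by the pivot value turns into a sum over the values. -/
theorem PivotTree.sum_nodes_eq (hT : T.Valid a (runOf a) Y Finset.univ)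
    (fn : Finset (Fin n) → Fin n → ℝ) (φ : α → ℝ)
    (h : ∀ S μ, Full a S → μ ∈ S → fn S μ = φ (a μ)) :
    ((T.nodes a (runOf a) Finset.univ).map fun N => fn N.1 N.2).sum = ∑ v ∈ T.values a, φ v := by
  have h1 : (T.pivots.map a).Nodup :=
    List.pairwise_map.2 ((PivotTree.pivots_sorted T _ hT).imp fun h => h.ne)
  rw [PivotTree.values, List.sum_toFinset _ h1,
    ← PivotTree.nodes_map_snd (a := a) (R := runOf a) T Finset.univ, List.map_map, List.map_map]
  congr 1
  refine List.map_congr_left fun N hN => ?_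
  exact h _ _ (PivotTree.nodes_full T _ full_univ _ _ hN) (PivotTree.nodes_subset T _ hT _ _ hN).1

theorem PivotTree.sum_univ_eq (hT : T.Valid a (runOf a) Y Finset.univ) (fl : Finset (Fin n) → ℝ)
    (h0 : fl ∅ = 0) (fn : Finset (Fin n) → Fin n → ℝ) :
    T.sum a (runOf a) fl fn Finset.univ =
      ∑ i ∈ Finset.range ((T.values a).card + 1),
        fl ((T.leafSet a (runOf a) Finset.univ).filter fun p => gapOf (T.values a) (a p) = i) +
      ((T.nodes a (runOf a) Finset.univ).map fun N => fn N.1 N.2).sum := by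
  rw [PivotTree.sum_eq_leaves_add_nodes, PivotTree.sum_leaves_eq fl h0 (T.values a) T _ hT]
  · exact fun μ h => PivotTree.mem_values.2 ⟨μ, h, rfl⟩
  · exact fun v hv => Or.inl (PivotTree.mem_values.1 hv)

/-- The number of runs in the leaf of a recursion tree in the gap `i`. -/
def PivotTree.leafRuns (a : Fin n → α) (T : PivotTree (Fin n)) (i : ℕ) : ℕ :=
  runCount (runOf a)
    ((T.leafSet a (runOf a) Finset.univ).filter fun p => gapOf (T.values a) (a p) = i)

theorem PivotTree.sum_runs_eq (hT : T.Valid a (runOf a) Y Finset.univ) (φ ψ : ℕ → ℝ)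
    (h0 : φ 0 = 0) : T.sum a (runOf a) (fun S => φ (runCount (runOf a) S))
      (fun S μ => ψ (equalRuns a (runOf a) S μ)) Finset.univ =
    ∑ i ∈ Finset.range ((T.values a).card + 1), φ (T.leafRuns a i) +
      ∑ v ∈ T.values a, ψ (valueRuns a v) := by
  rw [PivotTree.sum_univ_eq hT _ (by simpa [runCount] using h0)]
  rw [PivotTree.sum_nodes_eq hT (fun S μ => ψ (equalRuns a (runOf a) S μ))
    fun v => ψ (valueRuns a v)]
  · rfl
  · intro S μ h hμ
    rw [equalRuns_eq h hμ]
    rfl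

/-- By `mem_middle_of_linked` a pivot block is swallowed by the middle of its node, and leaves avoid
all middles. -/
theorem PivotTree.not_inPivotBlock (hT : T.Valid a (runOf a) Y Finset.univ) {p : Fin n}
    (hp : p ∈ T.leafSet a (runOf a) Finset.univ) : ¬ InPivotBlock a (T.values a) p := by
  rintro ⟨t, h1, h2⟩
  obtain ⟨μ, hμ, ht⟩ := PivotTree.mem_values.1 h2
  obtain ⟨S, hS⟩ := PivotTree.exists_mem_nodes (a := a) (R := runOf a) Finset.univ hμ
  have hμS := (PivotTree.nodes_subset T _ hT _ _ hS).1
  have htS : t ∈ S := PivotTree.nodes_full T _ full_univ _ _ hS μ hμS μ hμS t ht.le ht.ge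
  exact PivotTree.not_mem_middle_of_mem_leafSet T _ hT _ _ hS _ hp
    (PivotTree.mem_middle_of_linked T _ hT _ _ hS p (Finset.mem_univ _) t htS ht.symm h1)

theorem PivotTree.exists_middle_of_inPivotBlock (hT : T.Valid a (runOf a) Y Finset.univ) {p : Fin n}
    (hp : InPivotBlock a (T.values a) p) : ∃ S μ, (S, μ) ∈ T.nodes a (runOf a) Finset.univ ∧
      ∀ q, SameBlock a p q → q ∈ middle a (runOf a) S μ := by
  obtain ⟨t, h1, h2⟩ := hp
  obtain ⟨μ, hμ, ht⟩ := PivotTree.mem_values.1 h2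
  obtain ⟨S, hS⟩ := PivotTree.exists_mem_nodes (a := a) (R := runOf a) Finset.univ hμ
  have hμS := (PivotTree.nodes_subset T _ hT _ _ hS).1
  have htS : t ∈ S := PivotTree.nodes_full T _ full_univ _ _ hS μ hμS μ hμS t ht.le ht.ge
  exact ⟨S, μ, hS, fun q hq => PivotTree.mem_middle_of_linked T _ hT _ _ hS q (Finset.mem_univ _) t
    htS ht.symm (hq.symm.trans h1)⟩

/-- Elements with the values of different pivots are in different blocks. -/
theorem PivotTree.value_eq_of_sameBlock (hT : T.Valid a (runOf a) Y Finset.univ) {p q : Fin n}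
    (hp : a p ∈ T.values a) (hq : a q ∈ T.values a) (h : SameBlock a p q) : a p = a q := by
  obtain ⟨μ, hμ, ht⟩ := PivotTree.mem_values.1 hq
  obtain ⟨S, hS⟩ := PivotTree.exists_mem_nodes (a := a) (R := runOf a) Finset.univ hμ
  have hμS := (PivotTree.nodes_subset T _ hT _ _ hS).1
  have htS : q ∈ S := PivotTree.nodes_full T _ full_univ _ _ hS μ hμS μ hμS q ht.le ht.ge
  have hm := PivotTree.mem_middle_of_linked T _ hT _ _ hS p (Finset.mem_univ _) q htS ht.symm h
  obtain ⟨ν, hν, hs⟩ := PivotTree.mem_values.1 hp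
  by_contra hne
  have hνμ : ν ≠ μ := by
    rintro rfl
    exact hne (hs.symm.trans ht)
  rcases PivotTree.pivot_middle_noncrossing T _ hT _ _ hS p hm ν hν hνμ with h | h
  · exact h.1.ne hs.symm
  · exact h.1.ne hs

/-- Pairs of gap and run in the leaves give different selection blocks that are no pivot blocks;
pairs of pivot value and run give different pivot blocks by `value_eq_of_sameBlock`. -/
theorem PivotTree.sum_leafRuns_add_le (hT : T.Valid a (runOf a) Y Finset.univ) :
    ∑ i ∈ Finset.range ((T.values a).card + 1), T.leafRuns a i +
      ∑ v ∈ T.values a, valueRuns a v ≤ (selectionBlocks a (T.values a)).card := by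
  classical
  set P := T.values a with hP
  have e1 : ∑ i ∈ Finset.range (P.card + 1), T.leafRuns a i ≤
      ((T.leafSet a (runOf a) Finset.univ).image (selectionBlockOf a P)).card := by
    unfold PivotTree.leafRuns runCount
    rw [← card_image_pair _ _ _ (P.card + 1)
      fun p _ => Nat.lt_succ_of_le (PivotTree.gapOf_le_card P (a p))]
    refine card_image_le_card_image fun p hp q hq h => ?_
    rw [selectionBlockOf_eq_iff, mem_selectionBlockOf] at h
    rcases h with h | h
    · exact absurd h.1 (PivotTree.not_inPivotBlock hT hp)
    · exact Prod.ext h.2.2.2.symm h.2.2.1.symm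
  have e2 : ∑ v ∈ P, valueRuns a v ≤
      ((Finset.univ.filter fun p => a p ∈ P).image (selectionBlockOf a P)).card := by
    rw [← Finset.sum_congr rfl fun v hv => filter_image_valueRuns hv,
      ← card_image_value_pair _ _ _ fun p hp => by simpa using hp]
    refine card_image_le_card_image fun p hp q hq h => ?_
    simp only [Finset.mem_filter, Finset.mem_univ, true_and] at hp hq
    rw [selectionBlockOf_eq_iff, mem_selectionBlockOf] at h
    rcases h with h | h
    · exact Prod.ext (PivotTree.value_eq_of_sameBlock hT hp hq h.2) h.2.1
    · exact absurd ⟨p, SameBlock.refl p, hp⟩ h.1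
  refine (Nat.add_le_add e1 e2).trans ?_
  rw [← Finset.card_union_of_disjoint]
  · refine Finset.card_le_card (Finset.union_subset ?_ ?_) <;>
      exact Finset.image_subset_image (Finset.subset_univ _)
  · refine Finset.disjoint_left.2 fun B h h' => ?_
    obtain ⟨p, hp, rfl⟩ := Finset.mem_image.1 h
    obtain ⟨q, hq, hqp⟩ := Finset.mem_image.1 h'
    simp only [Finset.mem_filter, Finset.mem_univ, true_and] at hq
    have hqP : InPivotBlock a P q := ⟨q, SameBlock.refl q, hq⟩
    rw [selectionBlockOf_eq_iff, mem_selectionBlockOf] at hqp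
    rcases hqp with h | h
    · exact PivotTree.not_inPivotBlock hT hp (h.1.of_sameBlock h.2)
    · exact h.1 hqP

/-- No pivot separates a middle element from the pivot of its node, so a smaller middle element lies
in the gap directly below that pivot. -/
theorem PivotTree.gapOf_eq_of_lt (hT : T.Valid a (runOf a) Y Finset.univ)
    {S : Finset (Fin n)} {μ x : Fin n} (hN : (S, μ) ∈ T.nodes a (runOf a) Finset.univ)
    (hx : x ∈ middle a (runOf a) S μ) (h : a x < a μ) :
    gapOf (T.values a) (a x) = gapOf (T.values a) (a μ) := by
  unfold gapOf
  congr 1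
  refine Finset.filter_congr fun v hv => ?_
  obtain ⟨ν, hν, rfl⟩ := PivotTree.mem_values.1 hv
  by_cases hνμ : ν = μ
  · subst hνμ
    exact iff_of_false h.not_gt (lt_irrefl _)
  rcases PivotTree.pivot_middle_noncrossing T _ hT _ _ hN x hx ν hν hνμ with h | h
  · exact iff_of_false h.1.not_gt h.2.not_gt
  · exact iff_of_true h.1 h.2

/-- The gap directly above the pivot; the pivot itself is now counted among the smaller ones, hence
the additional one. -/
theorem PivotTree.gapOf_eq_of_gt (hT : T.Valid a (runOf a) Y Finset.univ)
    {S : Finset (Fin n)} {μ x : Fin n} (hN : (S, μ) ∈ T.nodes a (runOf a) Finset.univ)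
    (hx : x ∈ middle a (runOf a) S μ) (h : a μ < a x) :
    gapOf (T.values a) (a x) = gapOf (T.values a) (a μ) + 1 := by
  have hμ : a μ ∈ T.values a :=
    PivotTree.mem_values.2 ⟨μ, PivotTree.mem_pivots_of_mem_nodes hN, rfl⟩
  unfold gapOf
  rw [← Finset.card_insert_of_notMem (s := (T.values a).filter fun v => v < a μ) (a := a μ)
    (by simp)]
  congr 1
  ext v
  simp only [Finset.mem_filter, Finset.mem_insert]
  constructor
  · rintro ⟨hv, hvx⟩
    obtain ⟨ν, hν, rfl⟩ := PivotTree.mem_values.1 hv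
    by_cases hνμ : ν = μ
    · exact Or.inl (by rw [hνμ])
    rcases PivotTree.pivot_middle_noncrossing T _ hT _ _ hN x hx ν hν hνμ with h | h
    · exact absurd hvx h.1.not_gt
    · exact Or.inr ⟨hv, h.2⟩
  · rintro (rfl | ⟨h1, h2⟩)
    · exact ⟨hμ, h⟩
    · exact ⟨h1, h2.trans h⟩

/-- The number of pivots with `i` smaller pivots: one or zero. -/
def gapTop (P : Finset α) (i : ℕ) : ℕ := (P.filter fun v => gapOf P v = i).card

/-- The number of pivots with `i - 1` smaller pivots. -/
def gapBottom (P : Finset α) (i : ℕ) : ℕ := (P.filter fun v => gapOf P v + 1 = i).card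

theorem gapTop_le_one (P : Finset α) (i : ℕ) : gapTop P i ≤ 1 := by
  refine Finset.card_le_one.2 fun u hu v hv => ?_
  rw [Finset.mem_filter] at hu hv
  exact PivotTree.gapOf_injOn P hu.1 hv.1 (hu.2.trans hv.2.symm)

theorem gapBottom_le_one (P : Finset α) (i : ℕ) : gapBottom P i ≤ 1 := by
  refine Finset.card_le_one.2 fun u hu v hv => ?_
  rw [Finset.mem_filter] at hu hv
  exact PivotTree.gapOf_injOn P hu.1 hv.1 (Nat.succ_injective (hu.2.trans hv.2.symm))

theorem sum_card_fiber_le {κ : Type*} (s : Finset κ) (f : κ → ℕ) (N : ℕ) :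
    ∑ i ∈ Finset.range N, (s.filter fun v => f v = i).card ≤ s.card := by
  classical
  rw [← Finset.card_biUnion]
  · refine Finset.card_le_card fun v hv => ?_
    obtain ⟨i, _, h⟩ := Finset.mem_biUnion.1 hv
    exact (Finset.mem_filter.1 h).1
  · intro i _ j _ hij
    refine Finset.disjoint_left.2 fun v hv hv' => hij ?_
    exact (Finset.mem_filter.1 hv).2.symm.trans (Finset.mem_filter.1 hv').2

/-- The runs in a gap are those of the leaf and at most those of the two adjacent pivots. -/
theorem PivotTree.gapRuns_le (hT : T.Valid a (runOf a) Y Finset.univ) (i : ℕ) :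
    gapRuns a (T.values a) i ≤
      T.leafRuns a i + gapTop (T.values a) i + gapBottom (T.values a) i := by
  classical
  set P := T.values a with hP
  rw [gapRuns_eq]
  have hsub : (Finset.univ.filter fun p => a p ∉ P ∧ gapOf P (a p) = i).image (runOf a) ⊆
      (((T.leafSet a (runOf a) Finset.univ).filter fun p => gapOf P (a p) = i).image (runOf a) ∪
      (((T.pivots.toFinset).filter fun μ => gapOf P (a μ) = i).image (runOf a))) ∪
      (((T.pivots.toFinset).filter fun μ => gapOf P (a μ) + 1 = i).image (runOf a)) := by
    intro k hk
    obtain ⟨x, hx, rfl⟩ := Finset.mem_image.1 hk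
    simp only [Finset.mem_filter, Finset.mem_univ, true_and] at hx
    rw [Finset.mem_union, Finset.mem_union]
    by_cases hl : x ∈ T.leafSet a (runOf a) Finset.univ
    · exact Or.inl (Or.inl (Finset.mem_image_of_mem _ (by simp [hl, hx.2])))
    -- An element of the gap outside the leaf is a middle element in the run of its pivot, and this
    -- pivot bounds the gap from above or from below; so at most two further runs occur.
    obtain ⟨S, μ, hN, hm⟩ := PivotTree.exists_middle_of_not_mem_leafSet T _ x (Finset.mem_univ _) hl
    have hμ := PivotTree.mem_pivots_of_mem_nodes hN
    have hne : a x ≠ a μ := fun h => hx.1 (PivotTree.mem_values.2 ⟨μ, hμ, h.symm⟩)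
    rw [run_eq_of_mem_middle hm hne]
    rcases hne.lt_or_gt with h | h
    · refine Or.inl (Or.inr (Finset.mem_image_of_mem _ ?_))
      have := PivotTree.gapOf_eq_of_lt hT hN hm h
      simp only [Finset.mem_filter, List.mem_toFinset]
      exact ⟨hμ, this.symm.trans hx.2⟩
    · refine Or.inr (Finset.mem_image_of_mem _ ?_)
      have := PivotTree.gapOf_eq_of_gt hT hN hm h
      simp only [Finset.mem_filter, List.mem_toFinset]
      exact ⟨hμ, this.symm.trans hx.2⟩
  have inj : ∀ Z : ℕ → Prop, ∀ [DecidablePred Z], (((T.pivots.toFinset).filter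
      fun μ => Z (gapOf P (a μ))).image (runOf a)).card ≤ (P.filter fun v => Z (gapOf P v)).card := by
    intro Z _
    refine Finset.card_image_le.trans (Finset.card_le_card_of_injOn a ?_ ?_)
    · intro μ h
      simp only [Finset.coe_filter, List.mem_toFinset, Set.mem_ofPred_eq] at h ⊢
      exact ⟨PivotTree.mem_values.2 ⟨μ, h.1, rfl⟩, h.2⟩
    · intro μ h ν h' hμν
      simp only [Finset.coe_filter, List.mem_toFinset, Set.mem_ofPred_eq] at h h'
      exact PivotTree.pivots_injOn hT h.1 h'.1 hμν
  refine (Finset.card_le_card hsub).trans ((Finset.card_union_le _ _).trans (Nat.add_le_add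
    ((Finset.card_union_le _ _).trans (Nat.add_le_add le_rfl ?_)) ?_))
  · exact inj fun g => g = i
  · exact inj fun g => g + 1 = i

theorem PivotTree.leafRuns_le (hT : T.Valid a (runOf a) Y Finset.univ) (i : ℕ) :
    T.leafRuns a i ≤ gapRuns a (T.values a) i := by
  refine runCount_mono fun p hp => ?_
  rw [Finset.mem_filter] at hp ⊢
  exact ⟨Finset.mem_univ _, fun h => PivotTree.not_inPivotBlock hT hp.1
    ⟨p, SameBlock.refl p, h⟩, hp.2⟩

theorem gapRuns_le_numRuns (P : Finset α) (i : ℕ) : gapRuns a P i ≤ numRuns a :=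
  runCount_mono (Finset.filter_subset _ _)

theorem PivotTree.valueRuns_pos {v : α} (hv : v ∈ T.values a) : 0 < valueRuns a v := by
  obtain ⟨μ, _, rfl⟩ := PivotTree.mem_values.1 hv
  unfold valueRuns runCount
  exact Finset.card_pos.2 ⟨runOf a μ,
    Finset.mem_image.2 ⟨μ, Finset.mem_filter.2 ⟨Finset.mem_univ _, rfl⟩, rfl⟩⟩

/-! ### Lower bounds for the selection block bound -/

/-- From (m - 1)(lg r - lg m) ≥ 0 and lg m ≤ 2m/3. Each pivot value can thus pay for one additional
lg r, needed for a run at the bottom of a gap. -/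
theorem lg_le_value {m r : ℕ} (hm : 0 < m) (hr : m ≤ r) :
    lg r ≤ 2 / 3 * m + (m * lg r - xlg m) := by
  have h1 := lg_mono hr
  have h2 := lg_le_two_thirds m
  have h3 : (1 : ℝ) ≤ m := by exact_mod_cast hm
  unfold xlg
  nlinarith

/-- The two surplus runs of a gap are charged differently: the one at the top to the gap itself, by
lg x ≤ 2x/3, and the one at the bottom to the pivot there. This keeps the loss below n. -/
theorem xlg_gap_le {x l u b r : ℕ} (h1 : x ≤ l + u + b) (hx : x ≤ r) (hu : u ≤ 1) :
    xlg x ≤ l * lg r + 2 / 3 * x + b * lg r := by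
  have h2 := lg_mono hx
  have h3 := lg_le_two_thirds x
  have h4 : (x : ℝ) ≤ l + u + b := by exact_mod_cast h1
  have h5 : (u : ℝ) ≤ 1 := by exact_mod_cast hu
  have h6 := lg_nonneg x
  have h7 : (0 : ℝ) ≤ l := Nat.cast_nonneg _
  have h8 : (0 : ℝ) ≤ b := Nat.cast_nonneg _
  have h9 : (x : ℝ) * lg x ≤ (l + u + b) * lg x := mul_le_mul_of_nonneg_right h4 h6
  have h10 : (l : ℝ) * lg x ≤ l * lg r := mul_le_mul_of_nonneg_left h2 h7
  have h11 : (b : ℝ) * lg x ≤ b * lg r := mul_le_mul_of_nonneg_left h2 h8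
  have h12 : (u : ℝ) * lg x ≤ 1 * lg x := mul_le_mul_of_nonneg_right h5 h6
  unfold xlg
  linarith

/-- The difference is at most l lg (x / l) + 2 lg x ≤ x + 4x/3. -/
theorem xlg_sub_le {x l : ℕ} (h1 : x ≤ l + 2) (h2 : l ≤ x) : xlg x - xlg l ≤ 3 * x := by
  rcases Nat.eq_zero_or_pos x with rfl | hx
  · have : l = 0 := by omega
    subst this; simp
  have h3 := lg_le_two_thirds x
  have h4 : (x : ℝ) ≤ l + 2 := by exact_mod_cast h1
  have h5 := lg_nonneg x
  have h6 : (x : ℝ) * lg x ≤ (l + 2) * lg x := mul_le_mul_of_nonneg_right h4 h5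
  have h7 : (l : ℝ) * lg x - l * lg l ≤ x := by
    rcases Nat.eq_zero_or_pos l with rfl | hl
    · simp
    have hl' : (0 : ℝ) < l := by exact_mod_cast hl
    have hx' : (0 : ℝ) < x := by exact_mod_cast hx
    have := logb_two_le (div_pos hx' hl')
    rw [Real.logb_div hx'.ne' hl'.ne', le_div_iff₀ hl'] at this
    unfold lg
    linarith
  have h8 : (0 : ℝ) ≤ x := Nat.cast_nonneg _
  unfold xlg
  linarith

end TreeBlocks

/-! ### From sums over the tree to the selection block bound -/

section LowerBounds

variable {α : Type*} [LinearOrder α] {n : ℕ} {a : Fin n → α} {Y : Finset α}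
  {T : PivotTree (Fin n)}

/-- The β log ρ term covers the leaf pieces and the value pieces. The bottom runs of the gaps cost
at most one log ρ per pivot, which `lg_le_value` provides. The loss is 2/3 for every run in a gap
and for every run of a pivot value, and these are at most n in number. -/
theorem PivotTree.excess_ge (hT : T.Valid a (runOf a) Y Finset.univ) :
    -(2 / 3 * n : ℝ) ≤ excess a (T.values a) := by
  set P := T.values a with hP
  have h1 : ((∑ i ∈ Finset.range (P.card + 1), T.leafRuns a i + ∑ v ∈ P, valueRuns a v : ℕ) : ℝ) *
      lg (numRuns a) ≤ (selectionBlocks a P).card * lg (numRuns a) :=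
    mul_le_mul_of_nonneg_right (by exact_mod_cast PivotTree.sum_leafRuns_add_le hT) (lg_nonneg _)
  have h2 : ∑ i ∈ Finset.range (P.card + 1), xlg (gapRuns a P i) ≤
      ∑ i ∈ Finset.range (P.card + 1), ((T.leafRuns a i : ℝ) * lg (numRuns a) +
        2 / 3 * gapRuns a P i + gapBottom P i * lg (numRuns a)) :=
    Finset.sum_le_sum fun i _ => xlg_gap_le (PivotTree.gapRuns_le hT i) (gapRuns_le_numRuns _ _)
      (gapTop_le_one _ _)
  have h3 : ∑ v ∈ P, lg (numRuns a) ≤ ∑ v ∈ P, (2 / 3 * (valueRuns a v : ℝ) +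
      (valueRuns a v * lg (numRuns a) - xlg (valueRuns a v))) :=
    Finset.sum_le_sum fun v hv => lg_le_value (PivotTree.valueRuns_pos hv) (valueRuns_le_numRuns v)
  have h4 : (∑ i ∈ Finset.range (P.card + 1), (gapBottom P i : ℝ)) * lg (numRuns a) ≤
      P.card * lg (numRuns a) :=
    mul_le_mul_of_nonneg_right (by exact_mod_cast sum_card_fiber_le P _ _) (lg_nonneg _)
  have h5 : ∑ i ∈ Finset.range (P.card + 1), (gapRuns a P i : ℝ) + ∑ v ∈ P, (valueRuns a v : ℝ) ≤
      n := by exact_mod_cast sum_gapRuns_add_sum_valueRuns_le P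
  rw [Finset.sum_const, nsmul_eq_mul] at h3
  simp only [Finset.sum_add_distrib, Finset.sum_sub_distrib, ← Finset.mul_sum,
    ← Finset.sum_mul] at h2 h3
  push_cast at h1
  unfold excess
  linarith

/-- There are at most β pieces, and replacing the runs of the leaves by those of the gaps in x log x
costs at most 3 for each run of a gap. -/
theorem PivotTree.pieces_le_excess (hT : T.Valid a (runOf a) Y Finset.univ) :
    T.pieces a (runOf a) Finset.univ * lg (numRuns a) -
      T.pieceEntropy a (runOf a) Finset.univ ≤ excess a (T.values a) + 3 * n := by
  set P := T.values a with hP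
  have e1 := PivotTree.sum_runs_eq hT (fun x => (x : ℝ)) (fun x => (x : ℝ)) (by simp)
  have e2 := PivotTree.sum_runs_eq hT xlg xlg (by simp)
  unfold PivotTree.pieces PivotTree.pieceEntropy
  rw [e1, e2]
  have h1 : ((∑ i ∈ Finset.range (P.card + 1), T.leafRuns a i + ∑ v ∈ P, valueRuns a v : ℕ) : ℝ) *
      lg (numRuns a) ≤ (selectionBlocks a P).card * lg (numRuns a) :=
    mul_le_mul_of_nonneg_right (by exact_mod_cast PivotTree.sum_leafRuns_add_le hT) (lg_nonneg _)
  have h2 : ∑ i ∈ Finset.range (P.card + 1), (xlg (gapRuns a P i) - xlg (T.leafRuns a i)) ≤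
      ∑ i ∈ Finset.range (P.card + 1), 3 * (gapRuns a P i : ℝ) := by
    refine Finset.sum_le_sum fun i _ => xlg_sub_le ?_ (PivotTree.leafRuns_le hT i)
    have := PivotTree.gapRuns_le hT i
    rw [← hP] at this
    have := gapTop_le_one P i
    have := gapBottom_le_one P i
    omega
  have h5 : ∑ i ∈ Finset.range (P.card + 1), (gapRuns a P i : ℝ) + ∑ v ∈ P, (valueRuns a v : ℝ) ≤
      n := by exact_mod_cast sum_gapRuns_add_sum_valueRuns_le P
  have h6 : (0 : ℝ) ≤ ∑ v ∈ P, (valueRuns a v : ℝ) := Finset.sum_nonneg fun _ _ => Nat.cast_nonneg _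
  simp only [Finset.sum_sub_distrib, ← Finset.mul_sum] at h2
  push_cast at h1
  unfold excess
  linarith

theorem PivotTree.nodes_nodup (hT : T.Valid a (runOf a) Y Finset.univ) :
    (T.nodes a (runOf a) Finset.univ).Nodup := by
  refine List.Nodup.of_map Prod.snd ?_
  rw [PivotTree.nodes_map_snd]
  refine List.Nodup.of_map a ?_
  exact List.pairwise_map.2 ((PivotTree.pivots_sorted T _ hT).imp fun h => h.ne)

/-- The middle elements of the runs of the pivots on one side of the pivots weigh no more than the
selection blocks. -/
theorem PivotTree.sum_weight_middle_le (hT : T.Valid a (runOf a) Y Finset.univ)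
    (Z : Finset (Fin n) → Fin n → Finset (Fin n)) (c : ℕ)
    (hZ : ∀ S μ, Z S μ ⊆ PivotTree.middleRun a (runOf a) S μ) (hne : ∀ S μ, ∀ x ∈ Z S μ, a x ≠ a μ)
    (hc : ∀ S μ, (S, μ) ∈ T.nodes a (runOf a) Finset.univ → ∀ x ∈ Z S μ,
      gapOf (T.values a) (a x) = gapOf (T.values a) (a μ) + c) :
    ((T.nodes a (runOf a) Finset.univ).map fun N => weight (Z N.1 N.2).card).sum ≤
      ∑ B ∈ selectionBlocks a (T.values a), weight B.card := by
  have hZm : ∀ S μ x, x ∈ Z S μ → x ∈ middle a (runOf a) S μ ∧ runOf a x = runOf a μ :=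
    fun S μ x hx => by
      have := hZ S μ hx
      unfold PivotTree.middleRun runPart at this
      exact Finset.mem_filter.1 this
  rw [← List.sum_toFinset _ (PivotTree.nodes_nodup hT)]
  refine sum_weight_le _ (fun N : Finset (Fin n) × Fin n => Z N.1 N.2) ?_ ?_
  · rintro ⟨S, μ⟩ hN x hx y hy
    rw [List.mem_toFinset] at hN
    obtain ⟨mx, rx⟩ := hZm _ _ _ hx
    obtain ⟨my, ry⟩ := hZm _ _ _ hy
    have gx := hc _ _ hN _ hx
    have gy := hc _ _ hN _ hy
    have nx := hne _ _ _ hx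
    have ny := hne _ _ _ hy
    have hμ := (PivotTree.nodes_subset T _ hT _ _ hN).1
    have hS := PivotTree.nodes_full T _ full_univ _ _ hN
    -- Middles of different nodes are disjoint, so a pivot block that contains a middle element
    -- belongs to the pivot of the same node.
    have key : ∀ z, z ∈ Z S μ → InPivotBlock a (T.values a) z → SameBlock a z μ := by
      intro z hz ⟨t, h1, h2⟩
      obtain ⟨mz, rz⟩ := hZm _ _ _ hz
      obtain ⟨ν, hν, ht⟩ := PivotTree.mem_values.1 h2
      obtain ⟨S', hS'⟩ := PivotTree.exists_mem_nodes (a := a) (R := runOf a) Finset.univ hν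
      have hνS := (PivotTree.nodes_subset T _ hT _ _ hS').1
      have htS : t ∈ S' := PivotTree.nodes_full T _ full_univ _ _ hS' ν hνS ν hνS t ht.le ht.ge
      have hm := PivotTree.mem_middle_of_linked T _ hT _ _ hS' z (Finset.mem_univ _) t htS
        ht.symm h1
      have := PivotTree.pivot_eq_of_mem_middle T _ hT _ _ _ _ hN hS' z mz hm
      subst this
      exact h1.trans ⟨h1.1.symm.trans rz, Or.inl ht.symm⟩
    rw [selectionBlockOf_eq_iff, mem_selectionBlockOf]
    -- By `linked_pivot_of_linked` the elements of `Z S μ` are either all in the block of the pivot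
    -- or all outside the pivot blocks, and then in the same run and gap.
    by_cases hx' : InPivotBlock a (T.values a) x
    · have h1 := key x hx hx'
      have h2 : SameBlock a y μ := linked_pivot_of_linked hS hμ my nx ny h1
      exact Or.inl ⟨hx', h1.trans h2.symm⟩
    · refine Or.inr ⟨hx', fun hy' => hx' ?_, ry.trans rx.symm, gy.trans gx.symm⟩
      have h2 : SameBlock a x μ := linked_pivot_of_linked hS hμ mx ny nx (key y hy hy')
      exact ⟨μ, h2, PivotTree.mem_values.2 ⟨μ, PivotTree.mem_pivots_of_mem_nodes hN, rfl⟩⟩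
  · rintro ⟨S, μ⟩ hN ⟨S', μ'⟩ hN' x hx y hy h
    rw [List.mem_toFinset] at hN hN'
    obtain ⟨mx, rx⟩ := hZm _ _ _ hx
    obtain ⟨my, ry⟩ := hZm _ _ _ hy
    have gx := hc _ _ hN _ hx
    have gy := hc _ _ hN' _ hy
    -- Within a pivot block the node is determined by disjointness of middles; otherwise the common
    -- gap minus the fixed offset `c` determines the pivot.
    have hμ : μ = μ' := by
      rw [selectionBlockOf_eq_iff, mem_selectionBlockOf] at h
      rcases h with ⟨h1, h2⟩ | ⟨h1, h2, h3, h4⟩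
      · obtain ⟨S'', ν, hN'', h3⟩ := PivotTree.exists_middle_of_inPivotBlock hT h1
        have e1 := PivotTree.pivot_eq_of_mem_middle T _ hT _ _ _ _ hN hN'' x mx
          (h3 x (SameBlock.refl x))
        have e2 := PivotTree.pivot_eq_of_mem_middle T _ hT _ _ _ _ hN' hN'' y my (h3 y h2)
        exact e1.trans e2.symm
      · have hμ := PivotTree.mem_pivots_of_mem_nodes hN
        have hμ' := PivotTree.mem_pivots_of_mem_nodes hN'
        refine PivotTree.pivots_injOn hT hμ hμ' (PivotTree.gapOf_injOn (T.values a)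
          (PivotTree.mem_values.2 ⟨μ, hμ, rfl⟩) (PivotTree.mem_values.2 ⟨μ', hμ', rfl⟩) ?_)
        omega
    have h2 : ((T.nodes a (runOf a) Finset.univ).map Prod.snd).Nodup := by
      rw [PivotTree.nodes_map_snd]
      refine List.Nodup.of_map a ?_
      exact List.pairwise_map.2 ((PivotTree.pivots_sorted T _ hT).imp fun h => h.ne)
    exact List.inj_on_of_nodup_map h2 hN hN' hμ

/-- The pieces into which the runs are cut weigh at most four times as much as the selection
blocks. -/
theorem PivotTree.weightSum_le (hT : T.Valid a (runOf a) Y Finset.univ) :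
    T.weightSum a (runOf a) Finset.univ ≤
      4 * ∑ B ∈ selectionBlocks a (T.values a), weight B.card := by
  set P := T.values a with hP
  set K := Finset.univ.image (runOf a) with hK
  unfold PivotTree.weightSum
  rw [PivotTree.sum_univ_eq hT _ (by simp [runPart])]
  -- The factor 4 comes from four families of pieces, each of which injects into the selection
  -- blocks: leaf pieces, copies of pivot values, and middle elements below and above the pivots.
  have h1 : ∑ c ∈ Finset.range (P.card + 1) ×ˢ K, weight (runPart (runOf a)
      ((T.leafSet a (runOf a) Finset.univ).filter fun p => gapOf P (a p) = c.1) c.2).card ≤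
      ∑ B ∈ selectionBlocks a P, weight B.card := by
    refine sum_weight_le (κ := ℕ × ℕ) (Finset.range (P.card + 1) ×ˢ K) (fun c : ℕ × ℕ => runPart (runOf a)
      ((T.leafSet a (runOf a) Finset.univ).filter fun p => gapOf P (a p) = c.1) c.2) ?_ ?_
    · intro c _ x hx y hy
      simp only [runPart, Finset.mem_filter] at hx hy
      rw [selectionBlockOf_eq_iff, mem_selectionBlockOf]
      exact Or.inr ⟨PivotTree.not_inPivotBlock hT hx.1.1, PivotTree.not_inPivotBlock hT hy.1.1,
        hy.2.trans hx.2.symm, hy.1.2.trans hx.1.2.symm⟩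
    · intro c _ d _ x hx y hy h
      simp only [runPart, Finset.mem_filter] at hx hy
      rw [selectionBlockOf_eq_iff, mem_selectionBlockOf] at h
      rcases h with h | h
      · exact absurd h.1 (PivotTree.not_inPivotBlock hT hx.1.1)
      · refine Prod.ext ?_ ?_
        · exact hx.1.2.symm.trans (h.2.2.2.symm.trans hy.1.2)
        · exact hx.2.symm.trans (h.2.2.1.symm.trans hy.2)
  have h2 : ∑ c ∈ P ×ˢ K,
      weight (Finset.univ.filter fun p => a p = c.1 ∧ runOf a p = c.2).card ≤
      ∑ B ∈ selectionBlocks a P, weight B.card := by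
    refine sum_weight_le (κ := α × ℕ) (P ×ˢ K) (fun c : α × ℕ => Finset.univ.filter fun p => a p = c.1 ∧ runOf a p = c.2) ?_ ?_
    · intro c hc x hx y hy
      simp only [Finset.mem_filter, Finset.mem_univ, true_and] at hx hy
      rw [selectionBlockOf_eq_iff, mem_selectionBlockOf]
      exact Or.inl ⟨⟨x, SameBlock.refl x, hx.1 ▸ (Finset.mem_product.1 hc).1⟩,
        hx.2.trans hy.2.symm, Or.inl (hx.1.trans hy.1.symm)⟩
    · intro c hc d hd x hx y hy h
      simp only [Finset.mem_filter, Finset.mem_univ, true_and] at hx hy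
      have hx' : a x ∈ P := hx.1 ▸ (Finset.mem_product.1 hc).1
      have hy' : a y ∈ P := hy.1 ▸ (Finset.mem_product.1 hd).1
      rw [selectionBlockOf_eq_iff, mem_selectionBlockOf] at h
      rcases h with h | h
      · refine Prod.ext ?_ ?_
        · exact hx.1.symm.trans ((PivotTree.value_eq_of_sameBlock hT hx' hy' h.2).trans hy.1)
        · exact hx.2.symm.trans (h.2.1.trans hy.2)
      · exact absurd ⟨x, SameBlock.refl x, hx'⟩ h.1
  have h3 := PivotTree.sum_weight_middle_le hT
    (fun S μ => (PivotTree.middleRun a (runOf a) S μ).filter fun p => a p < a μ) 0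
    (fun _ _ => Finset.filter_subset _ _) (fun _ _ x hx => (Finset.mem_filter.1 hx).2.ne)
    fun S μ hN x hx => PivotTree.gapOf_eq_of_lt hT hN
      (Finset.mem_filter.1 (Finset.mem_filter.1 hx).1).1 (Finset.mem_filter.1 hx).2
  have h4 := PivotTree.sum_weight_middle_le hT
    (fun S μ => (PivotTree.middleRun a (runOf a) S μ).filter fun p => a μ < a p) 1
    (fun _ _ => Finset.filter_subset _ _) (fun _ _ x hx => (Finset.mem_filter.1 hx).2.ne')
    fun S μ hN x hx => PivotTree.gapOf_eq_of_gt hT hN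
      (Finset.mem_filter.1 (Finset.mem_filter.1 hx).1).1 (Finset.mem_filter.1 hx).2
  rw [Finset.sum_product] at h1 h2
  simp only [List.sum_map_add]
  have h5 := PivotTree.sum_nodes_eq hT
    (fun S μ => ∑ k ∈ K, weight (PivotTree.runFilter a (runOf a) S k (· = a μ)))
    (fun v => ∑ k ∈ K, weight (Finset.univ.filter fun p => a p = v ∧ runOf a p = k).card)
    fun S μ hS hμ => Finset.sum_congr rfl fun k _ => by rw [runFilter_eq hS hμ]
  rw [h5]
  linarith

/-- The excess is at least -2n/3 and the other terms are at least n, so n/3 remains. Then `runSum`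
is at most 4 · excess + 20n, and 4 + 3 · 20 = 64. `searchSum` is at most 24 (n + ∑ log s_i), and n +
∑ log s_i is at most the bound plus 2n/3, hence at most three times the bound. -/
theorem PivotTree.le_synergyBound (hT : T.Valid a (runOf a) Y Finset.univ) :
    (n : ℝ) ≤ 3 * synergyBound a (T.values a) ∧
    T.runSum a (runOf a) Finset.univ ≤ 64 * synergyBound a (T.values a) ∧
    T.searchSum a (runOf a) Finset.univ ≤ 96 * synergyBound a (T.values a) := by
  have h1 := PivotTree.excess_ge hT
  have h2 := PivotTree.pieces_le_excess hT
  have h3 := PivotTree.weightSum_le hT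
  have h4 := PivotTree.runSum_le T _ hT
  have h5 := PivotTree.searchSum_le (a := a) (R := runOf a) T Finset.univ
  have h6 := PivotTree.pieces_le_card T _ hT
  have h7 : 0 ≤ ∑ B ∈ selectionBlocks a (T.values a), lg B.card :=
    Finset.sum_nonneg fun _ _ => lg_nonneg _
  have h8 : 0 ≤ ∑ k ∈ Finset.univ.image (runOf a),
    potential (runPart (runOf a) Finset.univ k).card :=
    Finset.sum_nonneg fun _ _ => potential_nonneg _
  have h9 : ((selectionBlocks a (T.values a)).card : ℝ) ≤ n := by
    exact_mod_cast card_selectionBlocks_le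
  have h10 : (0 : ℝ) ≤ runCount (runOf a) (Finset.univ : Finset (Fin n)) := Nat.cast_nonneg _
  rw [sum_weight_selectionBlocks] at h3
  rw [synergyBound_eq]
  rw [numRuns_eq] at h2
  rw [Finset.card_univ, Fintype.card_fin] at h4 h6
  have hn : (0 : ℝ) ≤ n := Nat.cast_nonneg _
  refine ⟨by linarith, by linarith, by linarith⟩

end LowerBounds

/-! ### Pieces between two neighbouring values that are asked for -/

section ClassSum

variable {ι : Type} [Fintype ι] [DecidableEq ι] {α : Type*} [LinearOrder α]
  (a : ι → α) (R : ι → ℕ) (C : α → Prop) [DecidablePred C]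

/-- The elements of `S` with values in the class `C`. -/
def classPart (S : Finset ι) : Finset ι := S.filter fun p => C (a p)

/-- The number of runs that have at least `2 ^ k` elements in `S` with values in `C`. -/
def longRuns (S : Finset ι) (k : ℕ) : ℕ :=
  ((Finset.univ.image R).filter fun j => 2 ^ k ≤ (runPart R (classPart a C S) j).card).card

/-- The sum of the square roots of the numbers of runs of dyadic lengths. -/
noncomputable def lengthPotential (S : Finset ι) : ℝ :=
  ∑ k ∈ Finset.range (Fintype.card ι + 1), √(longRuns a R C S k)

/-- The sum of the square roots of the numbers of pieces with values in `C`. -/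
noncomputable def PivotTree.classSum (T : PivotTree ι) (S : Finset ι) : ℝ :=
  T.sum a R (fun S => √(runCount R (classPart a C S)))
    (fun S μ => if C (a μ) then √(equalRuns a R S μ) else 0) S

/-- The elements of `S` with values in `C` are the greatest elements of `S`. -/
def UpperIn (S : Finset ι) : Prop := ∀ p ∈ S, ∀ c, C c → c ≤ a p → C (a p)

/-- The elements of `S` with values in `C` are the smallest elements of `S`. -/
def LowerIn (S : Finset ι) : Prop := ∀ p ∈ S, ∀ c, C c → a p ≤ c → C (a p)

variable {a R C} {S : Finset ι} {μ : ι} {Y : Finset α}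

theorem classPart_mono {S S' : Finset ι} (h : S ⊆ S') : classPart a C S ⊆ classPart a C S' :=
  Finset.filter_subset_filter _ h

theorem longRuns_mono {S S' : Finset ι} (h : S ⊆ S') (k : ℕ) :
    longRuns a R C S k ≤ longRuns a R C S' k := by
  refine Finset.card_le_card fun j hj => ?_
  rw [Finset.mem_filter] at hj ⊢
  exact ⟨hj.1, hj.2.trans (Finset.card_le_card (Finset.filter_subset_filter _ (classPart_mono h)))⟩

theorem lengthPotential_nonneg (S : Finset ι) : 0 ≤ lengthPotential a R C S :=
  Finset.sum_nonneg fun _ _ => Real.sqrt_nonneg _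

theorem lengthPotential_mono {S S' : Finset ι} (h : S ⊆ S') :
    lengthPotential a R C S ≤ lengthPotential a R C S' :=
  Finset.sum_le_sum fun k _ => Real.sqrt_le_sqrt (by exact_mod_cast longRuns_mono h k)

theorem longRuns_le_runCount (S : Finset ι) (k : ℕ) : longRuns a R C S k ≤ runCount R S := by
  refine Finset.card_le_card fun j hj => ?_
  rw [Finset.mem_filter] at hj
  have : 0 < (runPart R (classPart a C S) j).card := lt_of_lt_of_le (by positivity) hj.2
  obtain ⟨p, hp⟩ := Finset.card_pos.1 this
  simp only [runPart, classPart, Finset.mem_filter] at hp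
  exact Finset.mem_image.2 ⟨p, hp.1.1, hp.2⟩

theorem longRuns_mul_le (S : Finset ι) (k : ℕ) :
    longRuns a R C S k * 2 ^ k ≤ (classPart a C S).card := by
  have h1 := Finset.card_eq_sum_card_fiberwise (f := R) (s := classPart a C S)
    (t := Finset.univ.image R) fun p _ => Finset.mem_coe.2 (Finset.mem_image_of_mem _ (Finset.mem_univ _))
  rw [h1, longRuns, ← smul_eq_mul, ← Finset.sum_const]
  calc _ ≤ ∑ j ∈ (Finset.univ.image R).filter
        fun j => 2 ^ k ≤ (runPart R (classPart a C S) j).card, (runPart R (classPart a C S) j).card :=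
        Finset.sum_le_sum fun j hj => (Finset.mem_filter.1 hj).2
    _ ≤ _ := Finset.sum_le_sum_of_subset (Finset.filter_subset _ _)

/-- At most V / 2 ^ k runs have 2 ^ k of the V elements. The rational ratio 3/4 may replace 1/√2
since 2 · (3/4) ^ 2 ≥ 1, and the geometric series has the sum 4. -/
theorem lengthPotential_le (S : Finset ι) :
    lengthPotential a R C S ≤ 4 * √(classPart a C S).card := by
  have h1 : ∀ k, √(longRuns a R C S k) ≤ √(classPart a C S).card * (3 / 4 : ℝ) ^ k := by
    intro k
    have h2 : (longRuns a R C S k : ℝ) * 2 ^ k ≤ (classPart a C S).card := by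
      exact_mod_cast longRuns_mul_le S k
    have h3 : (longRuns a R C S k : ℝ) ≤ (classPart a C S).card * ((3 / 4 : ℝ) ^ k) ^ 2 := by
      have h4 : (1 : ℝ) ≤ 2 ^ k * ((3 / 4 : ℝ) ^ k) ^ 2 := by
        rw [← pow_mul, mul_comm k 2, pow_mul, ← mul_pow]
        exact one_le_pow₀ (by norm_num)
      have h5 : (0 : ℝ) ≤ ((3 / 4 : ℝ) ^ k) ^ 2 := by positivity
      have h6 : (0 : ℝ) ≤ longRuns a R C S k := Nat.cast_nonneg _
      nlinarith [mul_le_mul_of_nonneg_right h2 h5, mul_le_mul_of_nonneg_left h4 h6]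
    calc √(longRuns a R C S k) ≤ √((classPart a C S).card * ((3 / 4 : ℝ) ^ k) ^ 2) :=
          Real.sqrt_le_sqrt h3
      _ = _ := by rw [Real.sqrt_mul (Nat.cast_nonneg _), Real.sqrt_sq (by positivity)]
  refine (Finset.sum_le_sum fun k _ => h1 k).trans ?_
  rw [← Finset.mul_sum, mul_comm]
  refine mul_le_mul_of_nonneg_right ?_ (Real.sqrt_nonneg _)
  rw [geom_sum_eq (by norm_num)]
  have : (0 : ℝ) ≤ (3 / 4 : ℝ) ^ (Fintype.card ι + 1) := by positivity
  rw [div_le_iff_of_neg (by norm_num)]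
  linarith

theorem sqrt_sub_ge {x y m : ℕ} (hy : y ≤ x) (hx : x ≤ m) :
    (x : ℝ) - y ≤ 2 * √m * (√x - √y) := by
  have h1 : √(y : ℝ) ≤ √x := Real.sqrt_le_sqrt (by exact_mod_cast hy)
  have h2 : √(x : ℝ) ≤ √m := Real.sqrt_le_sqrt (by exact_mod_cast hx)
  have h3 := Real.sq_sqrt (Nat.cast_nonneg (α := ℝ) x)
  have h4 := Real.sq_sqrt (Nat.cast_nonneg (α := ℝ) y)
  nlinarith

/-- When the pivot is in the class, half of the runs lose half of their elements in the class, so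
that the potential decreases significantly. -/
theorem lengthPotential_drop (hS : UpperIn a C S) (hμ : μ ∈ S) (hC : C (a μ))
    (h : runCount R S ≤ 2 * ((S.image R).filter fun k =>
      (runPart R S k).card ≤ 2 * ((runPart R S k).filter fun p => a μ ≤ a p).card).card) :
    √(runCount R S) ≤ 4 * (lengthPotential a R C S - lengthPotential a R C (lowSide a R S μ)) := by
  set L := lowSide a R S μ with hL
  set m := runCount R S with hm
  set H := (S.image R).filter fun k =>
      (runPart R S k).card ≤ 2 * ((runPart R S k).filter fun p => a μ ≤ a p).card with hH
  set N := Fintype.card ι + 1 with hN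
  have hsub : L ⊆ S := lowSide_subset
  -- In a run of `H` at least half of the elements are at or above the pivot. All of these belong to
  -- the class and are missing in `L`, so the class part of the run at least halves and drops below
  -- some power of two.
  have key : ∀ j ∈ H, ∃ k ∈ Finset.range N, 2 ^ k ≤ (runPart R (classPart a C S) j).card ∧
      ¬ 2 ^ k ≤ (runPart R (classPart a C L) j).card := by
    intro j hj
    obtain ⟨hj1, hj2⟩ := Finset.mem_filter.1 hj
    obtain ⟨q, hq, rfl⟩ := Finset.mem_image.1 hj1
    have hpos : 0 < (runPart R S (R q)).card := Finset.card_pos.2 ⟨q, by simp [runPart, hq]⟩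
    have h1 : (runPart R (classPart a C L) (R q)).card ≤
        ((runPart R S (R q)).filter fun p => ¬ a μ ≤ a p).card := by
      refine Finset.card_le_card fun p hp => ?_
      simp only [runPart, classPart, Finset.mem_filter] at hp ⊢
      exact ⟨⟨hsub hp.1.1, hp.2⟩, (lowSide_lt hp.1.1).not_ge⟩
    have h2 : (runPart R (classPart a C L) (R q)).card +
        ((runPart R S (R q)).filter fun p => a μ ≤ a p).card ≤
          (runPart R (classPart a C S) (R q)).card := by
      rw [← Finset.card_union_of_disjoint]
      · refine Finset.card_le_card (Finset.union_subset ?_ ?_)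
        · exact Finset.filter_subset_filter _ (classPart_mono hsub)
        · intro p hp
          simp only [runPart, classPart, Finset.mem_filter] at hp ⊢
          exact ⟨⟨hp.1.1, hS p hp.1.1 _ hC hp.2⟩, hp.1.2⟩
      · refine Finset.disjoint_left.2 fun p hp hp' => ?_
        simp only [runPart, classPart, Finset.mem_filter] at hp hp'
        exact (lowSide_lt hp.1.1).not_ge hp'.2
    have h3 := Finset.card_filter_add_card_filter_not (s := runPart R S (R q)) fun p => a μ ≤ a p
    have h4 : (runPart R (classPart a C S) (R q)).card ≤ Fintype.card ι := Finset.card_le_univ _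
    rcases Nat.eq_zero_or_pos (runPart R (classPart a C L) (R q)).card with h0 | h0
    -- If nothing of the class remains in the run, the level of length one is lost.
    · exact ⟨0, by simp [hN], by simp only [pow_zero]; omega, by rw [h0]; simp⟩
    · have h5 := Nat.lt_pow_succ_log_self (b := 2) (by norm_num)
        (runPart R (classPart a C L) (R q)).card
      have h6 := Nat.pow_log_le_self 2 h0.ne'
      -- The lost level is the smallest power of two above the remaining length.
      have h7 : 2 ^ (Nat.log 2 (runPart R (classPart a C L) (R q)).card + 1) ≤
          (runPart R (classPart a C S) (R q)).card := by
        rw [pow_succ]; omega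
      refine ⟨_, ?_, h7, by omega⟩
      have := Nat.lt_two_pow_self (n := Nat.log 2 (runPart R (classPart a C L) (R q)).card + 1)
      rw [Finset.mem_range]
      omega
  -- Counting pairs of runs and lost levels in both ways: each run of `H` loses at least one level.
  have hcount : H.card + ∑ k ∈ Finset.range N, longRuns a R C L k ≤
      ∑ k ∈ Finset.range N, longRuns a R C S k := by
    have e1 : ∀ k, longRuns a R C S k = longRuns a R C L k +
        ((Finset.univ.image R).filter fun j => 2 ^ k ≤ (runPart R (classPart a C S) j).card ∧
          ¬ 2 ^ k ≤ (runPart R (classPart a C L) j).card).card := by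
      intro k
      unfold longRuns
      rw [← Finset.card_union_of_disjoint]
      · congr 1
        ext j
        simp only [Finset.mem_filter, Finset.mem_union]
        have : 2 ^ k ≤ (runPart R (classPart a C L) j).card →
            2 ^ k ≤ (runPart R (classPart a C S) j).card := fun h =>
          h.trans (Finset.card_le_card (Finset.filter_subset_filter _ (classPart_mono hsub)))
        tauto
      · refine Finset.disjoint_left.2 fun j hj hj' => ?_
        rw [Finset.mem_filter] at hj hj'
        exact hj'.2.2 hj.2
    simp only [e1, Finset.sum_add_distrib]
    rw [add_comm]
    refine Nat.add_le_add_left ?_ _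
    have e2 := Finset.sum_card_bipartiteAbove_eq_sum_card_bipartiteBelow
      (s := Finset.range N) (t := Finset.univ.image R)
      (fun k j => 2 ^ k ≤ (runPart R (classPart a C S) j).card ∧
          ¬ 2 ^ k ≤ (runPart R (classPart a C L) j).card)
    unfold Finset.bipartiteAbove Finset.bipartiteBelow at e2
    rw [e2, Finset.card_eq_sum_ones]
    have hHK : H ⊆ Finset.univ.image R := (Finset.filter_subset _ _).trans
      (Finset.image_subset_image (Finset.subset_univ _))
    refine le_trans (Finset.sum_le_sum fun j hj => ?_) (Finset.sum_le_sum_of_subset hHK)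
    obtain ⟨k, hk, h1⟩ := key j hj
    exact Finset.card_pos.2 ⟨k, Finset.mem_filter.2 ⟨hk, h1⟩⟩
  have hm0 : 0 < m := Finset.card_pos.2 ⟨R μ, Finset.mem_image_of_mem _ hμ⟩
  have hsq : (0 : ℝ) < √m := Real.sqrt_pos.2 (by exact_mod_cast hm0)
  -- All the counts are at most m, so a drop of the counts is at most 2 √m times the drop of their
  -- square roots. With m ≤ 2 |H| one factor √m cancels below.
  have hsum : (H.card : ℝ) ≤ 2 * √m * (lengthPotential a R C S - lengthPotential a R C L) := by
    have h1 : ∑ k ∈ Finset.range N, ((longRuns a R C S k : ℝ) - longRuns a R C L k) ≤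
        ∑ k ∈ Finset.range N, 2 * √m * (√(longRuns a R C S k) - √(longRuns a R C L k)) :=
      Finset.sum_le_sum fun k _ => sqrt_sub_ge (longRuns_mono hsub k) (longRuns_le_runCount S k)
    rw [← Finset.mul_sum, Finset.sum_sub_distrib, Finset.sum_sub_distrib] at h1
    have h2 : (H.card : ℝ) + ∑ k ∈ Finset.range N, (longRuns a R C L k : ℝ) ≤
      ∑ k ∈ Finset.range N, (longRuns a R C S k : ℝ) := by exact_mod_cast hcount
    unfold lengthPotential
    linarith
  have hmH : (m : ℝ) ≤ 2 * H.card := by exact_mod_cast h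
  have h3 := Real.mul_self_sqrt (Nat.cast_nonneg (α := ℝ) m)
  have h4 : √(m : ℝ) * √m ≤ √m *
      (4 * (lengthPotential a R C S - lengthPotential a R C L)) := by nlinarith
  exact le_of_mul_le_mul_left h4 hsq

namespace PivotTree

theorem classSum_eq_zero (T : PivotTree ι) : ∀ S, T.Valid a R Y S →
    classPart a C S = ∅ → T.classSum a R C S = 0 := by
  induction T with
  | leaf => intro S _ h; simp [classSum, sum, h, runCount]
  | node μ l r ihl ihr =>
    intro S ⟨_, hμ, _, _, hl, hr⟩ h
    have h1 := ihl _ hl (Finset.subset_empty.1 (h ▸ classPart_mono lowSide_subset))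
    have h2 := ihr _ hr (Finset.subset_empty.1 (h ▸ classPart_mono highSide_subset))
    have h3 : ¬ C (a μ) := by
      intro hC
      have : μ ∈ classPart a C S := Finset.mem_filter.2 ⟨hμ, hC⟩
      simp [h] at this
    unfold classSum at *
    simp [sum, h1, h2, h3]

theorem sqrt_classPart_mono {S S' : Finset ι} (h : S ⊆ S') :
    √((classPart a C S).card : ℝ) ≤ √(classPart a C S').card :=
  Real.sqrt_le_sqrt (by exact_mod_cast Finset.card_le_card (classPart_mono h))

/-- If the pivot is in the class, everything above it is in the class and not asked for, so the
right child is a leaf. The two terms √m of pivot and leaf are paid by `lengthPotential_drop`, which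
gives 2 · 4 = 8. If the pivot is not in the class, the class lies entirely in the right child or the
middle. -/
theorem classSum_le_of_upperIn (hC : ∀ x, C x → x ∉ Y) (T : PivotTree ι) : ∀ S, T.Valid a R Y S →
    UpperIn a C S → T.classSum a R C S ≤ 8 * lengthPotential a R C S + √(classPart a C S).card := by
  induction T with
  | leaf =>
    intro S _ _
    have h1 := lengthPotential_nonneg (a := a) (R := R) (C := C) S
    have h2 : √(runCount R (classPart a C S) : ℝ) ≤ √(classPart a C S).card :=
      Real.sqrt_le_sqrt (by exact_mod_cast runCount_le_card _)
    simp only [classSum, sum]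
    linarith
  | node μ l r ihl ihr =>
    intro S ⟨_, hμ, _, hhigh, hl, hr⟩ hS
    have hSl : UpperIn a C (lowSide a R S μ) := fun p hp => hS p (lowSide_subset hp)
    have hSr : UpperIn a C (highSide a R S μ) := fun p hp => hS p (highSide_subset hp)
    by_cases hCμ : C (a μ)
    · have h1 := ihl _ hl hSl
      have h2 := lengthPotential_drop hS hμ hCμ hhigh
      -- A node requires a queried value in its sub-instance, but the values above this pivot are
      -- all in the class.
      have hleaf : r = leaf := by
        cases r with
        | leaf => rfl
        | node ν l' r' =>
          obtain ⟨⟨p, hp, hpY⟩, _⟩ := hr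
          exact absurd hpY (hC _ (hSr p hp _ hCμ (lt_highSide hp).le))
      subst hleaf
      have h3 : √(equalRuns a R S μ : ℝ) ≤ √(runCount R S) :=
        Real.sqrt_le_sqrt (by exact_mod_cast equalRuns_le)
      have h4 : √(runCount R (classPart a C (highSide a R S μ)) : ℝ) ≤ √(runCount R S) :=
        Real.sqrt_le_sqrt (by
          exact_mod_cast runCount_mono ((Finset.filter_subset _ _).trans highSide_subset))
      have h5 := sqrt_classPart_mono (a := a) (C := C)
        (lowSide_subset (a := a) (R := R) (S := S) (μ := μ))
      unfold classSum at *
      simp only [sum, hCμ, if_true]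
      linarith
    · have h1 : classPart a C (lowSide a R S μ) = ∅ := by
        rw [classPart, Finset.filter_eq_empty_iff]
        intro p hp hCp
        exact hCμ (hS μ hμ _ hCp (lowSide_lt hp).le)
      have h2 := classSum_eq_zero l _ hl h1
      have h3 := ihr _ hr hSr
      have h4 := lengthPotential_mono (a := a) (R := R) (C := C)
        (highSide_subset (a := a) (R := R) (S := S) (μ := μ))
      have h5 := sqrt_classPart_mono (a := a) (C := C)
        (highSide_subset (a := a) (R := R) (S := S) (μ := μ))
      unfold classSum at *
      simp only [sum, hCμ, if_false, h2]
      linarith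

/-- The constant is 8 · 4 + 1. -/
theorem classSum_le_sqrt_of_upperIn (hC : ∀ x, C x → x ∉ Y) (T : PivotTree ι) (S : Finset ι)
    (hT : T.Valid a R Y S) (hS : UpperIn a C S) :
    T.classSum a R C S ≤ 33 * √(classPart a C S).card := by
  have h1 := classSum_le_of_upperIn hC T S hT hS
  have h2 := lengthPotential_le (a := a) (R := R) (C := C) S
  linarith

/-- The tree of the recursion for the reversed order. -/
def mirror : PivotTree ι → PivotTree ι
  | leaf => leaf
  | node μ l r => node μ r.mirror l.mirror

theorem lowSide_toDual (S : Finset ι) (μ : ι) :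
    lowSide (fun p => OrderDual.toDual (a p)) R S μ = highSide a R S μ := by
  ext p
  simp only [mem_lowSide, mem_highSide, OrderDual.toDual_lt_toDual, OrderDual.toDual_le_toDual]

theorem highSide_toDual (S : Finset ι) (μ : ι) :
    highSide (fun p => OrderDual.toDual (a p)) R S μ = lowSide a R S μ := by
  ext p
  simp only [mem_lowSide, mem_highSide, OrderDual.toDual_lt_toDual, OrderDual.toDual_le_toDual]

theorem valid_mirror (T : PivotTree ι) : ∀ S, T.Valid a R Y S →
    T.mirror.Valid (fun p => OrderDual.toDual (a p)) R (Y.map OrderDual.toDual.toEmbedding) S := by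
  induction T with
  | leaf => intro S h p hp; simpa using h p hp
  | node μ l r ihl ihr =>
    intro S ⟨hY, hμ, h1, h2, hl, hr⟩
    refine ⟨by simpa using hY, hμ, h2, h1, ?_, ?_⟩
    · rw [lowSide_toDual]; exact ihr _ hr
    · rw [highSide_toDual]; exact ihl _ hl

theorem classSum_mirror (T : PivotTree ι) : ∀ S,
    T.mirror.classSum (fun p => OrderDual.toDual (a p)) R (fun x => C (OrderDual.ofDual x)) S =
      T.classSum a R C S := by
  induction T with
  | leaf => intro S; rfl
  | node μ l r ihl ihr =>
    intro S
    have h1 := ihl (lowSide a R S μ)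
    have h2 := ihr (highSide a R S μ)
    have h3 : (node μ l r).mirror.classSum (fun p => OrderDual.toDual (a p)) R
        (fun x => C (OrderDual.ofDual x)) S = (if C (a μ) then √(equalRuns a R S μ : ℝ) else 0) +
        r.mirror.classSum (fun p => OrderDual.toDual (a p)) R (fun x => C (OrderDual.ofDual x))
          (lowSide (fun p => OrderDual.toDual (a p)) R S μ) +
        l.mirror.classSum (fun p => OrderDual.toDual (a p)) R (fun x => C (OrderDual.ofDual x))
          (highSide (fun p => OrderDual.toDual (a p)) R S μ) := rfl
    have h4 : (node μ l r).classSum a R C S = (if C (a μ) then √(equalRuns a R S μ : ℝ) else 0) +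
        l.classSum a R C (lowSide a R S μ) + r.classSum a R C (highSide a R S μ) := rfl
    rw [h3, h4, lowSide_toDual, highSide_toDual, h1, h2]
    ring

theorem classSum_le_sqrt_of_lowerIn (hC : ∀ x, C x → x ∉ Y) (T : PivotTree ι) (S : Finset ι)
    (hT : T.Valid a R Y S) (hS : LowerIn a C S) :
    T.classSum a R C S ≤ 33 * √(classPart a C S).card := by
  rw [← classSum_mirror]
  refine classSum_le_sqrt_of_upperIn (a := fun p => OrderDual.toDual (a p))
    (C := fun x => C (OrderDual.ofDual x)) ?_ _ S (valid_mirror T S hT) ?_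
  · intro x hx
    simpa using hC _ hx
  · intro p hp c hc hcp
    exact hS p hp (OrderDual.ofDual c) hc hcp

/-- The sum of the square roots of the numbers of pieces in a class is of the order of the square
root of the size of the class. -/
theorem classSum_le (hC : ∀ x, C x → x ∉ Y) (hconv : ∀ x y z, C x → C z → x ≤ y → y ≤ z → C y)
    (T : PivotTree ι) : ∀ S, T.Valid a R Y S →
      T.classSum a R C S ≤ 67 * √(classPart a C S).card := by
  induction T with
  | leaf =>
    intro S _
    have h2 : √(runCount R (classPart a C S) : ℝ) ≤ √(classPart a C S).card :=
      Real.sqrt_le_sqrt (by exact_mod_cast runCount_le_card _)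
    have := Real.sqrt_nonneg ((classPart a C S).card : ℝ)
    simp only [classSum, sum]
    linarith
  | node μ l r ihl ihr =>
    intro S ⟨_, hμ, _, _, hl, hr⟩
    have h3 := sqrt_classPart_mono (a := a) (C := C)
      (lowSide_subset (a := a) (R := R) (S := S) (μ := μ))
    have h4 := sqrt_classPart_mono (a := a) (C := C)
      (highSide_subset (a := a) (R := R) (S := S) (μ := μ))
    by_cases hCμ : C (a μ)
    -- The first pivot in the class leaves it at the upper end of the left child and at the lower
    -- end of the right one: 33 + 33, plus 1 for the pivot itself.
    · have h1 := classSum_le_sqrt_of_upperIn hC l _ hl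
        fun p hp c hc hcp => hconv c (a p) (a μ) hc hCμ hcp (lowSide_lt hp).le
      have h2 := classSum_le_sqrt_of_lowerIn hC r _ hr
        fun p hp c hc hcp => hconv (a μ) (a p) c hCμ hc (lt_highSide hp).le hcp
      have h5 : √(equalRuns a R S μ : ℝ) ≤ √(classPart a C S).card := by
        refine Real.sqrt_le_sqrt ?_
        have : equalRuns a R S μ ≤ (classPart a C S).card := by
          refine (runCount_le_card _).trans (Finset.card_le_card fun p hp => ?_)
          rw [Finset.mem_filter] at hp
          exact Finset.mem_filter.2 ⟨hp.1, hp.2 ▸ hCμ⟩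
        exact_mod_cast this
      unfold classSum at *
      simp only [sum, hCμ, if_true]
      linarith
    · have h1 := ihl _ hl
      have h2 := ihr _ hr
      -- By convexity a pivot outside the class cannot have class elements on both sides.
      rcases (classPart a C (lowSide a R S μ)).eq_empty_or_nonempty with h | ⟨p, hp⟩
      · have h5 := classSum_eq_zero l _ hl h
        unfold classSum at *
        simp only [sum, hCμ, if_false, h5]
        linarith
      · have h : classPart a C (highSide a R S μ) = ∅ := by
          rw [classPart, Finset.filter_eq_empty_iff]
          intro q hq hCq
          obtain ⟨hp, hCp⟩ := Finset.mem_filter.1 hp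
          exact hCμ (hconv _ _ _ hCp hCq (lowSide_lt hp).le (lt_highSide hq).le)
        have h5 := classSum_eq_zero r _ hr h
        unfold classSum at *
        simp only [sum, hCμ, if_false, h5]
        linarith

/-! ### The entropy of the pieces in a class -/

/-- `x * log (N / x)`. -/
noncomputable def _root_.QSMS.relEntropy (N x : ℕ) : ℝ := x * lg N - xlg x

@[simp] theorem _root_.QSMS.relEntropy_zero (N : ℕ) : relEntropy N 0 = 0 := by simp [relEntropy]

theorem _root_.QSMS.relEntropy_nonneg {N x : ℕ} (h : x ≤ N) : 0 ≤ relEntropy N x := by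
  have := mul_le_mul_of_nonneg_left (lg_mono h) (Nat.cast_nonneg (α := ℝ) x)
  unfold relEntropy xlg
  linarith

/-- Write lg (N / x) = lg (N / V) + lg (V / x) and use lg (V / x) = 2 lg √(V / x) ≤ 2 √(V / x). -/
theorem _root_.QSMS.relEntropy_le_sqrt (N : ℕ) {x V : ℕ} (h : x ≤ V) :
    relEntropy N x ≤ x * (lg N - lg V) + 2 * √V * √x := by
  rcases Nat.eq_zero_or_pos x with rfl | hx
  · simp
  have hx' : (0 : ℝ) < x := by exact_mod_cast hx
  have hV' : (0 : ℝ) < V := by exact_mod_cast (hx.trans_le h)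
  have sx := Real.sqrt_pos.2 hx'
  have sV := Real.sqrt_pos.2 hV'
  have h1 := logb_two_le (div_pos sV sx)
  rw [Real.logb_div sV.ne' sx.ne'] at h1
  have h2 : ∀ y : ℝ, 0 < y → Real.logb 2 y = 2 * Real.logb 2 √y := by
    intro y hy
    have := Real.logb_pow 2 (√y) 2
    rw [Real.sq_sqrt hy.le] at this
    exact_mod_cast this
  have h3 : lg V - lg x ≤ 2 * (√V / √x) := by
    unfold lg
    rw [h2 _ hV', h2 _ hx']
    linarith
  have h4 := mul_le_mul_of_nonneg_left h3 hx'.le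
  have h5 : (x : ℝ) * (2 * (√V / √x)) = 2 * √V * √x := by
    have : (x : ℝ) = √x * √x := (Real.mul_self_sqrt hx'.le).symm
    nth_rewrite 1 [this]
    field_simp
  unfold relEntropy xlg
  linarith

variable (a R C) in
/-- The entropy of the pieces with values in the class `C`. -/
noncomputable def classEntropy (N : ℕ) (T : PivotTree ι) (S : Finset ι) : ℝ :=
  T.sum a R (fun S => relEntropy N (runCount R (classPart a C S)))
    (fun S μ => if C (a μ) then relEntropy N (equalRuns a R S μ) else 0) S

variable (a R C) in
/-- The number of pieces with values in the class `C`. -/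
noncomputable def classPieces (T : PivotTree ι) (S : Finset ι) : ℝ :=
  T.sum a R (fun S => runCount R (classPart a C S))
    (fun S μ => if C (a μ) then equalRuns a R S μ else 0) S

theorem card_classPart_sides (S : Finset ι) (μ : ι) :
    (classPart a C (lowSide a R S μ)).card + (classPart a C (highSide a R S μ)).card +
      ((classPart a C S).filter fun p => a p = a μ).card ≤ (classPart a C S).card := by
  rw [← Finset.card_union_of_disjoint, ← Finset.card_union_of_disjoint]
  · exact Finset.card_le_card (Finset.union_subset (Finset.union_subset
      (classPart_mono lowSide_subset) (classPart_mono highSide_subset)) (Finset.filter_subset _ _))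
  · refine Finset.disjoint_left.2 fun p hp hq => ?_
    have hq := (Finset.mem_filter.1 hq).2
    rcases Finset.mem_union.1 hp with h | h
    · exact (lowSide_lt (Finset.mem_filter.1 h).1).ne hq
    · exact (lt_highSide (Finset.mem_filter.1 h).1).ne' hq
  · exact Finset.disjoint_left.2 fun p hp hq =>
      (lowSide_lt (Finset.mem_filter.1 hp).1).not_gt (lt_highSide (Finset.mem_filter.1 hq).1)

theorem equalRuns_le_class (hCμ : C (a μ)) :
    equalRuns a R S μ ≤ ((classPart a C S).filter fun p => a p = a μ).card := by
  refine (runCount_le_card _).trans (Finset.card_le_card fun p hp => ?_)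
  rw [Finset.mem_filter] at hp
  exact Finset.mem_filter.2 ⟨Finset.mem_filter.2 ⟨hp.1, hp.2 ▸ hCμ⟩, hp.2⟩

theorem classPieces_le (T : PivotTree ι) : ∀ S,
    T.classPieces a R C S ≤ (classPart a C S).card := by
  induction T with
  | leaf => intro S; exact Nat.cast_le.2 (runCount_le_card _)
  | node μ l r ihl ihr =>
    intro S
    have h1 := ihl (lowSide a R S μ)
    have h2 := ihr (highSide a R S μ)
    have h3 : ((classPart a C (lowSide a R S μ)).card : ℝ) +
      (classPart a C (highSide a R S μ)).card +
      ((classPart a C S).filter fun p => a p = a μ).card ≤ (classPart a C S).card := by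
      exact_mod_cast card_classPart_sides S μ
    have h4 : (if C (a μ) then (equalRuns a R S μ : ℝ) else 0) ≤
        ((classPart a C S).filter fun p => a p = a μ).card := by
      split
      · next h => exact_mod_cast equalRuns_le_class h
      · exact Nat.cast_nonneg _
    unfold classPieces at *
    simp only [sum]
    linarith

/-- The bound `V` stays fixed in the induction, so `relEntropy_le_sqrt` is just added up over the
pieces. -/
theorem classEntropy_le_of_card_le (N : ℕ) {V : ℕ} (T : PivotTree ι) : ∀ S,
    (classPart a C S).card ≤ V → T.classEntropy a R C N S ≤
      (lg N - lg V) * T.classPieces a R C S + 2 * √V * T.classSum a R C S := by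
  induction T with
  | leaf =>
    intro S h
    have := relEntropy_le_sqrt N ((runCount_le_card (R := R) _).trans h)
    simp only [classEntropy, classPieces, classSum, sum]
    linarith
  | node μ l r ihl ihr =>
    intro S h
    have h1 := ihl (lowSide a R S μ) ((Finset.card_le_card (classPart_mono lowSide_subset)).trans h)
    have h2 := ihr (highSide a R S μ)
      ((Finset.card_le_card (classPart_mono highSide_subset)).trans h)
    have h3 : (if C (a μ) then relEntropy N (equalRuns a R S μ) else 0) ≤
        (lg N - lg V) * (if C (a μ) then (equalRuns a R S μ : ℝ) else 0) +
        2 * √V * (if C (a μ) then √(equalRuns a R S μ : ℝ) else 0) := by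
      split
      · next hC =>
        have := relEntropy_le_sqrt N (((equalRuns_le_class (R := R) hC).trans
          (Finset.card_le_card (Finset.filter_subset _ _))).trans h)
        linarith
      · simp
    unfold classEntropy classPieces classSum at *
    simp only [sum]
    linarith

/-- There are at most V pieces, which turns the first term into V lg (N / V); the second one is 2 √V
· 67 √V = 134 V. -/
theorem classEntropy_le (hC : ∀ x, C x → x ∉ Y)
    (hconv : ∀ x y z, C x → C z → x ≤ y → y ≤ z → C y) (N : ℕ) (T : PivotTree ι) (S : Finset ι)
    (hT : T.Valid a R Y S) (hN : S.card ≤ N) : T.classEntropy a R C N S ≤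
      relEntropy N (classPart a C S).card + 134 * (classPart a C S).card := by
  set V := (classPart a C S).card with hV
  have hVN : V ≤ N := (Finset.card_le_card (Finset.filter_subset _ _)).trans hN
  have h1 := classEntropy_le_of_card_le (a := a) (R := R) (C := C) N T S le_rfl
  have h2 := classPieces_le (a := a) (R := R) (C := C) T S
  have h3 := classSum_le hC hconv T S hT
  rw [← hV] at h1 h2 h3
  have h4 := mul_le_mul_of_nonneg_left h2 (sub_nonneg.2 (lg_mono hVN))
  have h5 := mul_le_mul_of_nonneg_left h3 (show (0 : ℝ) ≤ 2 * √V by positivity)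
  have h6 := Real.mul_self_sqrt (Nat.cast_nonneg (α := ℝ) V)
  have h7 : 2 * √(V : ℝ) * (67 * √V) = 134 * V := by
    rw [← h6]; simp only [h6]; linarith
  unfold relEntropy xlg
  linarith

end PivotTree

end ClassSum

/-! ### The entropy of all pieces -/

theorem relEntropy_eq (N x : ℕ) : relEntropy N x = x * (lg N - lg x) := by
  unfold relEntropy xlg; ring

/-- The function x log (N / x) is not monotone, but the defect m log (e / m) is at most e. -/
theorem relEntropy_le_add {N m e : ℕ} (h : m ≤ e) (he : e ≤ N) :
    relEntropy N m ≤ relEntropy N e + e := by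
  rcases Nat.eq_zero_or_pos m with rfl | hm
  · have := relEntropy_nonneg he
    have : (0 : ℝ) ≤ e := Nat.cast_nonneg _
    rw [relEntropy_zero]
    linarith
  have hm' : (0 : ℝ) < m := by exact_mod_cast hm
  have he' : (0 : ℝ) < e := by exact_mod_cast hm.trans_le h
  have h1 := logb_two_le (div_pos he' hm')
  rw [Real.logb_div he'.ne' hm'.ne'] at h1
  have h2 : (m : ℝ) * (lg e - lg m) ≤ e := by
    calc (m : ℝ) * (lg e - lg m) ≤ m * (e / m) := mul_le_mul_of_nonneg_left h1 hm'.le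
      _ = e := by field_simp
  have h3 := mul_nonneg (sub_nonneg.2 (Nat.cast_le (α := ℝ).2 h)) (sub_nonneg.2 (lg_mono he))
  rw [relEntropy_eq, relEntropy_eq]
  linarith

theorem xlg_mono {x y : ℕ} (h : x ≤ y) : xlg x ≤ xlg y :=
  mul_le_mul (by exact_mod_cast h) (lg_mono h) (lg_nonneg _) (Nat.cast_nonneg _)

/-! ### Decomposition of the entropy by the queried values -/

section Gaps

variable {ι : Type} [Fintype ι] [DecidableEq ι] {α : Type*} [LinearOrder α]
  {a : ι → α} {R : ι → ℕ} {Y : Finset α}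

/-- The entropy of the pieces is the sum over the gaps between the values that are asked for, and
over the pivots of these values. -/
theorem PivotTree.sum_relEntropy_eq (hY : ∀ y ∈ Y, ∃ p, a p = y) (N : ℕ) (T : PivotTree ι) :
    ∀ S, Full a S → T.Valid a R Y S →
      T.sum a R (fun S => relEntropy N (runCount R S)) (fun S μ => relEntropy N (equalRuns a R S μ))
        S = ∑ i ∈ Finset.range (Y.card + 1), T.classEntropy a R (fun x => x ∉ Y ∧ gapOf Y x = i) N S
          + T.sum a R (fun _ => 0)
            (fun S μ => if a μ ∈ Y then relEntropy N (equalRuns a R S μ) else 0) S := by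
  have hmem : ∀ x, gapOf Y x ∈ Finset.range (Y.card + 1) := fun x =>
    Finset.mem_range.2 (Nat.lt_succ_of_le (gapOf_le_card _ _))
  induction T with
  | leaf =>
    intro S hS hT
    simp only [PivotTree.sum, PivotTree.classEntropy, add_zero]
    rcases S.eq_empty_or_nonempty with rfl | ⟨x, hx⟩
    · simp [runCount, classPart]
    -- A queried value between two elements of the leaf would be attained inside it, because `S` is
    -- full, and the leaf would not be a leaf.
    have hc : ∀ p ∈ S, gapOf Y (a p) = gapOf Y (a x) := by
      intro p hp
      unfold gapOf
      congr 1
      refine Finset.filter_congr fun v hv => ?_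
      obtain ⟨t, rfl⟩ := hY v hv
      constructor
      · intro h
        by_contra h'
        exact hT t (hS x hx p hp t (not_lt.1 h') h.le) hv
      · intro h
        by_contra h'
        exact hT t (hS p hp x hx t (not_lt.1 h') h.le) hv
    rw [Finset.sum_eq_single_of_mem _ (hmem (a x))]
    · congr 2
      exact (Finset.filter_true_of_mem fun p hp => ⟨hT p hp, hc p hp⟩).symm
    · intro i _ hi
      have : classPart a (fun x => x ∉ Y ∧ gapOf Y x = i) S = ∅ :=
        Finset.filter_false_of_mem fun p hp h => hi (h.2.symm.trans (hc p hp))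
      rw [this]
      simp [runCount]
  | node μ l r ihl ihr =>
    intro S hS ⟨_, _, _, _, hl, hr⟩
    have h1 := ihl _ hS.lowSide hl
    have h2 := ihr _ hS.highSide hr
    have h3 : relEntropy N (equalRuns a R S μ) = ∑ i ∈ Finset.range (Y.card + 1),
        (if a μ ∉ Y ∧ gapOf Y (a μ) = i then relEntropy N (equalRuns a R S μ) else 0) +
        (if a μ ∈ Y then relEntropy N (equalRuns a R S μ) else 0) := by
      by_cases h : a μ ∈ Y
      · simp [h]
      · rw [Finset.sum_eq_single_of_mem _ (hmem (a μ))]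
        · simp [h]
        · intro i _ hi
          simp [Ne.symm hi]
    unfold PivotTree.classEntropy at *
    simp only [PivotTree.sum, Finset.sum_add_distrib]
    rw [h1, h2]
    nth_rewrite 1 [h3]
    ring

end Gaps

/-! ### Entropy of the partition into queried values and the gaps between them -/

section Labels

variable {α : Type*} [LinearOrder α] {n : ℕ} {a : Fin n → α} {Y : Finset α}
  {T : PivotTree (Fin n)}

/-- The position of the value `x` among the values in `Y`: twice the number of smaller values,
plus one if `x` is one of the values itself. -/
def label (Y : Finset α) (x : α) : ℕ := 2 * gapOf Y x + if x ∈ Y then 1 else 0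

/-- The number of elements with the label of `p`. -/
def labelCount (a : Fin n → α) (Y : Finset α) (p : Fin n) : ℕ :=
  (Finset.univ.filter fun t => label Y (a t) = label Y (a p)).card

/-- A class of x elements gives each of its elements the share log (N / x). The sum over elements
can later be rearranged by ranks. -/
theorem sum_relEntropy_fiber {κ : Type*} [DecidableEq κ] (s : Finset (Fin n)) (f : Fin n → κ)
    (t : Finset κ) (hf : ∀ p ∈ s, f p ∈ t) (N : ℕ) :
    ∑ c ∈ t, relEntropy N (s.filter fun p => f p = c).card =
      ∑ p ∈ s, (lg N - lg (s.filter fun q => f q = f p).card) := by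
  rw [← Finset.sum_fiberwise_of_maps_to hf]
  refine Finset.sum_congr rfl fun c _ => ?_
  rw [relEntropy_eq, ← nsmul_eq_mul, ← Finset.sum_const]
  refine Finset.sum_congr rfl fun p hp => ?_
  rw [(Finset.mem_filter.1 hp).2]

/-- The even labels are the gaps and the odd ones the queried values, so the label of an element
determines its class. -/
theorem sum_relEntropy_labels (N : ℕ) :
    ∑ i ∈ Finset.range (Y.card + 1),
      relEntropy N (classPart a (fun x => x ∉ Y ∧ gapOf Y x = i) Finset.univ).card +
      ∑ y ∈ Y, relEntropy N (Finset.univ.filter fun p => a p = y).card =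
    ∑ p, (lg N - lg (labelCount a Y p)) := by
  have h1 := sum_relEntropy_fiber (Finset.univ.filter fun p => a p ∉ Y) (fun p => gapOf Y (a p))
    (Finset.range (Y.card + 1))
    (fun p _ => Finset.mem_range.2 (Nat.lt_succ_of_le (PivotTree.gapOf_le_card _ _))) N
  have h2 := sum_relEntropy_fiber (Finset.univ.filter fun p => a p ∈ Y) a Y
    (fun p hp => (Finset.mem_filter.1 hp).2) N
  rw [← Finset.sum_filter_not_add_sum_filter Finset.univ fun p => a p ∈ Y]
  congr 1
  · refine Eq.trans ?_ (h1.trans ?_)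
    · refine Finset.sum_congr rfl fun i _ => ?_
      rw [Finset.filter_filter]
      rfl
    · refine Finset.sum_congr rfl fun p hp => ?_
      have hp := (Finset.mem_filter.1 hp).2
      rw [labelCount, Finset.filter_filter]
      congr 3
      refine Finset.filter_congr fun q _ => ?_
      unfold label
      rw [if_neg hp]
      by_cases hq : a q ∈ Y
      · simp only [hq, not_true, false_and, if_true, false_iff]; omega
      · simp only [hq, not_false_iff, true_and, if_false]; omega
  · refine Eq.trans ?_ (h2.trans ?_)
    · refine Finset.sum_congr rfl fun y hy => ?_
      rw [Finset.filter_filter]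
      congr 2
      refine Finset.filter_congr fun q _ => ⟨fun h => ⟨h ▸ hy, h⟩, fun h => h.2⟩
    · refine Finset.sum_congr rfl fun p hp => ?_
      have hp := (Finset.mem_filter.1 hp).2
      rw [labelCount, Finset.filter_filter]
      congr 3
      refine Finset.filter_congr fun q _ => ?_
      unfold label
      rw [if_pos hp]
      by_cases hq : a q ∈ Y
      · rw [if_pos hq]
        refine ⟨fun h => by rw [h.2], fun h => ⟨hq, PivotTree.gapOf_injOn Y hq hp (by omega)⟩⟩
      · simp only [hq, false_and, if_false, false_iff]; omega

/-- Gaps are handled by `classEntropy_le`; a pivot with a queried value contributes a single term,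
handled by `relEntropy_le_add`. -/
theorem PivotTree.sum_relEntropy_le (hT : T.Valid a (runOf a) Y Finset.univ)
    (hY : ∀ y ∈ Y, ∃ p, a p = y) :
    T.sum a (runOf a) (fun S => relEntropy n (runCount (runOf a) S))
      (fun S μ => relEntropy n (equalRuns a (runOf a) S μ)) Finset.univ ≤
    ∑ p, (lg n - lg (labelCount a Y p)) + 134 * n := by
  rw [PivotTree.sum_relEntropy_eq hY n T _ full_univ hT, ← sum_relEntropy_labels]
  have hcard : (Finset.univ : Finset (Fin n)).card = n := by simp
  have h1 : ∑ i ∈ Finset.range (Y.card + 1),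
      T.classEntropy a (runOf a) (fun x => x ∉ Y ∧ gapOf Y x = i) n Finset.univ ≤
      ∑ i ∈ Finset.range (Y.card + 1),
        (relEntropy n (classPart a (fun x => x ∉ Y ∧ gapOf Y x = i) Finset.univ).card +
          134 * (classPart a (fun x => x ∉ Y ∧ gapOf Y x = i) Finset.univ).card) := by
    refine Finset.sum_le_sum fun i _ => ?_
    refine PivotTree.classEntropy_le (fun x h => h.1) ?_ n T _ hT hcard.le
    intro x y z hx hz hxy hyz
    have h1 := gapOf_mono Y hxy
    have h2 := gapOf_mono Y hyz
    refine ⟨fun hy => ?_, by omega⟩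
    rcases hyz.lt_or_eq with h | rfl
    · have := gapOf_lt Y hy hxy h
      omega
    · exact hz.1 hy
  have h2 : T.sum a (runOf a) (fun _ => 0)
      (fun S μ => if a μ ∈ Y then relEntropy n (equalRuns a (runOf a) S μ) else 0) Finset.univ ≤
      ∑ y ∈ Y, (relEntropy n (Finset.univ.filter fun p => a p = y).card +
        ((Finset.univ.filter fun p => a p = y).card : ℝ)) := by
    rw [PivotTree.sum_univ_eq hT _ rfl, PivotTree.sum_nodes_eq hT
      (fun S μ => if a μ ∈ Y then relEntropy n (equalRuns a (runOf a) S μ) else 0)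
      fun v => if v ∈ Y then relEntropy n (valueRuns a v) else 0]
    · rw [Finset.sum_const_zero, zero_add, ← Finset.sum_filter]
      have hle : ∀ v, (Finset.univ.filter fun p => a p = v).card ≤ n := fun v =>
        (Finset.card_le_univ _).trans (by simp)
      refine (Finset.sum_le_sum fun v _ =>
        relEntropy_le_add (runCount_le_card _) (hle v)).trans ?_
      refine Finset.sum_le_sum_of_subset_of_nonneg
        (fun v hv => (Finset.mem_filter.1 hv).2) fun v _ _ => ?_
      have := relEntropy_nonneg (hle v)
      positivity
    · intro S μ h hμ
      rw [equalRuns_eq h hμ]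
      rfl
  have h3 : (∑ i ∈ Finset.range (Y.card + 1),
      (classPart a (fun x => x ∉ Y ∧ gapOf Y x = i) Finset.univ).card : ℕ) +
      ∑ y ∈ Y, (Finset.univ.filter fun p => a p = y).card ≤ n :=
    (card_eq_sum_gaps_add_sum_values (a := a) Y).le
  have h3' : (∑ i ∈ Finset.range (Y.card + 1),
      ((classPart a (fun x => x ∉ Y ∧ gapOf Y x = i) Finset.univ).card : ℝ)) +
      ∑ y ∈ Y, ((Finset.univ.filter fun p => a p = y).card : ℝ) ≤ n := by exact_mod_cast h3
  have h4 : 0 ≤ ∑ y ∈ Y, ((Finset.univ.filter fun p => a p = y).card : ℝ) :=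
    Finset.sum_nonneg fun _ _ => Nat.cast_nonneg _
  simp only [Finset.sum_add_distrib, ← Finset.mul_sum] at h1 h2
  linarith

theorem numRuns_le : numRuns a ≤ n := by
  have := runCount_le_card (R := runOf a) (Finset.univ : Finset (Fin n))
  rw [Finset.card_univ, Fintype.card_fin] at this
  exact this

/-- By `card_selectionBlocks_le_sum` and ρ ≤ n the excess is at most the entropy of the gap runs and
value runs. Passing from the gaps to the leaves costs 2 log n per pivot, and each log n is at most
the entropy term of the pivot value plus 2/3 of its number of runs. Hence the factor 1 + 2. -/
theorem PivotTree.excess_le (hT : T.Valid a (runOf a) Y Finset.univ) :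
    excess a (T.values a) ≤ 3 * T.sum a (runOf a)
      (fun S => relEntropy n (runCount (runOf a) S))
      (fun S μ => relEntropy n (equalRuns a (runOf a) S μ)) Finset.univ + 2 * n := by
  rw [PivotTree.sum_runs_eq hT _ _ (relEntropy_zero n)]
  set P := T.values a with hP
  have h1 : ((selectionBlocks a P).card : ℝ) * lg (numRuns a) ≤
      (∑ i ∈ Finset.range (P.card + 1), (gapRuns a P i : ℝ) + ∑ v ∈ P, (valueRuns a v : ℝ)) *
        lg n :=
    mul_le_mul (by exact_mod_cast card_selectionBlocks_le_sum) (lg_mono numRuns_le) (lg_nonneg _)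
      (by positivity)
  have h2 : ∀ i, relEntropy n (gapRuns a P i) ≤ relEntropy n (T.leafRuns a i) +
      (gapTop P i + gapBottom P i) * lg n := by
    intro i
    have h3 := xlg_mono (PivotTree.leafRuns_le hT i)
    have h4 : (gapRuns a P i : ℝ) ≤ T.leafRuns a i + gapTop P i + gapBottom P i := by
      exact_mod_cast PivotTree.gapRuns_le hT i
    have h5 := mul_le_mul_of_nonneg_right h4 (lg_nonneg n)
    unfold relEntropy
    linarith
  have h3 := Finset.sum_le_sum fun i (_ : i ∈ Finset.range (P.card + 1)) => h2 i
  have h4 : (∑ i ∈ Finset.range (P.card + 1), (gapBottom P i : ℝ)) * lg n ≤ P.card * lg n :=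
    mul_le_mul_of_nonneg_right (by exact_mod_cast sum_card_fiber_le P _ _) (lg_nonneg _)
  have h5 : (∑ i ∈ Finset.range (P.card + 1), (gapTop P i : ℝ)) * lg n ≤ P.card * lg n :=
    mul_le_mul_of_nonneg_right (by exact_mod_cast sum_card_fiber_le P _ _) (lg_nonneg _)
  have h6 : ∑ v ∈ P, lg n ≤ ∑ v ∈ P, (2 / 3 * (valueRuns a v : ℝ) +
      relEntropy n (valueRuns a v)) :=
    Finset.sum_le_sum fun v hv => lg_le_value (PivotTree.valueRuns_pos hv)
      ((valueRuns_le_numRuns v).trans numRuns_le)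
  have h7 : ∑ i ∈ Finset.range (P.card + 1), (gapRuns a P i : ℝ) + ∑ v ∈ P, (valueRuns a v : ℝ) ≤
      n := by exact_mod_cast sum_gapRuns_add_sum_valueRuns_le P
  have h8 : 0 ≤ ∑ i ∈ Finset.range (P.card + 1), (gapRuns a P i : ℝ) :=
    Finset.sum_nonneg fun _ _ => Nat.cast_nonneg _
  have h9 : 0 ≤ ∑ i ∈ Finset.range (P.card + 1), relEntropy n (T.leafRuns a i) :=
    Finset.sum_nonneg fun i _ => relEntropy_nonneg
      ((PivotTree.leafRuns_le hT i).trans ((gapRuns_le_numRuns _ _).trans numRuns_le))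
  have h10 : (0 : ℝ) ≤ n := Nat.cast_nonneg _
  rw [Finset.sum_const, nsmul_eq_mul] at h6
  simp only [Finset.sum_add_distrib, ← Finset.mul_sum, ← Finset.sum_mul] at h3 h6
  have h11 : excess a P ≤ ∑ i ∈ Finset.range (P.card + 1), relEntropy n (gapRuns a P i) +
      ∑ v ∈ P, relEntropy n (valueRuns a v) := by
    unfold excess relEntropy
    simp only [Finset.sum_sub_distrib, ← Finset.sum_mul]
    linarith
  linarith

end Labels

/-! ### The intervals of ranks between neighbouring queries -/

/-- Every fiber that meets `I` contributes at most one. -/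
theorem sum_inv_fiber_le {κ : Type*} [Fintype κ] (f : κ → ℕ) (I : Finset κ) (c : ℕ)
    (h : (I.image f).card ≤ c) :
    ∑ p ∈ I, ((Finset.univ.filter fun q => f q = f p).card : ℝ)⁻¹ ≤ c := by
  classical
  calc ∑ p ∈ I, ((Finset.univ.filter fun q => f q = f p).card : ℝ)⁻¹
      = ∑ i ∈ I.image f, ∑ p ∈ I with f p = i,
          ((Finset.univ.filter fun q => f q = f p).card : ℝ)⁻¹ :=
        (Finset.sum_fiberwise_of_maps_to (fun p hp => Finset.mem_image_of_mem f hp) _).symm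
    _ ≤ ∑ i ∈ I.image f, 1 := by
        refine Finset.sum_le_sum fun i _ => ?_
        have h1 : ∑ p ∈ I with f p = i, ((Finset.univ.filter fun q => f q = f p).card : ℝ)⁻¹ =
            (I.filter fun p => f p = i).card *
              ((Finset.univ.filter fun q => f q = i).card : ℝ)⁻¹ := by
          rw [← nsmul_eq_mul, ← Finset.sum_const]
          refine Finset.sum_congr rfl fun p hp => ?_
          rw [(Finset.mem_filter.1 hp).2]
        rw [h1]
        refine mul_inv_le_one_of_le₀ ?_ (Nat.cast_nonneg _)
        exact_mod_cast Finset.card_le_card (Finset.filter_subset_filter _ (Finset.subset_univ I))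
    _ ≤ c := by
        rw [Finset.sum_const, nsmul_one]
        exact_mod_cast h

/-- The entropy of a set that meets at most `c` fibers. -/
theorem sum_lg_sub_lg_fiber_le {κ : Type*} [Fintype κ] (f : κ → ℕ) (I : Finset κ) (c N : ℕ)
    (h : (I.image f).card ≤ c) :
    ∑ p ∈ I, (lg N - lg (Finset.univ.filter fun q => f q = f p).card) ≤
      relEntropy N I.card + c * I.card := by
  -- For the fiber F of `p` this is lg (|I| / |F|) ≤ |I| / |F|, whose sum is controlled by the
  -- number of fibers.
  have h1 : ∀ p ∈ I, lg N - lg (Finset.univ.filter fun q => f q = f p).card ≤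
      (lg N - lg I.card) + I.card * ((Finset.univ.filter fun q => f q = f p).card : ℝ)⁻¹ := by
    intro p hp
    have hI : (0 : ℝ) < I.card := by exact_mod_cast Finset.card_pos.2 ⟨p, hp⟩
    have hF : (0 : ℝ) < (Finset.univ.filter fun q => f q = f p).card := by
      exact_mod_cast Finset.card_pos.2 ⟨p, by simp⟩
    have := logb_two_le (div_pos hI hF)
    rw [Real.logb_div hI.ne' hF.ne', div_eq_mul_inv] at this
    unfold lg
    linarith
  refine (Finset.sum_le_sum h1).trans ?_
  rw [Finset.sum_add_distrib, Finset.sum_const, nsmul_eq_mul, ← Finset.mul_sum, ← relEntropy_eq]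
  have := mul_le_mul_of_nonneg_left (sum_inv_fiber_le f I c h) (Nat.cast_nonneg (α := ℝ) I.card)
  linarith

theorem sum_filter_intervals {n : ℕ} (e : ℕ → ℕ) (he : Monotone e) (h0 : e 0 = 0)
    (h : Fin n → ℝ) (m : ℕ) :
    ∑ i ∈ Finset.range m, ∑ k ∈ Finset.univ.filter (fun k : Fin n => e i ≤ k ∧ (k : ℕ) < e (i + 1)), h k =
      ∑ k ∈ Finset.univ.filter (fun k : Fin n => (k : ℕ) < e m), h k := by
  induction m with
  | zero => simp [h0]
  | succ m ih =>
    rw [Finset.sum_range_succ, ih, ← Finset.sum_union]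
    · refine Finset.sum_congr ?_ fun _ _ => rfl
      ext k
      have := he (Nat.le_succ m)
      simp only [Finset.mem_union, Finset.mem_filter, Finset.mem_univ, true_and]
      simp only [Nat.succ_eq_add_one] at this
      omega
    · refine Finset.disjoint_left.2 fun k hk hk' => ?_
      simp only [Finset.mem_filter, Finset.mem_univ, true_and] at hk hk'
      omega

theorem card_filter_interval {n u v : ℕ} (hv : v ≤ n) :
    (Finset.univ.filter fun k : Fin n => u ≤ k ∧ (k : ℕ) < v).card = v - u := by
  rw [← Nat.card_Ico, ← Finset.card_map Fin.valEmbedding]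
  congr 1
  ext k
  simp only [Finset.mem_map, Finset.mem_filter, Finset.mem_univ, true_and, Fin.valEmbedding_apply,
    Finset.mem_Ico]
  exact ⟨fun ⟨x, hx, h⟩ => h ▸ hx, fun h => ⟨⟨k, h.2.trans_le hv⟩, h, rfl⟩⟩

/-! ### Ranks, sorted order and the bound by the queries -/

section Ranks

variable {n q : ℕ} {r : Fin q → ℕ}

theorem extendedRank_zero : extendedRank n r 0 = 0 := by simp [extendedRank]

theorem extendedRank_last : extendedRank n r (q + 1) = n := by simp [extendedRank]

theorem extendedRank_succ (j : Fin q) : extendedRank n r (j + 1) = r j := by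
  simp [extendedRank]

theorem extendedRank_le (hr : ∀ i, 1 ≤ r i ∧ r i ≤ n) (i : ℕ) : extendedRank n r i ≤ n := by
  unfold extendedRank
  split_ifs
  · exact Nat.zero_le _
  · exact (hr _).2
  · exact le_rfl

theorem extendedRank_mono (hm : Monotone r) (hr : ∀ i, 1 ≤ r i ∧ r i ≤ n) :
    Monotone (extendedRank n r) := by
  refine monotone_nat_of_le_succ fun i => ?_
  rcases i with _ | i
  · rw [extendedRank_zero]
    exact Nat.zero_le _
  by_cases h : i + 1 < q
  · have h1 := extendedRank_succ (n := n) (r := r) ⟨i, by omega⟩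
    have h2 := extendedRank_succ (n := n) (r := r) ⟨i + 1, h⟩
    simp only at h1 h2
    rw [h1, h2]
    exact hm (Fin.le_def.2 (Nat.le_succ i))
  · have h1 : extendedRank n r (i + 1 + 1) = n := by
      rw [extendedRank, if_neg (by omega), dif_neg (by omega)]
    rw [h1]
    exact extendedRank_le hr _

variable {α : Type*} [LinearOrder α] {a : Fin n → α}

theorem hasRank_sort (k : Fin n) : HasRank a (k + 1) (Tuple.sort a k) := by
  have hm := Tuple.monotone_sort a
  constructor
  · rw [Nat.lt_succ_iff]
    have : (Finset.univ.filter fun t => a t < a (Tuple.sort a k)) ⊆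
        (Finset.univ.filter fun j : Fin n => 0 ≤ (j : ℕ) ∧ (j : ℕ) < k).map
          (Tuple.sort a).toEmbedding := by
      intro t ht
      rw [Finset.mem_filter] at ht
      refine Finset.mem_map.2 ⟨(Tuple.sort a).symm t, ?_, by simp⟩
      simp only [Finset.mem_filter, Finset.mem_univ, true_and, Nat.zero_le]
      by_contra h
      have := hm (Fin.le_def.2 (not_lt.1 h))
      simp only [Function.comp_apply, Equiv.apply_symm_apply] at this
      exact absurd ht.2 (not_lt.2 this)
    refine (Finset.card_le_card this).trans ?_
    rw [Finset.card_map, card_filter_interval k.2.le, Nat.sub_zero]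
  · have : (Finset.univ.filter fun j : Fin n => 0 ≤ (j : ℕ) ∧ (j : ℕ) < k + 1).map
          (Tuple.sort a).toEmbedding ⊆ (Finset.univ.filter fun t => a t ≤ a (Tuple.sort a k)) := by
      intro t ht
      obtain ⟨j, hj, rfl⟩ := Finset.mem_map.1 ht
      simp only [Finset.mem_filter, Finset.mem_univ, true_and, Nat.zero_le] at hj ⊢
      exact hm (Fin.le_def.2 (Nat.lt_succ_iff.1 hj))
    refine le_trans ?_ (Finset.card_le_card this)
    rw [Finset.card_map, card_filter_interval k.2, Nat.sub_zero]

theorem hasRank_value_unique {k : ℕ} {p t : Fin n} (hp : HasRank a k p) (ht : HasRank a k t) :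
    a p = a t := by
  have key : ∀ {p t : Fin n}, HasRank a k p → HasRank a k t → ¬ a p < a t := by
    intro p t hp ht h
    have : (Finset.univ.filter fun s => a s ≤ a p).card ≤
        (Finset.univ.filter fun s => a s < a t).card :=
      Finset.card_le_card fun s hs => by
        rw [Finset.mem_filter] at hs ⊢
        exact ⟨hs.1, hs.2.trans_lt h⟩
    have := hp.2
    have := ht.1
    omega
  exact le_antisymm (not_lt.1 (key ht hp)) (not_lt.1 (key hp ht))

/-- The values of the elements of the given ranks. -/
noncomputable def queryValues (a : Fin n → α) (r : Fin q → ℕ) : Finset α := by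
  classical
  exact (Finset.univ.filter fun p => ∃ i, HasRank a (r i) p).image a

theorem mem_queryValues {y : α} :
    y ∈ queryValues a r ↔ ∃ p, (∃ i, HasRank a (r i) p) ∧ a p = y := by
  simp [queryValues]

/-- In an interval of ranks between neighbouring queries there are at most three labels. -/
theorem card_labels_le (hm : Monotone r) (hr : ∀ i, 1 ≤ r i ∧ r i ≤ n) (i : ℕ) :
    ((Finset.univ.filter fun k : Fin n =>
      extendedRank n r i ≤ k ∧ (k : ℕ) < extendedRank n r (i + 1)).image
        fun k => label (queryValues a r) (a (Tuple.sort a k))).card ≤ 3 := by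
  classical
  set Y := queryValues a r with hY
  -- `B` holds the values queried before the interval. In the interval all of `B` is at most the
  -- current value `x`, and every other queried value is at least `x`. So the number of queried
  -- values below `x` is `u`, or it is u - 1 and `x` itself lies in `B`; the labels are among 2u -
  -- 1, 2u and 2u + 1.
  set B := Y.filter fun y => ∃ p, ∃ j : Fin q, (j : ℕ) < i ∧ HasRank a (r j) p ∧ a p = y with hB
  set u := B.card with hu
  have hsort := Tuple.monotone_sort a
  have key : ∀ (j : Fin q) p, HasRank a (r j) p →
      a p = a (Tuple.sort a ⟨r j - 1, by have := hr j; omega⟩) := by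
    intro j p hp
    refine hasRank_value_unique hp ?_
    have := hasRank_sort (a := a) ⟨r j - 1, by have := hr j; omega⟩
    rwa [show r j - 1 + 1 = r j by have := hr j; omega] at this
  have hsub : ((Finset.univ.filter fun k : Fin n =>
      extendedRank n r i ≤ k ∧ (k : ℕ) < extendedRank n r (i + 1)).image
        fun k => label Y (a (Tuple.sort a k))) ⊆ Finset.Icc (2 * u - 1) (2 * u + 1) := by
    intro c hc
    obtain ⟨k, hk, rfl⟩ := Finset.mem_image.1 hc
    simp only [Finset.mem_filter, Finset.mem_univ, true_and] at hk
    set x := a (Tuple.sort a k) with hx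
    have hBle : ∀ y ∈ B, y ≤ x := by
      intro y hy
      obtain ⟨_, p, j, hj, hp, rfl⟩ := Finset.mem_filter.1 hy
      rw [key j p hp]
      refine hsort (Fin.le_def.2 ?_)
      have h1 := extendedRank_mono hm hr (show (j : ℕ) + 1 ≤ i by omega)
      rw [extendedRank_succ] at h1
      simp only
      omega
    have hnB : ∀ y ∈ Y, y ∉ B → x ≤ y := by
      intro y hy hyB
      obtain ⟨p, ⟨j, hp⟩, rfl⟩ := mem_queryValues.1 hy
      have hj : i ≤ j := by
        by_contra h
        exact hyB (Finset.mem_filter.2 ⟨hy, p, j, not_le.1 h, hp, rfl⟩)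
      rw [key j p hp]
      refine hsort (Fin.le_def.2 ?_)
      have h1 := extendedRank_mono hm hr (show i + 1 ≤ (j : ℕ) + 1 by omega)
      rw [extendedRank_succ] at h1
      simp only
      omega
    have h1 : gapOf Y x ≤ u := by
      refine Finset.card_le_card fun y hy => ?_
      obtain ⟨hy, hyx⟩ := Finset.mem_filter.1 hy
      by_contra h
      exact absurd hyx (not_lt.2 (hnB y hy h))
    have h2 : u ≤ gapOf Y x + if x ∈ Y then 1 else 0 := by
      split_ifs with h
      rotate_left
      · rw [add_zero]
        refine Finset.card_le_card fun y hy => ?_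
        have hyY := (Finset.mem_filter.1 hy).1
        exact Finset.mem_filter.2 ⟨hyY, (hBle y hy).lt_of_ne fun e => h (e ▸ hyY)⟩
      · rw [gapOf, ← Finset.card_insert_of_notMem (a := x) (by simp)]
        refine Finset.card_le_card fun y hy => ?_
        rcases (hBle y hy).lt_or_eq with h | h
        · exact Finset.mem_insert_of_mem (Finset.mem_filter.2 ⟨(Finset.mem_filter.1 hy).1, h⟩)
        · exact h ▸ Finset.mem_insert_self _ _
    rw [Finset.mem_Icc]
    unfold label
    split_ifs at h2 ⊢ <;> omega
  refine (Finset.card_le_card hsub).trans ?_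
  rw [Nat.card_Icc]
  omega

/-- The differences of the ranks telescope to n, so the terms Δ log n add up to n log n. -/
theorem sum_relEntropy_extendedRank (hm : Monotone r) (hr : ∀ i, 1 ≤ r i ∧ r i ≤ n) :
    ∑ i ∈ Finset.range (q + 1), relEntropy n (extendedRank n r (i + 1) - extendedRank n r i) =
      queryBound n r - n := by
  have he := extendedRank_mono hm hr
  have h1 : ∑ i ∈ Finset.range (q + 1),
      ((extendedRank n r (i + 1) - extendedRank n r i : ℕ) : ℝ) = n := by
    rw [← Nat.cast_sum, Finset.sum_range_tsub he, extendedRank_last, extendedRank_zero,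
      Nat.sub_zero]
  unfold queryBound relEntropy
  rw [Finset.sum_sub_distrib, ← Finset.sum_mul, h1]
  have h2 : ∀ i, xlg (extendedRank n r (i + 1) - extendedRank n r i) =
      ((extendedRank n r (i + 1) : ℝ) - extendedRank n r i) *
      Real.logb 2 ((extendedRank n r (i + 1) : ℝ) - extendedRank n r i) := by
    intro i
    unfold xlg lg
    rw [Nat.cast_sub (he (Nat.le_succ i))]
  simp only [h2]
  unfold lg
  ring

theorem le_queryBound (hm : Monotone r) (hr : ∀ i, 1 ≤ r i ∧ r i ≤ n) :
    (n : ℝ) ≤ queryBound n r := by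
  have h := sum_relEntropy_extendedRank hm hr
  have : 0 ≤ ∑ i ∈ Finset.range (q + 1),
      relEntropy n (extendedRank n r (i + 1) - extendedRank n r i) :=
    Finset.sum_nonneg fun i _ => relEntropy_nonneg
      ((Nat.sub_le _ _).trans (extendedRank_le hr _))
  linarith

/-- The sum over elements is taken in sorted order and cut at the queries. Three labels per interval
cost 3n, of which one n is contained in `queryBound`. -/
theorem sum_label_le (hm : Monotone r) (hr : ∀ i, 1 ≤ r i ∧ r i ≤ n) :
    ∑ p, (lg n - lg (labelCount a (queryValues a r) p)) ≤ queryBound n r + 2 * n := by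
  have he := extendedRank_mono hm hr
  set g : Fin n → ℕ := fun k => label (queryValues a r) (a (Tuple.sort a k)) with hg
  have h1 : ∀ k, labelCount a (queryValues a r) (Tuple.sort a k) =
      (Finset.univ.filter fun j => g j = g k).card := by
    intro k
    refine Eq.trans ?_ (Finset.card_map (Tuple.sort a).toEmbedding)
    rw [labelCount]
    congr 1
    ext t
    rw [Finset.mem_map_equiv]
    simp [hg]
  rw [← Equiv.sum_comp (Tuple.sort a)]
  simp only [h1]
  have h2 := sum_filter_intervals (n := n) (extendedRank n r) he extendedRank_zero
    (fun k => lg n - lg (Finset.univ.filter fun j => g j = g k).card) (q + 1)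
  rw [extendedRank_last, Finset.filter_true_of_mem fun k _ => k.2] at h2
  rw [← h2]
  have h3 : ∀ i ∈ Finset.range (q + 1), ∑ k ∈ Finset.univ.filter (fun k : Fin n =>
      extendedRank n r i ≤ k ∧ (k : ℕ) < extendedRank n r (i + 1)),
        (lg n - lg (Finset.univ.filter fun j => g j = g k).card) ≤
      relEntropy n (extendedRank n r (i + 1) - extendedRank n r i) +
        3 * ((extendedRank n r (i + 1) - extendedRank n r i : ℕ) : ℝ) := by
    intro i _
    have := sum_lg_sub_lg_fiber_le g _ 3 n (card_labels_le (a := a) hm hr i)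
    rw [card_filter_interval (extendedRank_le hr _)] at this
    exact_mod_cast this
  refine (Finset.sum_le_sum h3).trans ?_
  rw [Finset.sum_add_distrib, ← Finset.mul_sum, sum_relEntropy_extendedRank hm hr,
    ← Nat.cast_sum, Finset.sum_range_tsub he, extendedRank_last, extendedRank_zero, Nat.sub_zero]
  linarith

/-- The entropy of the pieces is at most `queryBound` + 136n, so the excess is at most 3 ·
`queryBound` + 410n. The two remaining terms are at most 2n, and n ≤ `queryBound`. -/
theorem PivotTree.synergyBound_le {T : PivotTree (Fin n)} (hm : Monotone r)
    (hr : ∀ i, 1 ≤ r i ∧ r i ≤ n)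
    (hT : T.Valid a (runOf a) (queryValues a r) Finset.univ) :
    synergyBound a (T.values a) ≤ 415 * queryBound n r := by
  have h1 := PivotTree.sum_relEntropy_le hT fun y hy => by
    obtain ⟨p, _, h⟩ := mem_queryValues.1 hy
    exact ⟨p, h⟩
  have h2 := sum_label_le (a := a) hm hr
  have h3 := PivotTree.excess_le hT
  have h4 := sum_lg_selectionBlocks_le (a := a) (P := T.values a)
  have h5 := le_queryBound hm hr
  rw [synergyBound_eq]
  linarith

end Ranks

/-! ### Lists of runs -/

theorem countP_eq_card_filter {κ : Type*} [DecidableEq κ] {l : List κ} (hl : l.Nodup)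
    (P : κ → Prop) [DecidablePred P] :
    l.countP (fun x => P x) = (l.toFinset.filter P).card := by
  rw [List.countP_eq_length_filter, ← List.toFinset_card_of_nodup (hl.filter _)]
  congr 1
  ext x
  simp

section Rep

variable {ι : Type} [Fintype ι] [DecidableEq ι] {α : Type*} [LinearOrder α]

/-- The lists in `runs` are the sorted, nonempty pieces of the runs that make up `S`. -/
structure Rep (a : ι → α) (R : ι → ℕ) (runs : List (List ι)) (S : Finset ι) : Prop where
  ne : ∀ r ∈ runs, r ≠ []
  sorted : ∀ r ∈ runs, r.Pairwise fun x y => a x ≤ a y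
  nodup : runs.flatten.Nodup
  mem : ∀ p, p ∈ runs.flatten ↔ p ∈ S
  same : ∀ r ∈ runs, ∀ x ∈ r, ∀ y ∈ r, R x = R y
  diff : runs.Pairwise fun r s => ∀ x ∈ r, ∀ y ∈ s, R x ≠ R y

/-- The run of the elements of a list. -/
def runKey (R : ι → ℕ) (r : List ι) : ℕ := (r.head?.map R).getD 0

variable {a : ι → α} {R : ι → ℕ} {runs : List (List ι)} {S : Finset ι}

namespace Rep

theorem perm (h : Rep a R runs S) {runs' : List (List ι)} (hp : runs.Perm runs') :
    Rep a R runs' S where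
  ne r hr := h.ne r (hp.mem_iff.2 hr)
  sorted r hr := h.sorted r (hp.mem_iff.2 hr)
  nodup := hp.flatten.nodup_iff.1 h.nodup
  mem p := (hp.flatten.mem_iff (a := p)).symm.trans (h.mem p)
  same r hr := h.same r (hp.mem_iff.2 hr)
  diff := (hp.pairwise_iff fun hrs x hx y hy => (hrs y hy x hx).symm).1 h.diff

/-- Recursive calls are instances of this: filtering keeps order and runs, and empty pieces are
dropped to keep all lists nonempty. -/
theorem restrict (h : Rep a R runs S) {S' : Finset ι} (hS : S' ⊆ S) :
    Rep a R ((runs.map fun r => r.filter fun x => x ∈ S').filter fun r => !r.isEmpty) S' := by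
  have hf : ∀ r', r' ∈ (runs.map fun r => r.filter fun x => x ∈ S').filter (fun r => !r.isEmpty) →
      ∃ r ∈ runs, r' = r.filter fun x => x ∈ S' := by
    intro r' hr'
    obtain ⟨r, hr, rfl⟩ := List.mem_map.1 (List.mem_filter.1 hr').1
    exact ⟨r, hr, rfl⟩
  have hflat : ((runs.map fun r => r.filter fun x => x ∈ S').filter
      fun r => !r.isEmpty).flatten = runs.flatten.filter fun x => x ∈ S' := by
    rw [List.flatten_filter_not_isEmpty, List.filter_flatten]
  refine ⟨?_, ?_, ?_, ?_, ?_, ?_⟩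
  · intro r' hr'
    simpa using (List.mem_filter.1 hr').2
  · intro r' hr'
    obtain ⟨r, hr, rfl⟩ := hf r' hr'
    exact (h.sorted r hr).sublist List.filter_sublist
  · rw [hflat]
    exact h.nodup.filter _
  · intro p
    rw [hflat, List.mem_filter, h.mem]
    simp only [decide_eq_true_eq]
    exact ⟨fun h => h.2, fun h => ⟨hS h, h⟩⟩
  · intro r' hr' x hx y hy
    obtain ⟨r, hr, rfl⟩ := hf r' hr'
    exact h.same r hr x (List.mem_filter.1 hx).1 y (List.mem_filter.1 hy).1
  · refine List.Pairwise.sublist List.filter_sublist (List.pairwise_map.2 (h.diff.imp ?_))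
    intro r s hrs x hx y hy
    exact hrs x (List.mem_filter.1 hx).1 y (List.mem_filter.1 hy).1

theorem key_eq (h : Rep a R runs S) {r : List ι} (hr : r ∈ runs) {x : ι} (hx : x ∈ r) :
    runKey R r = R x := by
  rcases r with _ | ⟨y, t⟩
  · simp at hx
  · exact h.same _ hr y List.mem_cons_self x hx

theorem exists_mem (h : Rep a R runs S) {r : List ι} (hr : r ∈ runs) :
    ∃ x ∈ r, runKey R r = R x := by
  obtain ⟨x, hx⟩ := List.exists_mem_of_ne_nil r (h.ne r hr)
  exact ⟨x, hx, h.key_eq hr hx⟩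

theorem mem_of_mem (h : Rep a R runs S) {r : List ι} (hr : r ∈ runs) {x : ι} (hx : x ∈ r) : x ∈ S :=
  (h.mem x).1 (List.mem_flatten.2 ⟨r, hr, hx⟩)

theorem nodup_keys (h : Rep a R runs S) : (runs.map (runKey R)).Nodup := by
  rw [List.Nodup, List.pairwise_map]
  refine List.Pairwise.imp_of_mem ?_ h.diff
  intro r s hr hs hrs
  obtain ⟨x, hx, e⟩ := h.exists_mem hr
  obtain ⟨y, hy, e'⟩ := h.exists_mem hs
  rw [e, e']
  exact hrs x hx y hy

theorem toFinset_keys (h : Rep a R runs S) : (runs.map (runKey R)).toFinset = S.image R := by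
  ext k
  simp only [List.mem_toFinset, List.mem_map, Finset.mem_image]
  constructor
  · rintro ⟨r, hr, rfl⟩
    obtain ⟨x, hx, e⟩ := h.exists_mem hr
    exact ⟨x, h.mem_of_mem hr hx, e.symm⟩
  · rintro ⟨x, hx, rfl⟩
    obtain ⟨r, hr, hxr⟩ := List.mem_flatten.1 ((h.mem x).2 hx)
    exact ⟨r, hr, h.key_eq hr hxr⟩

theorem length_eq (h : Rep a R runs S) : runs.length = runCount R S := by
  rw [runCount, ← h.toFinset_keys, List.toFinset_card_of_nodup h.nodup_keys, List.length_map]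

theorem countP_keys (h : Rep a R runs S) (P : ℕ → Prop) [DecidablePred P] :
    runs.countP (fun r => P (runKey R r)) = ((S.image R).filter P).card := by
  rw [← h.toFinset_keys, ← countP_eq_card_filter h.nodup_keys, List.countP_map]
  simp [Function.comp_def]

/-- The lists have distinct keys, so a sum over some of them is a sum over a subset of `K`. -/
theorem sum_keys_le (h : Rep a R runs S) {l : List (List ι)} (hl : l.Sublist runs) (φ : ℕ → ℝ)
    (hφ : ∀ k, 0 ≤ φ k) (K : Finset ℕ) (hK : ∀ r ∈ l, runKey R r ∈ K) :
    (l.map fun r => φ (runKey R r)).sum ≤ ∑ k ∈ K, φ k := by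
  have h1 := List.sum_toFinset φ (h.nodup_keys.sublist (hl.map _))
  rw [List.map_map] at h1
  refine (le_of_eq h1.symm).trans (Finset.sum_le_sum_of_subset_of_nonneg ?_ fun k _ _ => hφ k)
  intro k hk
  obtain ⟨r, hr, rfl⟩ := List.mem_map.1 (List.mem_toFinset.1 hk)
  exact hK r hr

theorem run_nodup (h : Rep a R runs S) {r : List ι} (hr : r ∈ runs) : r.Nodup :=
  h.nodup.sublist (List.sublist_flatten_of_mem hr)

theorem run_toFinset (h : Rep a R runs S) {r : List ι} (hr : r ∈ runs) :
    r.toFinset = runPart R S (runKey R r) := by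
  ext x
  rw [List.mem_toFinset, runPart, Finset.mem_filter]
  constructor
  · exact fun hx => ⟨h.mem_of_mem hr hx, (h.key_eq hr hx).symm⟩
  · rintro ⟨hx, e⟩
    obtain ⟨s, hs, hxs⟩ := List.mem_flatten.1 ((h.mem x).2 hx)
    have : r = s := List.inj_on_of_nodup_map h.nodup_keys hr hs (e.symm.trans (h.key_eq hs hxs).symm)
    exact this ▸ hxs

theorem countP_run (h : Rep a R runs S) {r : List ι} (hr : r ∈ runs) (P : ι → Prop)
    [DecidablePred P] :
    r.countP (fun x => P x) = ((runPart R S (runKey R r)).filter P).card := by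
  rw [← h.run_toFinset hr, countP_eq_card_filter (h.run_nodup hr)]

theorem countP_eq_runFilter (h : Rep a R runs S) {r : List ι} (hr : r ∈ runs) (P : α → Prop)
    [DecidablePred P] :
    r.countP (fun x => P (a x)) = PivotTree.runFilter a R S (runKey R r) P :=
  h.countP_run hr fun x => P (a x)

theorem length_run (h : Rep a R runs S) {r : List ι} (hr : r ∈ runs) :
    r.length = (runPart R S (runKey R r)).card := by
  rw [← h.run_toFinset hr, List.toFinset_card_of_nodup (h.run_nodup hr)]

theorem length_flatten (h : Rep a R runs S) : runs.flatten.length = S.card := by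
  rw [← List.toFinset_card_of_nodup h.nodup]
  congr 1
  ext p
  rw [List.mem_toFinset, h.mem]

/-! ### The median of the middles -/

theorem getElem_mono_of_sorted {r : List ι} (hr : r.Pairwise fun x y => a x ≤ a y) {i j : ℕ}
    (hij : i ≤ j) (hj : j < r.length) : a (r[i]'(hij.trans_lt hj)) ≤ a r[j] := by
  rcases hij.lt_or_eq with h | rfl
  · exact List.pairwise_iff_getElem.1 hr _ _ _ _ h
  · exact le_rfl

/-- The middle element and the length / 2 elements before it are counted. -/
theorem length_le_countP_of_middle_le {r : List ι} (hr : r.Pairwise fun x y => a x ≤ a y) {x μ : ι}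
    (hx : r[r.length / 2]? = some x) (h : a x ≤ a μ) :
    r.length ≤ 2 * r.countP fun p => a p ≤ a μ := by
  obtain ⟨hl, rfl⟩ := List.getElem?_eq_some_iff.1 hx
  have h1 : (r.take (r.length / 2 + 1)).countP (fun p => a p ≤ a μ) = r.length / 2 + 1 := by
    have : (r.take (r.length / 2 + 1)).length = r.length / 2 + 1 := by
      rw [List.length_take]; omega
    conv_rhs => rw [← this]
    rw [List.countP_eq_length]
    intro p hp
    obtain ⟨i, hi, rfl⟩ := List.mem_take_iff_getElem.1 hp
    simp only [decide_eq_true_eq]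
    exact (getElem_mono_of_sorted hr (by omega) hl).trans h
  have h2 := (List.take_sublist (r.length / 2 + 1) r).countP_le (p := fun p => a p ≤ a μ)
  omega

theorem length_le_countP_of_le_middle {r : List ι} (hr : r.Pairwise fun x y => a x ≤ a y) {x μ : ι}
    (hx : r[r.length / 2]? = some x) (h : a μ ≤ a x) :
    r.length ≤ 2 * r.countP fun p => a μ ≤ a p := by
  obtain ⟨hl, rfl⟩ := List.getElem?_eq_some_iff.1 hx
  have h1 : (r.drop (r.length / 2)).countP (fun p => a μ ≤ a p) = r.length - r.length / 2 := by
    rw [← List.length_drop, List.countP_eq_length]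
    intro p hp
    obtain ⟨i, hi, rfl⟩ := List.mem_drop_iff_getElem.1 hp
    simp only [decide_eq_true_eq]
    exact h.trans (getElem_mono_of_sorted hr (Nat.le_add_right _ _) (by omega))
  have h2 := (List.drop_sublist (r.length / 2) r).countP_le (p := fun p => a μ ≤ a p)
  omega

/-- At least half of the middles are at most `μ` and at least half are at least `μ`; in such a run
half of the elements are on the same side as its middle. This yields the balance condition in
`Valid`. -/
theorem medianOfMiddles (h : Rep a R runs S) (hS : S.Nonempty) :
    ∃ μ ∈ S, (medianOfMiddles runs).eval (leOf a) = some μ ∧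
      (QSMS.medianOfMiddles runs).cost (leOf a) ≤ 150 * runCount R S ∧
      runCount R S ≤ 2 * ((S.image R).filter fun k =>
        (runPart R S k).card ≤ 2 * ((runPart R S k).filter fun p => a p ≤ a μ).card).card ∧
      runCount R S ≤ 2 * ((S.image R).filter fun k =>
        (runPart R S k).card ≤ 2 * ((runPart R S k).filter fun p => a μ ≤ a p).card).card := by
  have hne : runs ≠ [] := by
    rintro rfl
    obtain ⟨x, hx⟩ := hS
    simpa using (h.mem x).2 hx
  obtain ⟨μ, h1, h2, ⟨h3, h4⟩, h5⟩ := medianOfMiddles_spec a runs h.ne hne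
  have hl : (runs.filterMap fun r => r[r.length / 2]?).length = runs.length := by
    rw [List.length_filterMap_eq_countP, List.countP_eq_length]
    intro r hr
    have := List.length_pos_iff.2 (h.ne r hr)
    rw [List.getElem?_eq_getElem (by omega)]
    rfl
  refine ⟨μ, ?_, h1, h.length_eq ▸ h5, ?_, ?_⟩
  · obtain ⟨r, hr, e⟩ := List.mem_filterMap.1 h2
    exact h.mem_of_mem hr (List.mem_of_getElem? e)
  · have h6 : (runs.filterMap fun r => r[r.length / 2]?).countP (fun x => a x ≤ a μ) ≤
        runs.countP fun r => (runPart R S (runKey R r)).card ≤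
          2 * ((runPart R S (runKey R r)).filter fun p => a p ≤ a μ).card := by
      rw [List.countP_filterMap]
      refine List.countP_mono_left fun r hr e => ?_
      obtain ⟨x, hx, e⟩ : ∃ x, r[r.length / 2]? = some x ∧ a x ≤ a μ := by
        rcases hx : r[r.length / 2]? with _ | x
        · simp [hx] at e
        · exact ⟨x, rfl, by simpa [hx] using e⟩
      have := length_le_countP_of_middle_le (h.sorted r hr) hx e
      rw [h.length_run hr, h.countP_run hr] at this
      simpa using this
    rw [h.countP_keys fun k => (runPart R S k).card ≤
      2 * ((runPart R S k).filter fun p => a p ≤ a μ).card] at h6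
    rw [← h.length_eq]
    omega
  · have h6 : (runs.filterMap fun r => r[r.length / 2]?).countP (fun x => a μ ≤ a x) ≤
        runs.countP fun r => (runPart R S (runKey R r)).card ≤
          2 * ((runPart R S (runKey R r)).filter fun p => a μ ≤ a p).card := by
      rw [List.countP_filterMap]
      refine List.countP_mono_left fun r hr e => ?_
      obtain ⟨x, hx, e⟩ : ∃ x, r[r.length / 2]? = some x ∧ a μ ≤ a x := by
        rcases hx : r[r.length / 2]? with _ | x
        · simp [hx] at e
        · exact ⟨x, rfl, by simpa [hx] using e⟩
      have := length_le_countP_of_le_middle (h.sorted r hr) hx e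
      rw [h.length_run hr, h.countP_run hr] at this
      simpa using this
    rw [h.countP_keys fun k => (runPart R S k).card ≤
      2 * ((runPart R S k).filter fun p => a μ ≤ a p).card] at h6
    have h7 := countP_le_value a (runs.filterMap fun r => r[r.length / 2]?) μ
    rw [← h.length_eq]
    omega

end Rep

end Rep

/-! ### The steps of the algorithm -/

section Steps

variable {ι : Type} {α : Type*} [LinearOrder α] (a : ι → α)

theorem le_lg_of_two_pow_le {e x : ℕ} (h : 2 ^ e ≤ x) : (e : ℝ) ≤ lg x := by
  have h1 := lg_mono h
  rw [lg_pow] at h1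
  have : lg 2 = 1 := by simp [lg]
  rwa [this, mul_one] at h1

theorem splitRun_spec (μ : ι) {r : List ι} (hr : r.Pairwise fun x y => a x ≤ a y) :
    (splitRun μ r).eval (leOf a) = (r.filter fun x => a x < a μ, r.filter fun x => a x = a μ,
      r.filter fun x => a μ < a x) ∧
    ((splitRun μ r).cost (leOf a) : ℝ) ≤
      3 * (lg (1 + min (r.countP fun x => a x < a μ) (r.countP fun x => a μ ≤ a x)) +
        lg (1 + min (r.countP fun x => a x ≤ a μ) (r.countP fun x => a μ < a x))) + 4 := by
  obtain ⟨c1, t1, -⟩ := isCut_testAt (le := leOf a) (test := fun x => less x μ) (l := r)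
    (fun x => a x < a μ) (fun x => less_eval a x μ) (fun x => (less_cost _ x μ).le)
    (hr.imp fun {x y} h h' => by simp only [decide_eq_true_eq] at *; exact h.trans_lt h')
  obtain ⟨c2, t2, d2⟩ := isCut_testAt (le := leOf a) (test := fun x => leq x μ) (l := r)
    (fun x => a x ≤ a μ) (fun x => leq_eval a x μ) (fun x => (leq_cost _ x μ).le)
    (hr.imp fun {x y} h h' => by simp only [decide_eq_true_eq] at *; exact h.trans h')
  -- The equal elements are obtained by cutting the prefix of the elements at most `μ` once more, at
  -- the same position as in the whole run.
  obtain ⟨-, -, d3⟩ := isCut_testAt (le := leOf a) (test := fun x => less x μ)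
    (l := r.filter fun x => a x ≤ a μ)
    (fun x => a x < a μ) (fun x => less_eval a x μ) (fun x => (less_cost _ x μ).le)
    ((hr.imp fun {x y} h h' => by
      simp only [decide_eq_true_eq] at *; exact h.trans_lt h').sublist List.filter_sublist)
  rw [countP_filter_of_imp (fun x _ h => by
    simp only [decide_eq_true_eq] at *; exact h.le)] at d3
  obtain ⟨e1, k1, i1, j1, s1⟩ := doublingBoth_spec c1 r.length 0 r.length 0 le_rfl (Nat.zero_le _)
    List.countP_le_length le_rfl
  obtain ⟨e2, k2, i2, j2, s2⟩ := doublingBoth_spec c2 r.length 0 r.length 0 le_rfl (Nat.zero_le _)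
    List.countP_le_length le_rfl
  have l1 := countP_le_value a r μ
  have l2 := countP_value_le a r μ
  constructor
  · simp only [splitRun, Cmp.eval_bind, Cmp.eval_pure, e1, e2, t1, t2, d2, d3, List.filter_filter]
    congr 2
    · refine List.filter_congr fun x _ => ?_
      rw [Bool.eq_iff_iff]
      simp only [Bool.and_eq_true, Bool.not_eq_true', decide_eq_false_iff_not, decide_eq_true_eq,
        not_lt]
      exact ⟨fun h => le_antisymm h.2 h.1, fun h => ⟨h.ge, h.le⟩⟩
    · refine List.filter_congr fun x _ => ?_
      rw [Bool.eq_iff_iff]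
      simp only [Bool.not_eq_true', decide_eq_false_iff_not, decide_eq_true_eq, not_le]
  · have h1 := le_lg_of_two_pow_le (e := k1)
      (x := 1 + min (r.countP fun x => a x < a μ) (r.countP fun x => a μ ≤ a x)) (by omega)
    have h2 := le_lg_of_two_pow_le (e := k2)
      (x := 1 + min (r.countP fun x => a x ≤ a μ) (r.countP fun x => a μ < a x)) (by omega)
    have h3 : (splitRun μ r).cost (leOf a) ≤ 3 * k1 + 2 + (3 * k2 + 2) := by
      simp only [splitRun, Cmp.cost_bind, Cmp.cost_pure]
      omega
    have h4 : ((splitRun μ r).cost (leOf a) : ℝ) ≤ 3 * k1 + 2 + (3 * k2 + 2) := by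
      exact_mod_cast h3
    linarith

theorem splitRuns_spec (μ : ι) (rs : List (List ι))
    (hr : ∀ r ∈ rs, r.Pairwise fun x y => a x ≤ a y) :
    (splitRuns μ rs).eval (leOf a) = rs.map (fun r => (r.filter fun x => a x < a μ,
      r.filter fun x => a x = a μ, r.filter fun x => a μ < a x)) ∧
    ((splitRuns μ rs).cost (leOf a) : ℝ) ≤ 3 * (rs.map fun r =>
      (lg (1 + min (r.countP fun x => a x < a μ) (r.countP fun x => a μ ≤ a x)) +
        lg (1 + min (r.countP fun x => a x ≤ a μ) (r.countP fun x => a μ < a x)))).sum +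
      4 * rs.length := by
  induction rs with
  | nil => simp [splitRuns]
  | cons r rs ih =>
    obtain ⟨h1, h2⟩ := ih fun s hs => hr s (List.mem_cons_of_mem _ hs)
    obtain ⟨h3, h4⟩ := splitRun_spec a μ (hr r List.mem_cons_self)
    constructor
    · simp only [splitRuns, Cmp.eval_bind, Cmp.eval_pure, h1, h3, List.map_cons]
    · simp only [splitRuns, Cmp.cost_bind, Cmp.cost_pure, List.map_cons, List.sum_cons,
        List.length_cons]
      push_cast
      linarith

/-- The maximum is described by the values it bounds; this form also covers the empty list, where no
value is bounded, and matches the definition of `lowSide`. -/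
theorem maxC_spec (l : List ι) : (∀ v, (∃ y, (maxC l).eval (leOf a) = some y ∧ v ≤ a y) ↔
    ∃ z ∈ l, v ≤ a z) ∧ (maxC l).cost (leOf a) ≤ l.length := by
  induction l with
  | nil => simp [maxC]
  | cons x xs ih =>
    obtain ⟨h1, h2⟩ := ih
    simp only [maxC, Cmp.eval_bind, Cmp.cost_bind, List.length_cons, List.exists_mem_cons_iff]
    simp only [← h1]
    rcases (maxC xs).eval (leOf a) with _ | y
    · simp only [Cmp.eval_pure, Cmp.cost_pure]
      exact ⟨fun v => by simp, by omega⟩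
    · simp only [Cmp.eval_bind, Cmp.cost_bind, leq_eval, leq_cost, Cmp.eval_ite, Cmp.cost_ite,
        Cmp.eval_pure, Cmp.cost_pure, decide_eq_true_eq, ite_self]
      refine ⟨fun v => ?_, by omega⟩
      split
      · next h => simpa using fun h' => le_trans h' h
      · next h => simpa using fun h' => h'.trans (not_le.1 h).le

theorem minC_spec (l : List ι) : (∀ v, (∃ y, (minC l).eval (leOf a) = some y ∧ a y ≤ v) ↔
    ∃ z ∈ l, a z ≤ v) ∧ (minC l).cost (leOf a) ≤ l.length := by
  induction l with
  | nil => simp [minC]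
  | cons x xs ih =>
    obtain ⟨h1, h2⟩ := ih
    simp only [minC, Cmp.eval_bind, Cmp.cost_bind, List.length_cons, List.exists_mem_cons_iff]
    simp only [← h1]
    rcases (minC xs).eval (leOf a) with _ | y
    · simp only [Cmp.eval_pure, Cmp.cost_pure]
      exact ⟨fun v => by simp, by omega⟩
    · simp only [Cmp.eval_bind, Cmp.cost_bind, leq_eval, leq_cost, Cmp.eval_ite, Cmp.cost_ite,
        Cmp.eval_pure, Cmp.cost_pure, decide_eq_true_eq, ite_self]
      refine ⟨fun v => ?_, by omega⟩
      split
      · next h => simpa using fun h' => le_trans h h'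
      · next h => simpa using fun h' => (not_le.1 h).le.trans h'

theorem getLast?_max {l : List ι} (hl : l.Pairwise fun x y => a x ≤ a y) (v : α) :
    (∃ z, l.getLast? = some z ∧ v ≤ a z) ↔ ∃ z ∈ l, v ≤ a z := by
  constructor
  · rintro ⟨z, hz, h⟩
    exact ⟨z, List.mem_of_getLast? hz, h⟩
  · rintro ⟨z, hz, h⟩
    have hne := List.ne_nil_of_mem hz
    refine ⟨l.getLast hne, List.getLast?_eq_some_getLast hne, h.trans ?_⟩
    rw [← List.dropLast_append_getLast hne] at hl hz
    rcases List.mem_append.1 hz with hz | hz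
    · exact (List.pairwise_append.1 hl).2.2 z hz _ (by simp)
    · rw [List.mem_singleton.1 hz]

theorem head?_min {l : List ι} (hl : l.Pairwise fun x y => a x ≤ a y) (v : α) :
    (∃ z, l.head? = some z ∧ a z ≤ v) ↔ ∃ z ∈ l, a z ≤ v := by
  rcases l with _ | ⟨x, t⟩
  · simp
  · rw [List.pairwise_cons] at hl
    simp only [List.head?_cons, Option.some.injEq, exists_eq_left', List.mem_cons]
    constructor
    · exact fun h => ⟨x, Or.inl rfl, h⟩
    · rintro ⟨z, rfl | hz, h⟩
      · exact h
      · exact (hl.1 z hz).trans h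

/-- `f` will be the membership in the high side. Without a bound `m` it fails everywhere, in
accordance with the default that the whole list is counted. -/
theorem countBelow_spec (m : Option ι) {l : List ι} (hl : l.Pairwise fun x y => a x ≤ a y)
    (f : ι → Bool) (hf : ∀ x ∈ l, f x = true ↔ ∃ y, m = some y ∧ a y ≤ a x) :
    l.take ((countBelow m l).eval (leOf a)) = l.filter (fun x => !f x) ∧
    l.drop ((countBelow m l).eval (leOf a)) = l.filter f ∧
    ((countBelow m l).cost (leOf a) : ℝ) ≤ 2 * lg (1 + l.countP fun x => !f x) + 1 := by
  rcases m with _ | m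
  · have h : ∀ x ∈ l, f x = false := fun x hx => by
      have := hf x hx
      simpa using this
    refine ⟨?_, ?_, ?_⟩
    · rw [List.filter_eq_self.2 fun x hx => by simp [h x hx]]
      simp [countBelow]
    · rw [List.filter_eq_nil_iff.2 fun x hx => by simp [h x hx]]
      simp [countBelow]
    · have := lg_nonneg (1 + l.countP fun x => !f x)
      simp only [countBelow, Cmp.cost_pure]
      push_cast
      linarith
  · have h : ∀ x ∈ l, (!f x) = decide (a x < a m) := fun x hx => by
      have := hf x hx
      simp only [Option.some.injEq, exists_eq_left'] at this
      rw [Bool.eq_iff_iff, decide_eq_true_eq, ← not_le, ← this]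
      simp
    have h' : ∀ x ∈ l, f x = !decide (a x < a m) := fun x hx => by
      rw [← h x hx, Bool.not_not]
    obtain ⟨c, t, d⟩ := isCut_testAt (le := leOf a) (test := fun x => less x m) (l := l)
      (fun x => a x < a m) (fun x => less_eval a x m) (fun x => (less_cost _ x m).le)
      (hl.imp fun {x y} h h' => by simp only [decide_eq_true_eq] at *; exact h.trans_lt h')
    obtain ⟨e, k, i, s⟩ := doubling_spec c List.countP_le_length l.length 0 0 le_rfl (Nat.zero_le _)
    rw [List.filter_congr h, List.filter_congr h', List.countP_congr fun x hx => by rw [h x hx]]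
    refine ⟨?_, ?_, ?_⟩
    · rw [countBelow, e, t]
    · rw [countBelow, e, d]
    · have h1 := le_lg_of_two_pow_le (e := k) (x := 1 + l.countP fun x => a x < a m) (by omega)
      have h2 : ((countBelow (some m) l).cost (leOf a) : ℝ) ≤ 2 * k + 0 + 1 := by
        exact_mod_cast s
      linarith

/-- The search starts at the pivot and runs backwards, hence the reversed list and the truncation
from the right. -/
theorem countAbove_spec (m : Option ι) {l : List ι} (hl : l.Pairwise fun x y => a x ≤ a y)
    (f : ι → Bool) (hf : ∀ x ∈ l, f x = true ↔ ∃ y, m = some y ∧ a x ≤ a y) :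
    l.drop (l.length - (countAbove m l.reverse).eval (leOf a)) = l.filter (fun x => !f x) ∧
    l.take (l.length - (countAbove m l.reverse).eval (leOf a)) = l.filter f ∧
    ((countAbove m l.reverse).cost (leOf a) : ℝ) ≤ 2 * lg (1 + l.countP fun x => !f x) + 1 := by
  rcases m with _ | m
  · have h : ∀ x ∈ l, f x = false := fun x hx => by
      have := hf x hx
      simpa using this
    refine ⟨?_, ?_, ?_⟩
    · rw [List.filter_eq_self.2 fun x hx => by simp [h x hx]]
      simp [countAbove]
    · rw [List.filter_eq_nil_iff.2 fun x hx => by simp [h x hx]]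
      simp [countAbove]
    · have := lg_nonneg (1 + l.countP fun x => !f x)
      simp only [countAbove, Cmp.cost_pure]
      push_cast
      linarith
  · have h : ∀ x ∈ l, (!f x) = decide (a m < a x) := fun x hx => by
      have := hf x hx
      simp only [Option.some.injEq, exists_eq_left'] at this
      rw [Bool.eq_iff_iff, decide_eq_true_eq, ← not_le, ← this]
      simp
    have h' : ∀ x ∈ l, f x = !decide (a m < a x) := fun x hx => by
      rw [← h x hx, Bool.not_not]
    obtain ⟨c, t, d⟩ := isCut_testAt (le := leOf a) (test := fun x => less m x) (l := l.reverse)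
      (fun x => a m < a x) (fun x => less_eval a m x) (fun x => (less_cost _ m x).le)
      (List.pairwise_reverse.2 (hl.imp fun {x y} h h' => by
        simp only [decide_eq_true_eq] at *; exact h'.trans_le h))
    obtain ⟨e, k, i, s⟩ := doubling_spec c List.countP_le_length l.reverse.length 0 0 le_rfl
      (Nat.zero_le _)
    rw [List.filter_congr h, List.filter_congr h', List.countP_congr fun x hx => by rw [h x hx]]
    rw [List.take_reverse, List.filter_reverse] at t
    rw [List.drop_reverse, List.filter_reverse] at d
    refine ⟨?_, ?_, ?_⟩
    · rw [countAbove, e, List.reverse_injective t]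
    · rw [countAbove, e, List.reverse_injective d]
    · rw [List.countP_reverse] at i
      have h1 := le_lg_of_two_pow_le (e := k) (x := 1 + l.countP fun x => a m < a x) (by omega)
      have h2 : ((countAbove (some m) l.reverse).cost (leOf a) : ℝ) ≤ 2 * k + 0 + 1 := by
        exact_mod_cast s
      linarith

end Steps

/-! ### Splitting an instance by the pivot -/

section Split

variable {ι : Type} [Fintype ι] [DecidableEq ι] {α : Type*} [LinearOrder α]
  {a : ι → α} {R : ι → ℕ} {S : Finset ι} {μ : ι} {s t : List ι} {others : List (List ι)}

namespace Rep

theorem mem_before (h : Rep a R ((s ++ μ :: t) :: others) S) {x : ι} (hx : x ∈ s) :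
    x ∈ S ∧ a x ≤ a μ ∧ R x = R μ ∧ x ≠ μ := by
  have hr : s ++ μ :: t ∈ (s ++ μ :: t) :: others := List.mem_cons_self
  refine ⟨h.mem_of_mem hr (by simp [hx]),
    (List.pairwise_append.1 (h.sorted _ hr)).2.2 x hx μ (by simp),
    h.same _ hr _ (by simp [hx]) _ (by simp), ?_⟩
  exact (List.nodup_append.1 (h.run_nodup hr)).2.2 x hx μ (by simp)

theorem mem_after (h : Rep a R ((s ++ μ :: t) :: others) S) {x : ι} (hx : x ∈ t) :
    x ∈ S ∧ a μ ≤ a x ∧ R x = R μ ∧ x ≠ μ := by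
  have hr : s ++ μ :: t ∈ (s ++ μ :: t) :: others := List.mem_cons_self
  refine ⟨h.mem_of_mem hr (by simp [hx]),
    (List.pairwise_cons.1 (List.pairwise_append.1 (h.sorted _ hr)).2.1).1 x hx,
    h.same _ hr _ (by simp [hx]) _ (by simp), ?_⟩
  rintro rfl
  exact (List.nodup_cons.1 (List.nodup_append.1 (h.run_nodup hr)).2.1).1 hx

theorem mem_others (h : Rep a R ((s ++ μ :: t) :: others) S) {x : ι} :
    (∃ r ∈ others, x ∈ r) ↔ x ∈ S ∧ R x ≠ R μ := by
  constructor
  · rintro ⟨r, hr, hx⟩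
    exact ⟨h.mem_of_mem (List.mem_cons_of_mem _ hr) hx,
      ((List.pairwise_cons.1 h.diff).1 r hr μ (by simp) x hx).symm⟩
  · rintro ⟨hx, hR⟩
    obtain ⟨r, hr, hxr⟩ := List.mem_flatten.1 ((h.mem x).2 hx)
    rcases List.mem_cons.1 hr with rfl | hr
    · exact absurd (h.same _ List.mem_cons_self x hxr μ (by simp)) hR
    · exact ⟨r, hr, hxr⟩

theorem sorted_filter (h : Rep a R ((s ++ μ :: t) :: others) S) {r : List ι} (hr : r ∈ others)
    (f : ι → Bool) : (r.filter f).Pairwise fun x y => a x ≤ a y :=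
  (h.sorted r (List.mem_cons_of_mem _ hr)).sublist List.filter_sublist

/-- The greatest smaller elements of the other runs are the last entries of their filtered lists, so
being bounded by their maximum is being bounded by some smaller foreign element. -/
theorem mem_lowSide_iff (h : Rep a R ((s ++ μ :: t) :: others) S) {x : ι} (hx : x ∈ S) :
    x ∈ lowSide a R S μ ↔ ∃ y, (maxC (others.filterMap fun r =>
      (r.filter fun x => a x < a μ).getLast?)).eval (leOf a) = some y ∧ a x ≤ a y := by
  rw [(maxC_spec a _).1, mem_lowSide]
  constructor
  · rintro ⟨_, z, hz, hR, h1, h2⟩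
    obtain ⟨r, hr, hzr⟩ := h.mem_others.2 ⟨hz, hR⟩
    obtain ⟨y, hy, hxy⟩ := (getLast?_max a (h.sorted_filter hr fun x => a x < a μ) (a x)).2
      ⟨z, List.mem_filter.2 ⟨hzr, by simpa using h1⟩, h2⟩
    exact ⟨y, List.mem_filterMap.2 ⟨r, hr, hy⟩, hxy⟩
  · rintro ⟨y, hy, hxy⟩
    obtain ⟨r, hr, hyr⟩ := List.mem_filterMap.1 hy
    obtain ⟨hyr, h1⟩ := List.mem_filter.1 (List.mem_of_getLast? hyr)
    obtain ⟨h2, h3⟩ := h.mem_others.1 ⟨r, hr, hyr⟩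
    exact ⟨hx, y, h2, h3, by simpa using h1, hxy⟩

theorem mem_highSide_iff (h : Rep a R ((s ++ μ :: t) :: others) S) {x : ι} (hx : x ∈ S) :
    x ∈ highSide a R S μ ↔ ∃ y, (minC (others.filterMap fun r =>
      (r.filter fun x => a μ < a x).head?)).eval (leOf a) = some y ∧ a y ≤ a x := by
  rw [(minC_spec a _).1, mem_highSide]
  constructor
  · rintro ⟨_, z, hz, hR, h1, h2⟩
    obtain ⟨r, hr, hzr⟩ := h.mem_others.2 ⟨hz, hR⟩
    obtain ⟨y, hy, hxy⟩ := (head?_min a (h.sorted_filter hr fun x => a μ < a x) (a x)).2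
      ⟨z, List.mem_filter.2 ⟨hzr, by simpa using h1⟩, h2⟩
    exact ⟨y, List.mem_filterMap.2 ⟨r, hr, hy⟩, hxy⟩
  · rintro ⟨y, hy, hxy⟩
    obtain ⟨r, hr, hyr⟩ := List.mem_filterMap.1 hy
    obtain ⟨hyr, h1⟩ := List.mem_filter.1 (List.mem_of_head? hyr)
    obtain ⟨h2, h3⟩ := h.mem_others.1 ⟨r, hr, hyr⟩
    exact ⟨hx, y, h2, h3, by simpa using h1, hxy⟩

theorem mem_sides_of_mem_others (h : Rep a R ((s ++ μ :: t) :: others) S) {r : List ι}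
    (hr : r ∈ others) {x : ι} (hx : x ∈ r) :
    (x ∈ lowSide a R S μ ↔ a x < a μ) ∧ (x ∈ highSide a R S μ ↔ a μ < a x) ∧
      (x ∈ middle a R S μ ↔ a x = a μ) := by
  obtain ⟨h1, h2⟩ := h.mem_others.1 ⟨r, hr, hx⟩
  have h3 : x ∈ lowSide a R S μ ↔ a x < a μ := ⟨lowSide_lt, mem_lowSide_of_ne h1 h2⟩
  have h4 : x ∈ highSide a R S μ ↔ a μ < a x := ⟨lt_highSide, mem_highSide_of_ne h1 h2⟩
  refine ⟨h3, h4, ?_⟩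
  rw [mem_middle, h3, h4, not_lt, not_lt]
  exact ⟨fun h => le_antisymm h.2.2 h.2.1, fun h => ⟨h1, h.ge, h.le⟩⟩

theorem pivot_mem (h : Rep a R ((s ++ μ :: t) :: others) S) : μ ∈ S :=
  h.mem_of_mem List.mem_cons_self (by simp)

/-- The sub-instance of the smaller elements. -/
theorem left (h : Rep a R ((s ++ μ :: t) :: others) S) :
    Rep a R (((s.filter fun x => x ∈ lowSide a R S μ) ::
      others.map fun r => r.filter fun x => a x < a μ).filter fun r => !r.isEmpty)
      (lowSide a R S μ) := by
  have := h.restrict (lowSide_subset (a := a) (R := R) (S := S) (μ := μ))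
  have h1 : t.filter (fun x => x ∈ lowSide a R S μ) = [] :=
    List.filter_eq_nil_iff.2 fun x hx => by
      simpa using fun hx' => (lowSide_lt hx').not_ge (h.mem_after hx).2.1
  have h2 : μ ∉ lowSide a R S μ := fun hμ => lt_irrefl _ (lowSide_lt hμ)
  have h3 : others.map (fun r => r.filter fun x => x ∈ lowSide a R S μ) =
      others.map fun r => r.filter fun x => a x < a μ :=
    List.map_congr_left fun r hr => List.filter_congr fun x hx => by
      simp only [(h.mem_sides_of_mem_others hr hx).1]
  have h4 : (s ++ μ :: t).filter (fun x => x ∈ lowSide a R S μ) =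
      s.filter fun x => x ∈ lowSide a R S μ := by
    rw [List.filter_append, List.filter_cons, h1, if_neg (by simpa using h2), List.append_nil]
  rwa [List.map_cons, h3, h4] at this

/-- The sub-instance of the greater elements. -/
theorem right (h : Rep a R ((s ++ μ :: t) :: others) S) :
    Rep a R (((t.filter fun x => x ∈ highSide a R S μ) ::
      others.map fun r => r.filter fun x => a μ < a x).filter fun r => !r.isEmpty)
      (highSide a R S μ) := by
  have := h.restrict (highSide_subset (a := a) (R := R) (S := S) (μ := μ))
  have h1 : s.filter (fun x => x ∈ highSide a R S μ) = [] :=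
    List.filter_eq_nil_iff.2 fun x hx => by
      simpa using fun hx' => (lt_highSide hx').not_ge (h.mem_before hx).2.1
  have h2 : μ ∉ highSide a R S μ := fun hμ => lt_irrefl _ (lt_highSide hμ)
  have h3 : others.map (fun r => r.filter fun x => x ∈ highSide a R S μ) =
      others.map fun r => r.filter fun x => a μ < a x :=
    List.map_congr_left fun r hr => List.filter_congr fun x hx => by
      simp only [(h.mem_sides_of_mem_others hr hx).2.1]
  have h4 : (s ++ μ :: t).filter (fun x => x ∈ highSide a R S μ) =
      t.filter fun x => x ∈ highSide a R S μ := by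
    rw [List.filter_append, List.filter_cons, h1, if_neg (by simpa using h2), List.nil_append]
  rwa [List.map_cons, h3, h4] at this

variable (a R S s t others μ) in
/-- The elements whose ranks become known, in sorted order. -/
def midList : List ι := (s.filter fun x => !decide (x ∈ lowSide a R S μ)) ++
  μ :: (others.map fun r => r.filter fun x => a x = a μ).flatten ++
  t.filter fun x => !decide (x ∈ highSide a R S μ)

/-- Before the pivot nothing is in the high side and after it nothing in the low side; in other runs
only the copies of the pivot value are middle elements. Only the order differs. -/
theorem midList_perm (h : Rep a R ((s ++ μ :: t) :: others) S) :
    (midList a R S μ s t others).Perm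
      ((((s ++ μ :: t) :: others).flatten).filter fun x => x ∈ middle a R S μ) := by
  have e1 : s.filter (fun x => x ∈ middle a R S μ) =
      s.filter fun x => !decide (x ∈ lowSide a R S μ) := by
    refine List.filter_congr fun x hx => ?_
    obtain ⟨h1, h2, _⟩ := h.mem_before hx
    have : x ∉ highSide a R S μ := fun h' => (lt_highSide h').not_ge h2
    simp [mem_middle, h1, this]
  have e2 : t.filter (fun x => x ∈ middle a R S μ) =
      t.filter fun x => !decide (x ∈ highSide a R S μ) := by
    refine List.filter_congr fun x hx => ?_
    obtain ⟨h1, h2, _⟩ := h.mem_after hx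
    have : x ∉ lowSide a R S μ := fun h' => (lowSide_lt h').not_ge h2
    simp [mem_middle, h1, this]
  have e3 : (others.map fun r => r.filter fun x => a x = a μ).flatten =
      others.flatten.filter fun x => x ∈ middle a R S μ := by
    rw [List.filter_flatten]
    congr 1
    refine List.map_congr_left fun r hr => List.filter_congr fun x hx => ?_
    simp only [(h.mem_sides_of_mem_others hr hx).2.2]
  rw [midList, e3, List.flatten_cons, List.filter_append, List.filter_append, List.filter_cons,
    if_pos (by simpa using QSMS.pivot_mem_middle h.pivot_mem), e1, e2, List.append_assoc,
    List.append_assoc]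
  refine List.Perm.append_left _ ?_
  rw [List.cons_append, List.cons_append]
  exact List.Perm.cons _ List.perm_append_comm

theorem midList_nodup (h : Rep a R ((s ++ μ :: t) :: others) S) :
    (midList a R S μ s t others).Nodup :=
  h.midList_perm.nodup_iff.2 (h.nodup.filter _)

theorem mem_midList (h : Rep a R ((s ++ μ :: t) :: others) S) {x : ι} :
    x ∈ midList a R S μ s t others ↔ x ∈ middle a R S μ := by
  rw [h.midList_perm.mem_iff, List.mem_filter, h.mem, decide_eq_true_eq]
  exact ⟨fun h => h.2, fun h => ⟨(mem_middle.1 h).1, h⟩⟩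

theorem midList_sorted (h : Rep a R ((s ++ μ :: t) :: others) S) :
    (midList a R S μ s t others).Pairwise fun x y => a x ≤ a y := by
  have hr := h.sorted _ List.mem_cons_self
  rw [List.pairwise_append, List.pairwise_cons] at hr
  have he : ∀ x ∈ (others.map fun r => r.filter fun x => a x = a μ).flatten, a x = a μ := by
    intro x hx
    obtain ⟨r', hr', hx⟩ := List.mem_flatten.1 hx
    obtain ⟨r, _, rfl⟩ := List.mem_map.1 hr'
    simpa using (List.mem_filter.1 hx).2
  have hs : ∀ x ∈ s.filter fun x => !decide (x ∈ lowSide a R S μ), a x ≤ a μ :=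
    fun x hx => (h.mem_before (List.mem_filter.1 hx).1).2.1
  have ht : ∀ x ∈ t.filter fun x => !decide (x ∈ highSide a R S μ), a μ ≤ a x :=
    fun x hx => (h.mem_after (List.mem_filter.1 hx).1).2.1
  have hμ : ∀ x ∈ μ :: (others.map fun r => r.filter fun x => a x = a μ).flatten, a x = a μ := by
    intro x hx
    rcases List.mem_cons.1 hx with rfl | hx
    · rfl
    · exact he x hx
  rw [midList, List.pairwise_append, List.pairwise_append]
  refine ⟨⟨hr.1.sublist List.filter_sublist, ?_, fun x hx y hy => ?_⟩,
    hr.2.1.2.sublist List.filter_sublist, fun x hx y hy => ?_⟩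
  · exact List.pairwise_of_forall_mem_list fun x hx y hy => by rw [hμ x hx, hμ y hy]
  · rw [hμ y hy]
    exact hs x hx
  · refine le_trans ?_ (ht y hy)
    rcases List.mem_append.1 hx with hx | hx
    · exact hs x hx
    · exact (hμ x hx).le

theorem countP_before_le (h : Rep a R ((s ++ μ :: t) :: others) S) :
    s.countP (fun x => !decide (x ∈ lowSide a R S μ)) ≤ (PivotTree.middleRun a R S μ).card := by
  have hn : s.Nodup := (List.nodup_append.1 (h.run_nodup List.mem_cons_self)).1
  have := countP_eq_card_filter hn fun x => x ∉ lowSide a R S μ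
  simp only [decide_not] at this
  rw [this]
  refine Finset.card_le_card fun x hx => ?_
  rw [Finset.mem_filter, List.mem_toFinset] at hx
  obtain ⟨h1, h2, h3, _⟩ := h.mem_before hx.1
  exact Finset.mem_filter.2 ⟨mem_middle.2 ⟨h1, hx.2, fun h' => (lt_highSide h').not_ge h2⟩, h3⟩

theorem countP_after_le (h : Rep a R ((s ++ μ :: t) :: others) S) :
    t.countP (fun x => !decide (x ∈ highSide a R S μ)) ≤ (PivotTree.middleRun a R S μ).card := by
  have hn : t.Nodup :=
    (List.nodup_cons.1 (List.nodup_append.1 (h.run_nodup List.mem_cons_self)).2.1).2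
  have := countP_eq_card_filter hn fun x => x ∉ highSide a R S μ
  simp only [decide_not] at this
  rw [this]
  refine Finset.card_le_card fun x hx => ?_
  rw [Finset.mem_filter, List.mem_toFinset] at hx
  obtain ⟨h1, h2, h3, _⟩ := h.mem_after hx.1
  exact Finset.mem_filter.2 ⟨mem_middle.2 ⟨h1, fun h' => (lowSide_lt h').not_ge h2, hx.2⟩, h3⟩

/-- The costs in the lists are translated into those over run indices; runs that are absent from `S`
only add nonnegative terms. -/
theorem sum_search_le (h : Rep a R ((s ++ μ :: t) :: others) S) :
    (others.map fun r =>
      (lg (1 + min (r.countP fun x => a x < a μ) (r.countP fun x => a μ ≤ a x)) +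
        lg (1 + min (r.countP fun x => a x ≤ a μ) (r.countP fun x => a μ < a x)))).sum +
      2 * lg (1 + (PivotTree.middleRun a R S μ).card) ≤ PivotTree.searchNode a R S μ := by
  rw [PivotTree.searchNode]
  refine add_le_add_left (le_trans (le_of_eq ?_) (h.sum_keys_le (l := others)
    (List.sublist_cons_self _ _) (fun k =>
      lg (1 + min (PivotTree.runFilter a R S k (· < a μ)) (PivotTree.runFilter a R S k (a μ ≤ ·))) +
      lg (1 + min (PivotTree.runFilter a R S k (· ≤ a μ)) (PivotTree.runFilter a R S k (a μ < ·))))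
    (fun k => add_nonneg (lg_nonneg _) (lg_nonneg _)) _ ?_)) _
  · congr 1
    refine List.map_congr_left fun r hr => ?_
    have hr' := List.mem_cons_of_mem (s ++ μ :: t) hr
    rw [h.countP_eq_runFilter hr' (· < a μ), h.countP_eq_runFilter hr' (a μ ≤ ·),
      h.countP_eq_runFilter hr' (· ≤ a μ), h.countP_eq_runFilter hr' (a μ < ·)]
  · intro r hr
    obtain ⟨x, hx, e⟩ := h.exists_mem (List.mem_cons_of_mem _ hr)
    rw [e]
    exact Finset.mem_erase.2 ⟨(h.mem_others.1 ⟨r, hr, hx⟩).2,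
      Finset.mem_image_of_mem _ (Finset.mem_univ _)⟩

end Rep

end Split

/-! ### The recursion -/

section Recursion

variable {ι : Type} [Fintype ι] [DecidableEq ι] {α : Type*} [LinearOrder α]
  {a : ι → α} {R : ι → ℕ}

/-- Runs are determined by their keys, so only one contains the pivot and the flattening in the
algorithm is harmless. -/
theorem Rep.filter_mem_eq {runs : List (List ι)} {S : Finset ι} (h : Rep a R runs S)
    {r : List ι} (hr : r ∈ runs) {μ : ι} (hμ : μ ∈ r) : (runs.filter fun s => μ ∈ s) = [r] := by
  have h1 : ∀ s ∈ runs.filter (fun s => μ ∈ s), s = r := by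
    intro s hs
    obtain ⟨hs, hμs⟩ := List.mem_filter.1 hs
    exact List.inj_on_of_nodup_map h.nodup_keys hs hr
      ((h.key_eq hs (by simpa using hμs)).trans (h.key_eq hr hμ).symm)
  have h2 : r ∈ runs.filter (fun s => μ ∈ s) := List.mem_filter.2 ⟨hr, by simpa using hμ⟩
  have h3 : (runs.filter fun s => μ ∈ s).Nodup := (List.Nodup.of_map _ h.nodup_keys).filter _
  generalize runs.filter (fun s => μ ∈ s) = l at h1 h2 h3
  match l with
  | [] => simp at h2
  | [x] => rw [h1 x (by simp)]
  | x :: y :: l =>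
    rw [h1 x (by simp), h1 y (by simp)] at h3
    simp at h3

/-- The run of the pivot is written as s ++ μ :: t, so that the two searched parts are `s` and `t`.
Per run the cost is 150 for the median, 4 for the additive terms of the splitting searches, and 2
for the maximum and minimum; the slack up to 158 absorbs the constants of the last two searches. The
logarithms have a factor of at most 3. -/
theorem multiSelectRuns_succ {runs : List (List ι)} {S : Finset ι} (h : Rep a R runs S)
    (hS : S.Nonempty) (fuel : ℕ) {Q : List ℕ} (hQ : Q ≠ []) :
    ∃ μ ∈ S, ∃ (left right : List (List ι)) (mid : List ι),
      runCount R S ≤ 2 * ((S.image R).filter fun k =>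
        (runPart R S k).card ≤ 2 * ((runPart R S k).filter fun p => a p ≤ a μ).card).card ∧
      runCount R S ≤ 2 * ((S.image R).filter fun k =>
        (runPart R S k).card ≤ 2 * ((runPart R S k).filter fun p => a μ ≤ a p).card).card ∧
      Rep a R left (lowSide a R S μ) ∧ Rep a R right (highSide a R S μ) ∧
      mid.Pairwise (fun x y => a x ≤ a y) ∧ mid.Nodup ∧ (∀ x, x ∈ mid ↔ x ∈ middle a R S μ) ∧
      ∃ outl outr : Cmp ι (Output ι),
      outl = multiSelectRuns fuel left (Q.filter fun k => k ≤ (lowSide a R S μ).card) ∧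
      outr = multiSelectRuns fuel right ((Q.filter fun k =>
        (lowSide a R S μ).card + mid.length < k).map fun k =>
          k - ((lowSide a R S μ).card + mid.length)) ∧
      (multiSelectRuns (fuel + 1) runs Q).eval (leOf a) = ⟨fun k =>
        if k ≤ (lowSide a R S μ).card then (outl.eval (leOf a)).answer k
        else if k ≤ (lowSide a R S μ).card + mid.length then mid[k - (lowSide a R S μ).card - 1]?
        else (outr.eval (leOf a)).answer (k - ((lowSide a R S μ).card + mid.length)),
        (outl.eval (leOf a)).pivots ++ μ :: (outr.eval (leOf a)).pivots⟩ ∧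
      ((multiSelectRuns (fuel + 1) runs Q).cost (leOf a) : ℝ) ≤
        158 * runCount R S + 3 * PivotTree.searchNode a R S μ +
          outl.cost (leOf a) + outr.cost (leOf a) := by
  obtain ⟨μ, hμ, m1, m2, half1, half2⟩ := h.medianOfMiddles hS
  obtain ⟨rj, hrj, hμr⟩ := List.mem_flatten.1 ((h.mem μ).2 hμ)
  have f1 := h.filter_mem_eq hrj hμr
  obtain ⟨s, t, rfl, hs⟩ := List.eq_append_cons_of_mem hμr
  set others := runs.filter fun r => μ ∉ r with ho
  have h' : Rep a R ((s ++ μ :: t) :: others) S := by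
    refine h.perm ((List.filter_append_perm (fun r => decide (μ ∈ r)) runs).symm.trans ?_)
    rw [f1, ho]
    simp
  have f2 : ([s ++ μ :: t] : List (List ι)).flatten = s ++ μ :: t := by simp
  have f3 : (s ++ μ :: t).idxOf μ = s.length := by
    rw [List.idxOf_append_of_notMem hs]
    simp
  have f4 : (s ++ μ :: t).take s.length = s := by simp
  have f5 : (s ++ μ :: t).drop (s.length + 1) = t := by simp
  obtain ⟨p1, p2⟩ := splitRuns_spec a μ others fun r hr => h'.sorted r (List.mem_cons_of_mem _ hr)
  have hss : s.Pairwise fun x y => a x ≤ a y :=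
    (List.pairwise_append.1 (h'.sorted _ List.mem_cons_self)).1
  have hts : t.Pairwise fun x y => a x ≤ a y :=
    (List.pairwise_cons.1 (List.pairwise_append.1 (h'.sorted _ List.mem_cons_self)).2.1).2
  have g1 := (maxC_spec a (others.filterMap fun r => (r.filter fun x => a x < a μ).getLast?)).2
  have g2 := (minC_spec a (others.filterMap fun r => (r.filter fun x => a μ < a x).head?)).2
  obtain ⟨b1, b2, b3⟩ := countAbove_spec a _ hss (fun x => x ∈ lowSide a R S μ) fun x hx =>
    decide_eq_true_iff.trans (h'.mem_lowSide_iff (h'.mem_before hx).1)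
  obtain ⟨c1, c2, c3⟩ := countBelow_spec a _ hts (fun x => x ∈ highSide a R S μ) fun x hx =>
    decide_eq_true_iff.trans (h'.mem_highSide_iff (h'.mem_after hx).1)
  have hlen := h'.left.length_flatten
  have e : others.length + 1 = runCount R S := h'.length_eq
  refine ⟨μ, hμ, _, _, _, half1, half2, h'.left, h'.right, h'.midList_sorted, h'.midList_nodup,
    fun x => h'.mem_midList, _, _, rfl, rfl, ?_, ?_⟩
  · rw [multiSelectRuns, if_neg (by simpa using hQ)]
    simp only [Cmp.eval_bind, Cmp.eval_pure, m1, f1, f2, f3, f4, f5, ← ho, p1, List.filterMap_map,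
      List.map_map, Function.comp_def, b1, b2, c1, c2, hlen]
    rfl
  · have k1 := lg_mono (Nat.add_le_add_left h'.countP_before_le 1)
    have k2 := lg_mono (Nat.add_le_add_left h'.countP_after_le 1)
    have k3 := h'.sum_search_le
    have k4 : ((maxC (others.filterMap fun r => (r.filter fun x => a x < a μ).getLast?)).cost
        (leOf a) : ℝ) ≤ others.length := by
      exact_mod_cast g1.trans (List.length_filterMap_le _ _)
    have k5 : ((minC (others.filterMap fun r => (r.filter fun x => a μ < a x).head?)).cost
        (leOf a) : ℝ) ≤ others.length := by
      exact_mod_cast g2.trans (List.length_filterMap_le _ _)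
    have k6 : ((medianOfMiddles runs).cost (leOf a) : ℝ) ≤ 150 * runCount R S := by
      exact_mod_cast m2
    have k7 : (others.length : ℝ) + 1 = runCount R S := by exact_mod_cast e
    have k8 := lg_nonneg (1 + (PivotTree.middleRun a R S μ).card)
    rw [multiSelectRuns, if_neg (by simpa using hQ)]
    simp only [Cmp.cost_bind, Cmp.cost_pure, m1, f1, f2, f3, f4, f5, ← ho, p1, List.filterMap_map,
      List.map_map, Function.comp_def, b1, b2, c1, c2, hlen]
    push_cast
    unfold Rep.midList
    linarith

end Recursion

/-! ### Ranks in sub-instances and correctness of the recursion -/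

section Ranks

variable {ι : Type} [Fintype ι] [DecidableEq ι] {α : Type*} [LinearOrder α]
  {a : ι → α} {R : ι → ℕ} {S : Finset ι} {μ p : ι}

variable (a) in
/-- `p` is an element of rank `k` in `S`. -/
def RankIn (S : Finset ι) (k : ℕ) (p : ι) : Prop :=
  p ∈ S ∧ (S.filter fun t => a t < a p).card < k ∧ k ≤ (S.filter fun t => a t ≤ a p).card

theorem rankIn_of_isKth {l : List ι} (hl : l.Nodup) (hS : ∀ x, x ∈ l ↔ x ∈ S) {k : ℕ}
    (hp : p ∈ l) (h : IsKth a l k p) : RankIn a S (k + 1) p := by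
  have e : l.toFinset = S := by ext x; rw [List.mem_toFinset, hS]
  obtain ⟨h1, h2⟩ := h
  rw [countP_eq_card_filter hl, e] at h1 h2
  exact ⟨(hS p).1 hp, Nat.lt_succ_of_le h1, h2⟩

theorem exists_rankIn {k : ℕ} (h1 : 1 ≤ k) (h2 : k ≤ S.card) : ∃ p, RankIn a S k p := by
  obtain ⟨p, _, hp, h⟩ := sortC_isKth a S.toList (k := k - 1) (by rw [Finset.length_toList]; omega)
  have := rankIn_of_isKth S.nodup_toList (fun x => Finset.mem_toList) hp h
  rw [Nat.sub_add_cancel h1] at this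
  exact ⟨p, this⟩

theorem card_filter_parts (f : ι → Prop) [DecidablePred f] : (S.filter f).card =
    ((lowSide a R S μ).filter f).card + ((middle a R S μ).filter f).card +
      ((highSide a R S μ).filter f).card := by
  rw [← Finset.card_union_of_disjoint, ← Finset.card_union_of_disjoint]
  · congr 1
    ext x
    simp only [Finset.mem_union, Finset.mem_filter, mem_middle]
    have h1 := @lowSide_subset _ _ _ _ _ a R S μ x
    have h2 := @highSide_subset _ _ _ _ _ a R S μ x
    tauto
  · rw [← Finset.filter_union]
    refine Finset.disjoint_filter_filter (Finset.disjoint_left.2 fun x hx hx' => ?_)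
    rcases Finset.mem_union.1 hx with h | h
    · exact Finset.disjoint_left.1 disjoint_lowSide_highSide h hx'
    · exact (mem_middle.1 h).2.2 hx'
  · exact Finset.disjoint_filter_filter
      (Finset.disjoint_left.2 fun x hx hx' => (mem_middle.1 hx').2.1 hx)

theorem card_parts : S.card = (lowSide a R S μ).card + (middle a R S μ).card +
    (highSide a R S μ).card := by
  simpa using card_filter_parts (a := a) (R := R) (S := S) (μ := μ) fun _ => True

theorem lowSide_lt_middle {x : ι} (hp : p ∈ lowSide a R S μ) (hx : x ∈ middle a R S μ) :
    a p < a x := lt_of_mem_lowSide hp (mem_middle.1 hx).1 (mem_middle.1 hx).2.1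

theorem middle_lt_highSide {x : ι} (hx : x ∈ middle a R S μ) (hp : p ∈ highSide a R S μ) :
    a x < a p := lt_of_mem_highSide hp (mem_middle.1 hx).1 (mem_middle.1 hx).2.2

theorem lowSide_lt_highSide {x : ι} (hp : p ∈ lowSide a R S μ) (hx : x ∈ highSide a R S μ) :
    a p < a x := (lowSide_lt hp).trans (lt_highSide hx)

theorem card_filter_of_forall {κ : Type*} {s : Finset κ} {f : κ → Prop} [DecidablePred f]
    (h : ∀ x ∈ s, f x) : (s.filter f).card = s.card := by
  rw [Finset.filter_true_of_mem h]

theorem card_filter_of_forall_not {κ : Type*} {s : Finset κ} {f : κ → Prop} [DecidablePred f]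
    (h : ∀ x ∈ s, ¬ f x) : (s.filter f).card = 0 := by
  rw [Finset.filter_false_of_mem h, Finset.card_empty]

/-- The three parts are ordered by value, so for an element of one part the other parts are counted
completely or not at all. -/
theorem rankIn_lowSide (hp : p ∈ lowSide a R S μ) {k : ℕ} :
    RankIn a S k p ↔ RankIn a (lowSide a R S μ) k p := by
  have h1 := fun x (hx : x ∈ middle a R S μ) => lowSide_lt_middle hp hx
  have h2 := fun x (hx : x ∈ highSide a R S μ) => lowSide_lt_highSide hp hx
  unfold RankIn
  rw [card_filter_parts (a := a) (R := R) (μ := μ) (fun t => a t < a p),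
    card_filter_parts (a := a) (R := R) (μ := μ) (fun t => a t ≤ a p),
    card_filter_of_forall_not fun x hx => (h1 x hx).le.not_gt,
    card_filter_of_forall_not fun x hx => (h2 x hx).le.not_gt,
    card_filter_of_forall_not fun x hx => (h1 x hx).not_ge,
    card_filter_of_forall_not fun x hx => (h2 x hx).not_ge]
  simp only [hp, lowSide_subset hp, add_zero]

theorem rankIn_middle (hp : p ∈ middle a R S μ) {k : ℕ}
    (h : RankIn a (middle a R S μ) k p) : RankIn a S ((lowSide a R S μ).card + k) p := by
  have h1 := fun x (hx : x ∈ lowSide a R S μ) => lowSide_lt_middle hx hp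
  have h2 := fun x (hx : x ∈ highSide a R S μ) => middle_lt_highSide hp hx
  obtain ⟨_, h3, h4⟩ := h
  unfold RankIn
  rw [card_filter_parts (a := a) (R := R) (μ := μ) (fun t => a t < a p),
    card_filter_parts (a := a) (R := R) (μ := μ) (fun t => a t ≤ a p),
    card_filter_of_forall h1, card_filter_of_forall fun x hx => (h1 x hx).le,
    card_filter_of_forall_not fun x hx => (h2 x hx).le.not_gt,
    card_filter_of_forall_not fun x hx => (h2 x hx).not_ge]
  exact ⟨(mem_middle.1 hp).1, by omega, by omega⟩

theorem rankIn_highSide (hp : p ∈ highSide a R S μ) {k : ℕ} : RankIn a S k p ↔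
    (lowSide a R S μ).card + (middle a R S μ).card < k ∧
      RankIn a (highSide a R S μ) (k - ((lowSide a R S μ).card + (middle a R S μ).card)) p := by
  have h1 := fun x (hx : x ∈ lowSide a R S μ) => lowSide_lt_highSide hx hp
  have h2 := fun x (hx : x ∈ middle a R S μ) => middle_lt_highSide hx hp
  unfold RankIn
  rw [card_filter_parts (a := a) (R := R) (μ := μ) (fun t => a t < a p),
    card_filter_parts (a := a) (R := R) (μ := μ) (fun t => a t ≤ a p),
    card_filter_of_forall h1, card_filter_of_forall fun x hx => (h1 x hx).le,
    card_filter_of_forall h2, card_filter_of_forall fun x hx => (h2 x hx).le]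
  simp only [hp, highSide_subset hp, true_and]
  omega

/-- The recursion follows a recursion tree, answers the queries correctly, and its cost is linear in
the sums of the numbers of runs and of the search costs over the nodes. -/
theorem multiSelectRuns_spec {Y : Finset α} (fuel : ℕ) : ∀ (runs : List (List ι)) (S : Finset ι)
    (Q : List ℕ), Rep a R runs S → S.card ≤ fuel → (∀ k ∈ Q, 1 ≤ k ∧ k ≤ S.card) →
    (∀ p ∈ S, a p ∈ Y ↔ ∃ k ∈ Q, RankIn a S k p) →
    ∃ T : PivotTree ι, T.Valid a R Y S ∧
      ((multiSelectRuns fuel runs Q).eval (leOf a)).pivots = T.pivots ∧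
      ((multiSelectRuns fuel runs Q).cost (leOf a) : ℝ) ≤
        158 * T.runSum a R S + 3 * T.searchSum a R S ∧
      ∀ k ∈ Q, ∃ p, ((multiSelectRuns fuel runs Q).eval (leOf a)).answer k = some p ∧
        RankIn a S k p := by
  induction fuel with
  | zero =>
    intro runs S Q _ hc hQ _
    have hQ' : ∀ k, k ∉ Q := fun k hk => by have := hQ k hk; omega
    have hS : S = ∅ := Finset.card_eq_zero.1 (Nat.le_zero.1 hc)
    refine ⟨.leaf, fun p hp => by simp [hS] at hp, rfl, ?_, fun k hk => absurd hk (hQ' k)⟩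
    simp [multiSelectRuns, PivotTree.runSum, PivotTree.searchSum, PivotTree.sum]
  | succ fuel ih =>
    intro runs S Q h hc hQ hY
    rcases eq_or_ne Q [] with rfl | hQne
    · refine ⟨.leaf, fun p hp h' => by simpa using (hY p hp).1 h', ?_, ?_, by simp⟩
      · simp [multiSelectRuns, PivotTree.pivots]
      · simp [multiSelectRuns, PivotTree.runSum, PivotTree.searchSum, PivotTree.sum]
    obtain ⟨k₀, hk₀⟩ := List.exists_mem_of_ne_nil Q hQne
    obtain ⟨p₀, hp₀⟩ := exists_rankIn (a := a) (hQ k₀ hk₀).1 (hQ k₀ hk₀).2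
    obtain ⟨μ, hμ, left, right, mid, half1, half2, hl, hr, m1, m2, m3, outl, outr, rfl, rfl, he,
      hcost⟩ := multiSelectRuns_succ h ⟨p₀, hp₀.1⟩ fuel hQne
    have hmid : mid.length = (middle a R S μ).card := by
      rw [← List.toFinset_card_of_nodup m2]
      congr 1
      ext x
      rw [List.mem_toFinset, m3]
    have hparts := card_parts (a := a) (R := R) (S := S) (μ := μ)
    -- The pivot is in the middle, so both sides are strictly smaller than `S` and the fuel
    -- suffices.
    have hmpos : 0 < (middle a R S μ).card :=
      Finset.card_pos.2 ⟨μ, pivot_mem_middle hμ⟩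
    rw [hmid] at he hcost
    obtain ⟨Tl, vl, pl, cl, al⟩ := ih left (lowSide a R S μ)
      (Q.filter fun k => k ≤ (lowSide a R S μ).card) hl (by omega)
      (fun k hk => by
        have := hQ k (List.mem_filter.1 hk).1
        have := (List.mem_filter.1 hk).2
        simp only [decide_eq_true_eq] at this
        omega)
      (fun p hp => by
        rw [hY p (lowSide_subset hp)]
        refine ⟨fun ⟨k, hk, h⟩ => ?_, fun ⟨k, hk, h⟩ =>
          ⟨k, (List.mem_filter.1 hk).1, (rankIn_lowSide hp).2 h⟩⟩
        have h := (rankIn_lowSide hp).1 h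
        refine ⟨k, List.mem_filter.2 ⟨hk, ?_⟩, h⟩
        simpa using h.2.2.trans (Finset.card_le_card (Finset.filter_subset _ _)))
    obtain ⟨Tr, vr, pr, cr, ar⟩ := ih right (highSide a R S μ)
      ((Q.filter fun k => (lowSide a R S μ).card + (middle a R S μ).card < k).map fun k =>
        k - ((lowSide a R S μ).card + (middle a R S μ).card)) hr (by omega)
      (fun k hk => by
        obtain ⟨j, hj, rfl⟩ := List.mem_map.1 hk
        have := hQ j (List.mem_filter.1 hj).1
        have := (List.mem_filter.1 hj).2
        simp only [decide_eq_true_eq] at this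
        omega)
      (fun p hp => by
        rw [hY p (highSide_subset hp)]
        constructor
        · rintro ⟨k, hk, h⟩
          obtain ⟨h1, h2⟩ := (rankIn_highSide hp).1 h
          exact ⟨_, List.mem_map.2 ⟨k, List.mem_filter.2 ⟨hk, by simpa using h1⟩, rfl⟩, h2⟩
        · rintro ⟨k, hk, h⟩
          obtain ⟨j, hj, rfl⟩ := List.mem_map.1 hk
          obtain ⟨hj, h1⟩ := List.mem_filter.1 hj
          exact ⟨j, hj, (rankIn_highSide hp).2 ⟨by simpa using h1, h⟩⟩)
    refine ⟨.node μ Tl Tr, ⟨⟨p₀, hp₀.1, (hY p₀ hp₀.1).2 ⟨k₀, hk₀, hp₀⟩⟩, hμ, half1, half2, vl, vr⟩,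
      ?_, ?_, ?_⟩
    · rw [he, PivotTree.pivots, ← pl, ← pr]
    · unfold PivotTree.runSum PivotTree.searchSum at *
      simp only [PivotTree.sum]
      linarith
    · intro k hk
      obtain ⟨hk1, hk2⟩ := hQ k hk
      rw [he]
      simp only
      split_ifs with h1 h2
      · obtain ⟨p, hp, hr⟩ := al k (List.mem_filter.2 ⟨hk, by simpa using h1⟩)
        exact ⟨p, hp, (rankIn_lowSide hr.1).2 hr⟩
      -- The rank inside the middle is k - |low|, counted from one; the list index is one less.
      · have hi : k - (lowSide a R S μ).card - 1 < mid.length := by omega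
        have hm := List.getElem_mem hi
        refine ⟨mid[k - (lowSide a R S μ).card - 1], List.getElem?_eq_getElem hi, ?_⟩
        have := rankIn_middle ((m3 _).1 hm)
          (rankIn_of_isKth m2 m3 hm (isKth_getElem_of_sorted a m1 hi))
        rwa [show (lowSide a R S μ).card + (k - (lowSide a R S μ).card - 1 + 1) = k by omega]
          at this
      · obtain ⟨p, hp, hr⟩ := ar _ (List.mem_map.2
          ⟨k, List.mem_filter.2 ⟨hk, by simpa using h2⟩, rfl⟩)
        exact ⟨p, hp, (rankIn_highSide hr.1).2 ⟨by omega, hr⟩⟩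

end Ranks

/-! ### The detection of the runs -/

section Detect

theorem detectRuns_cost {ι : Type} (le : ι → ι → Bool) (l : List ι) :
    (detectRuns l).cost le ≤ l.length := by
  induction l using detectRuns.induct with
  | case1 => simp [detectRuns]
  | case2 => simp [detectRuns]
  | case3 x y t ih =>
    simp only [detectRuns, Cmp.cost_bind, leq_cost, List.length_cons] at ih ⊢
    split <;> simp only [Cmp.cost_pure] <;> omega

/-- The hypothesis says that `R` counts descents along the list. Strict increase of `R` from list to
list, rather than mere difference, is what survives the induction when a new list is put in front.
-/
theorem detectRuns_spec {ι : Type} {α : Type*} [LinearOrder α] {a : ι → α} {R : ι → ℕ} (l : List ι)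
    (hl : l.IsChain fun x y => R y = R x + if a y < a x then 1 else 0) :
    ((detectRuns l).eval (leOf a)).flatten = l ∧
    (∀ r ∈ (detectRuns l).eval (leOf a), r ≠ []) ∧
    (∀ r ∈ (detectRuns l).eval (leOf a), r.Pairwise fun x y => a x ≤ a y) ∧
    (∀ r ∈ (detectRuns l).eval (leOf a), ∀ x ∈ r, ∀ y ∈ r, R x = R y) ∧
    ((detectRuns l).eval (leOf a)).Pairwise fun r s => ∀ x ∈ r, ∀ y ∈ s, R x < R y := by
  induction l using detectRuns.induct with
  | case1 => simp [detectRuns]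
  | case2 x => simp [detectRuns]
  | case3 x y t ih =>
    rw [List.isChain_cons_cons] at hl
    obtain ⟨h1, h2, h3, h4, h5⟩ := ih hl.2
    rw [detectRuns]
    simp only [Cmp.eval_bind, leq_eval]
    -- The first run of the rest begins with `y`, so the scan may compare `x` with `y` alone.
    obtain ⟨r, rs, e, hr⟩ : ∃ r rs, (detectRuns (y :: t)).eval (leOf a) = (y :: r) :: rs ∧
        r ++ rs.flatten = t := by
      rcases hd : (detectRuns (y :: t)).eval (leOf a) with _ | ⟨_ | ⟨z, r⟩, rs⟩
      · simp [hd] at h1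
      · exact absurd rfl (h2 [] (by simp [hd]))
      · rw [hd] at h1
        simp only [List.flatten_cons, List.cons_append, List.cons.injEq] at h1
        exact ⟨r, rs, by rw [h1.1], h1.2⟩
    rw [e] at h1 h2 h3 h4 h5 ⊢
    rw [List.pairwise_cons] at h5
    by_cases hxy : a x ≤ a y
    · have hR : R y = R x := by simpa [hxy.not_gt] using hl.1
      simp only [hxy, decide_true, Cmp.eval_pure]
      refine ⟨by simpa using h1, ?_, ?_, ?_, ?_⟩
      · intro s hs
        rcases List.mem_cons.1 hs with rfl | hs
        · simp
        · exact h2 s (List.mem_cons_of_mem _ hs)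
      · intro s hs
        rcases List.mem_cons.1 hs with rfl | hs
        · have h6 := h3 _ List.mem_cons_self
          refine List.pairwise_cons.2 ⟨fun z hz => ?_, h6⟩
          rcases List.mem_cons.1 hz with rfl | hz
          · exact hxy
          · exact hxy.trans ((List.pairwise_cons.1 h6).1 z hz)
        · exact h3 s (List.mem_cons_of_mem _ hs)
      · intro s hs
        rcases List.mem_cons.1 hs with rfl | hs
        · have h6 : ∀ z ∈ x :: y :: r, R z = R y := by
            intro z hz
            rcases List.mem_cons.1 hz with rfl | hz
            · exact hR.symm
            · exact h4 _ List.mem_cons_self z hz y List.mem_cons_self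
          exact fun z hz w hw => (h6 z hz).trans (h6 w hw).symm
        · exact h4 s (List.mem_cons_of_mem _ hs)
      · refine List.pairwise_cons.2 ⟨fun s hs z hz w hw => ?_, h5.2⟩
        rcases List.mem_cons.1 hz with rfl | hz
        · exact hR ▸ h5.1 s hs y List.mem_cons_self w hw
        · exact h5.1 s hs z hz w hw
    · have hR : R y = R x + 1 := by simpa [not_le.1 hxy] using hl.1
      simp only [hxy, decide_false, Cmp.eval_pure]
      refine ⟨by simpa using h1, ?_, ?_, ?_, ?_⟩
      · intro s hs
        rcases List.mem_cons.1 hs with rfl | hs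
        · simp
        · exact h2 s hs
      · intro s hs
        rcases List.mem_cons.1 hs with rfl | hs
        · simp
        · exact h3 s hs
      · intro s hs
        rcases List.mem_cons.1 hs with rfl | hs
        · simp
        · exact h4 s hs
      · refine List.pairwise_cons.2 ⟨fun s hs z hz w hw => ?_, List.pairwise_cons.2 h5⟩
        rw [List.mem_singleton.1 hz]
        rcases List.mem_cons.1 hs with rfl | hs
        · have := h4 _ List.mem_cons_self w hw y List.mem_cons_self
          omega
        · have := h5.1 s hs y List.mem_cons_self w hw
          omega

variable {α : Type*} [LinearOrder α] {n : ℕ}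

/-- The only position that can be a new descent is `p` itself. -/
theorem runOf_succ (a : Fin n → α) {j p : Fin n} (h : (j : ℕ) + 1 = p) :
    runOf a p = runOf a j + if a p < a j then 1 else 0 := by
  unfold runOf
  split_ifs with hlt
  · rw [← Finset.card_insert_of_notMem (a := p)]
    · congr 1
      ext k
      simp only [Finset.mem_filter, Finset.mem_univ, true_and, Finset.mem_insert, Fin.le_def]
      constructor
      · rintro ⟨h1, h2⟩
        by_cases hk : k = p
        · exact Or.inl hk
        · have : (k : ℕ) ≠ p := fun e => hk (Fin.ext e)
          exact Or.inr ⟨by omega, h2⟩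
      · rintro (rfl | ⟨h1, h2⟩)
        · exact ⟨le_rfl, j, h, hlt⟩
        · exact ⟨by omega, h2⟩
    · simp only [Finset.mem_filter, Finset.mem_univ, true_and, Fin.le_def]
      omega
  · rw [add_zero]
    congr 1
    ext k
    simp only [Finset.mem_filter, Finset.mem_univ, true_and, Fin.le_def]
    constructor
    · rintro ⟨h1, i, h2, h3⟩
      refine ⟨?_, i, h2, h3⟩
      by_contra hk
      have h4 : k = p := Fin.ext (by omega)
      have h5 : i = j := Fin.ext (by rw [h4] at h2; omega)
      exact hlt (h4 ▸ h5 ▸ h3)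
    · rintro ⟨h1, h2⟩
      exact ⟨by omega, h2⟩

theorem rep_detectRuns (a : Fin n → α) :
    Rep a (runOf a) ((detectRuns (List.finRange n)).eval (leOf a)) Finset.univ := by
  obtain ⟨h1, h2, h3, h4, h5⟩ := detectRuns_spec (a := a) (R := runOf a) (List.finRange n) (by
    rw [List.isChain_iff_getElem]
    intro i hi
    exact runOf_succ a (by simp))
  exact ⟨h2, h3, by rw [h1]; exact List.nodup_finRange n, fun p => by simp [h1], h4,
    h5.imp fun h x hx y hy => (h x hx y hy).ne⟩

/-- The whole input with fuel n; the additional n comparisons are those of the scan for the runs. -/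
theorem quickSynergyMultiSelection_spec {q : ℕ} {r : Fin q → ℕ} (a : Fin n → α)
    (hr : ∀ i, 1 ≤ r i ∧ r i ≤ n) : ∃ T : PivotTree (Fin n),
    T.Valid a (runOf a) (queryValues a r) Finset.univ ∧
    pivotSet a (List.ofFn r) = T.values a ∧
    ((quickSynergyMultiSelection (List.finRange n) (List.ofFn r)).cost (cmpOf a) : ℝ) ≤
      n + 158 * T.runSum a (runOf a) Finset.univ + 3 * T.searchSum a (runOf a) Finset.univ ∧
    ∀ i : Fin q, ∃ p : Fin n,
      ((quickSynergyMultiSelection (List.finRange n) (List.ofFn r)).eval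
        (cmpOf a)).1[(i : ℕ)]? = some (some p) ∧ HasRank a (r i) p := by
  have hrank : ∀ k p, RankIn a Finset.univ k p ↔ HasRank a k p := fun k p => by
    simp [RankIn, HasRank]
  obtain ⟨T, hT, hp, hc, ha⟩ := multiSelectRuns_spec (Y := queryValues a r) n _ _ (List.ofFn r)
    (rep_detectRuns a) (by simp)
    (fun k hk => by
      obtain ⟨i, rfl⟩ := (List.mem_ofFn' _ _).1 hk
      simpa using hr i)
    (fun p _ => by
      rw [mem_queryValues]
      constructor
      · rintro ⟨t, ⟨i, ht⟩, e⟩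
        refine ⟨r i, (List.mem_ofFn' _ _).2 ⟨i, rfl⟩, (hrank _ _).2 ?_⟩
        unfold HasRank at *
        rwa [e] at ht
      · rintro ⟨k, hk, h⟩
        obtain ⟨i, rfl⟩ := (List.mem_ofFn' _ _).1 hk
        exact ⟨p, ⟨i, (hrank _ _).1 h⟩, rfl⟩)
  have hcmp : cmpOf a = leOf a := rfl
  refine ⟨T, hT, ?_, ?_, fun i => ?_⟩
  · rw [pivotSet, PivotTree.values, ← hp, hcmp, quickSynergyMultiSelection]
    simp
  · have h1 : ((detectRuns (List.finRange n)).cost (leOf a) : ℝ) ≤ n := by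
      have := detectRuns_cost (leOf a) (List.finRange n)
      rw [List.length_finRange] at this
      exact_mod_cast this
    rw [hcmp, quickSynergyMultiSelection]
    simp only [Cmp.cost_bind, Cmp.cost_pure, List.length_finRange, add_zero]
    push_cast
    linarith
  · obtain ⟨p, h1, h2⟩ := ha (r i) ((List.mem_ofFn' _ _).2 ⟨i, rfl⟩)
    refine ⟨p, ?_, (hrank _ _).1 h2⟩
    rw [hcmp, quickSynergyMultiSelection]
    simp only [Cmp.eval_bind, Cmp.eval_pure, List.length_finRange]
    simp [h1]

end Detect

end QSMS

theorem mainTheorem3 :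
    ∃ C : ℝ, 0 < C ∧
      ∀ (α : Type*) [LinearOrder α] (n : ℕ) (a : Fin n → α) (q : ℕ) (r : Fin q → ℕ),
        Monotone r → (∀ i, 1 ≤ r i ∧ r i ≤ n) →
          (∀ i : Fin q, ∃ p : Fin n,
            ((QSMS.quickSynergyMultiSelection (List.finRange n) (List.ofFn r)).eval
              (QSMS.cmpOf a)).1[(i : ℕ)]? = some (some p) ∧ QSMS.HasRank a (r i) p) ∧
          ((QSMS.quickSynergyMultiSelection (List.finRange n) (List.ofFn r)).cost
              (QSMS.cmpOf a) : ℝ) ≤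
            C * QSMS.synergyBound a (QSMS.pivotSet a (List.ofFn r)) ∧
          QSMS.synergyBound a (QSMS.pivotSet a (List.ofFn r)) ≤ C * QSMS.queryBound n r := by
  -- The constant is 3 + 158 · 64 + 3 · 96, from n, `runSum` and `searchSum` in `le_synergyBound`;
  -- it exceeds the 415 of the second inequality.
  refine ⟨10403, by norm_num, fun α _ n a q r hm hr => ?_⟩
  obtain ⟨T, hT, hP, hc, ha⟩ := QSMS.quickSynergyMultiSelection_spec a hr
  obtain ⟨h1, h2, h3⟩ := QSMS.PivotTree.le_synergyBound hT
  have h4 := QSMS.PivotTree.synergyBound_le hm hr hT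
  have h5 := QSMS.le_queryBound hm hr
  have h6 : (0 : ℝ) ≤ n := Nat.cast_nonneg n
  rw [hP]
  exact ⟨ha, by linarith, by linarith⟩
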